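/- Let $X$ be a Riemann surface with a conformal metric $g_X$. Let $(E,\overline\partial_E)$ be a holomorphic vector bundle of finite rank on $X$, let $\theta$ be a Higgs field, i.e. a holomorphic section of $\mathrm{End}(E)\otimes K_X$, and let $h$ be a harmonic metric of $(E,\theta)$, i.e. a smooth Hermitian metric (linear in the first and conjugate-linear in the second variable) with $R(h)+[\theta,\theta_h^\dagger]=0$, where $R(h)$ is the curvature of the Chern connection $\overline\partial_E+\partial_{E,h}$ and $\theta_h^\dagger$ is the adjoint of $\theta$ with respect to $h$. Put $\mathbb D^1=\overline\partial_E+\theta+\partial_{E,h}+\theta_h^\dagger$. A smooth $E$-valued $1$-form $\tau$ on $X$ is called a harmonic $1$-form of $(E,\theta,h)$ if $(\overline\partial_E+\theta)\tau=0$ and $(\overline\partial_E+\theta)^{*}_{h,g_X}\tau=0$, where $(\overline\partial_E+\theta)^{*}_{h,g_X}$ is the formal adjoint with respect to $h$ and $g_X$. For $E$-valued $1$-forms put $h(a\otimes\kappa,b\otimes\kappa')=h(a,b)\,\kappa\wedge\overline{\kappa'}$, and for a section $a$ put $h(a,b\otimes\kappa')=h(a,b)\,\overline{\kappa'}$. Let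 $\tau_1,\tau_2$ be harmonic $1$-forms of $(E,\theta,h)$ on $X$, and let $U\subset X$ be a simply connected, relatively compact open subset with smooth boundary $\partial U$. Then there exists a smooth section $\sigma_1$ of $E$ on $U$ such that $\tau_{1|U}=\mathbb D^1\sigma_1$. Every such $\sigma_1$ extends continuously to $\overline U$, and, with $\partial U$ carrying the boundary orientation, \[ \sqrt{-1}\int_U\Bigl(h(\tau_1^{1,0},\tau_2^{1,0})-h(\tau_1^{0,1},\tau_2^{0,1})\Bigr) =\sqrt{-1}\int_{\partial U}\Bigl(h(\sigma_1,\tau_2^{1,0})-h(\sigma_1,\tau_2^{0,1})\Bigr). \] -/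

import Mathlib

open Bundle Manifold Set MeasureTheory
open scoped ContDiff ComplexConjugate

noncomputable section

namespace HiggsSurface

/-! ### Riemann surfaces -/

section Surface

/-- A complex manifold of dimension one is in particular a real smooth surface. -/
instance realManifold (X : Type*) [TopologicalSpace X] [ChartedSpace ℂ X]
    [IsManifold 𝓘(ℂ, ℂ) ω X] : IsManifold 𝓘(ℝ, ℂ) ∞ X := by
  apply isManifold_of_contDiffOn
  intro e e' he he'
  have h := ((contDiffGroupoid ω 𝓘(ℂ, ℂ)).compatible he he').1
  exact (ContDiffOn.restrict_scalars ℝ h).of_le le_top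

variable {X : Type*} [TopologicalSpace X] [ChartedSpace ℂ X]

/-- The tangent space of the Riemann surface `X` at `x`: a complex line, whose underlying real
vector space is the real tangent plane. -/
abbrev T (x : X) : Type := TangentSpace 𝓘(ℂ, ℂ) x

/-- The real differential of a function with values in a complex vector space. -/
def dReal {G : Type*} [NormedAddCommGroup G] [NormedSpace ℂ G] (f : X → G) (x : X) (v : T x) : G :=
  mfderiv 𝓘(ℝ, ℂ) 𝓘(ℝ, G) f x v

/-- The part of type `(1,0)` of a vector-valued real covector. -/
def part10 {V W : Type*} [AddCommGroup V] [Module ℂ V] [AddCommGroup W] [Module ℂ W]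
    (α : V → W) (v : V) : W :=
  (1 / 2 : ℂ) • (α v - Complex.I • α (Complex.I • v))

/-- The part of type `(0,1)` of a vector-valued real covector. -/
def part01 {V W : Type*} [AddCommGroup V] [Module ℂ V] [AddCommGroup W] [Module ℂ W]
    (α : V → W) (v : V) : W :=
  (1 / 2 : ℂ) • (α v + Complex.I • α (Complex.I • v))

variable [IsManifold 𝓘(ℂ, ℂ) ω X]

/-- The coordinate vector field with constant coefficient `c` in the chart `z` at `x₀`, that is,
the field on which `dz` takes the value `c`. -/
def coordVec (x₀ : X) (c : ℂ) (y : X) : T y :=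
  (trivializationAt ℂ (fun x : X => TangentSpace 𝓘(ℂ, ℂ) x) x₀).symmL ℂ y c

variable (X) in
/-- A conformal metric: a smooth Riemannian metric for which multiplication by `i` on the tangent
spaces is an isometry. -/
structure ConformalMetric where
  inner : ∀ x : X, T x →ₗ[ℝ] T x →ₗ[ℝ] ℝ
  symm : ∀ x v w, inner x v w = inner x w v
  pos : ∀ x v, v ≠ 0 → 0 < inner x v v
  conformal : ∀ x v w, inner x (Complex.I • v) (Complex.I • w) = inner x v w
  smooth : ∀ (x₀ : X) (c c' : ℂ), ContMDiffOn 𝓘(ℝ, ℂ) 𝓘(ℝ, ℝ) ∞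
    (fun y => inner y (coordVec x₀ c y) (coordVec x₀ c' y)) (chartAt ℂ x₀).source

/-- The area form of a conformal metric, for the complex orientation: `vol (v, i v) = |v|²`. -/
def ConformalMetric.vol (g : ConformalMetric X) (x : X) (v w : T x) : ℝ :=
  g.inner x (Complex.I • v) w

/-! ### Integration of 2-forms on the surface and of 1-forms along a smooth boundary -/

variable [T2Space X] [SigmaCompactSpace X]

variable (X) in
/-- A partition of unity subordinate to the charts. -/
def chartPartition : SmoothPartitionOfUnity X 𝓘(ℝ, ℂ) X univ :=
  (SmoothPartitionOfUnity.exists_isSubordinate_chartAt_source 𝓘(ℝ, ℂ) X).choose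

/-- The integral over `A` of the 2-form `ψ`, computed by a partition of unity: in the chart
`z = x + i y`, the form is `ψ (∂/∂x, ∂/∂y) dx ∧ dy`. -/
def surfaceIntegral (A : Set X) (ψ : ∀ x : X, T x → T x → ℂ) : ℂ :=
  ∑ᶠ i : X, ∫ z in (chartAt ℂ i).target ∩ (chartAt ℂ i).symm ⁻¹' A,
    (chartPartition X i ((chartAt ℂ i).symm z) : ℂ) *
      ψ ((chartAt ℂ i).symm z) (coordVec i 1 ((chartAt ℂ i).symm z))
        (coordVec i Complex.I ((chartAt ℂ i).symm z))

/-- An orientation preserving real smooth chart `φ` in which `U` is the part `Im φ > 0`; hence the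
frontier of `U` is the part `Im φ = 0`, and its boundary orientation is that of increasing `Re φ`. -/
structure IsBoundaryChart (U : Set X) (φ : OpenPartialHomeomorph X ℂ) : Prop where
  smooth : φ ∈ IsManifold.maximalAtlas 𝓘(ℝ, ℂ) ∞ X
  oriented : ∀ x ∈ φ.source,
    0 < ContinuousLinearMap.det (R := ℝ) (M := ℂ) (mfderiv 𝓘(ℝ, ℂ) 𝓘(ℝ, ℂ) φ x)
  straight : ∀ x ∈ φ.source, x ∈ U ↔ 0 < (φ x).im

/-- The open set `U` has smooth boundary. -/
def HasSmoothBoundary (U : Set X) : Prop :=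
  ∀ p ∈ frontier U, ∃ φ : OpenPartialHomeomorph X ℂ, p ∈ φ.source ∧ IsBoundaryChart U φ

/-- A boundary chart around the frontier point `p`. -/
def boundaryChart {U : Set X} (hU : HasSmoothBoundary U) (p : frontier U) :
    OpenPartialHomeomorph X ℂ :=
  (hU p p.2).choose

theorem exists_boundaryPartition {U : Set X} (hU : HasSmoothBoundary U) :
    ∃ f : SmoothPartitionOfUnity (frontier U) 𝓘(ℝ, ℂ) X (frontier U),
      f.IsSubordinate fun p => (boundaryChart hU p).source :=
  SmoothPartitionOfUnity.exists_isSubordinate 𝓘(ℝ, ℂ) isClosed_frontier _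
    (fun p => (boundaryChart hU p).open_source)
    fun p hp => mem_iUnion_of_mem ⟨p, hp⟩ (hU p hp).choose_spec.1

/-- A partition of unity along the frontier, subordinate to boundary charts. -/
def boundaryPartition {U : Set X} (hU : HasSmoothBoundary U) :
    SmoothPartitionOfUnity (frontier U) 𝓘(ℝ, ℂ) X (frontier U) :=
  (exists_boundaryPartition hU).choose

/-- The integral of the 1-form `η` over the boundary of `U` with its boundary orientation,
computed by a partition of unity: in a boundary chart `φ` the boundary is parametrized by
`t ↦ φ⁻¹ t` with `t` real. -/
def boundaryIntegral {U : Set X} (hU : HasSmoothBoundary U) (η : ∀ x : X, T x → ℂ) : ℂ :=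
  ∑ᶠ p : frontier U, ∫ t in {t : ℝ | (t : ℂ) ∈ (boundaryChart hU p).target},
    (boundaryPartition hU p ((boundaryChart hU p).symm t) : ℂ) *
      η ((boundaryChart hU p).symm t)
        (mfderiv 𝓘(ℝ, ℂ) 𝓘(ℝ, ℂ) (boundaryChart hU p).symm (t : ℂ) (1 : ℂ))

end Surface

/-! ### Higgs bundles with a Hermitian metric -/

section Bundle

variable {X : Type*} [TopologicalSpace X] [ChartedSpace ℂ X] [IsManifold 𝓘(ℂ, ℂ) ω X]
  (F : Type*) [NormedAddCommGroup F] [NormedSpace ℂ F] [FiniteDimensional ℂ F]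
  (E : X → Type*) [∀ x, AddCommGroup (E x)] [∀ x, Module ℂ (E x)]
  [TopologicalSpace (TotalSpace F E)] [∀ x, TopologicalSpace (E x)]
  [FiberBundle F E] [VectorBundle ℂ F E] [ContMDiffVectorBundle ω F E 𝓘(ℂ, ℂ)]

/-- A Higgs field: a holomorphic section of `End E ⊗ K`. Holomorphy is tested in a holomorphic
trivialization and a holomorphic chart around each point. -/
structure HiggsField where
  toFun : ∀ x : X, T x →ₗ[ℂ] Module.End ℂ (E x)
  holomorphic : ∀ (x₀ : X) (u : F), MDifferentiableOn 𝓘(ℂ, ℂ) 𝓘(ℂ, F)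
    (fun y => (trivializationAt F E x₀
      ⟨y, toFun y (coordVec x₀ 1 y) ((trivializationAt F E x₀).symm y u)⟩).2)
    ((chartAt ℂ x₀).source ∩ (trivializationAt F E x₀).baseSet)

/-- A smooth Hermitian metric, linear in the first and conjugate-linear in the second variable. -/
structure HermitianMetric where
  inner : ∀ x : X, E x →ₗ[ℂ] E x →ₗ⋆[ℂ] ℂ
  symm : ∀ x a b, inner x b a = conj (inner x a b)
  pos : ∀ x a, a ≠ 0 → 0 < (inner x a a).re
  smooth : ∀ (x₀ : X) (u u' : F), ContMDiffOn 𝓘(ℝ, ℂ) 𝓘(ℝ, ℂ) ∞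
    (fun y => inner y ((trivializationAt F E x₀).symm y u) ((trivializationAt F E x₀).symm y u'))
    (trivializationAt F E x₀).baseSet

variable {E}

/-- `s` is a (real) smooth section of `E` over `A`. -/
def SmoothSectionOn (A : Set X) (s : ∀ x, E x) : Prop :=
  ContMDiffOn 𝓘(ℝ, ℂ) (𝓘(ℝ, ℂ).prod 𝓘(ℝ, F)) ∞ (fun x => TotalSpace.mk' F x (s x)) A

/-- `s` is a continuous section of `E` over `A`. -/
def ContinuousSectionOn (A : Set X) (s : ∀ x, E x) : Prop :=
  ContinuousOn (fun x => TotalSpace.mk' F x (s x)) A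

/-- `τ` is a smooth `E`-valued 1-form: its coefficients in charts and trivializations are smooth. -/
def SmoothForm (τ : ∀ x : X, T x →ₗ[ℝ] E x) : Prop :=
  ∀ (x₀ : X) (c : ℂ), ContMDiffOn 𝓘(ℝ, ℂ) 𝓘(ℝ, F) ∞
    (fun y => (trivializationAt F E x₀ ⟨y, τ y (coordVec x₀ c y)⟩).2)
    ((chartAt ℂ x₀).source ∩ (trivializationAt F E x₀).baseSet)

/-- The operator `∂̄_E` of the holomorphic bundle `E`: the `(0,1)`-part of the differential in a
holomorphic trivialization. -/
def dbar (s : ∀ x, E x) (x : X) (v : T x) : E x :=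
  (trivializationAt F E x).symm x
    (part01 (dReal (fun y => (trivializationAt F E x ⟨y, s y⟩).2) x) v)

variable {F}

/-- The vector `w` of `E x` with `h (w, a) = ℓ a` for all `a`, where `ℓ` is a conjugate-linear
functional. -/
def HermitianMetric.riesz (h : HermitianMetric F E) (x : X) (ℓ : E x → ℂ) : E x :=
  haveI : Nonempty (E x) := ⟨0⟩
  Classical.epsilon fun w => ∀ a, h.inner x w a = ℓ a

/-- The `(1,0)`-part `∂_{E,h}` of the Chern connection, determined by
`∂ (h (s, t)) = h (∂_{E,h} s, t)` for the local holomorphic sections `t` that are constant in a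
holomorphic trivialization. -/
def HermitianMetric.del (h : HermitianMetric F E) (s : ∀ x, E x) (x : X) (v : T x) : E x :=
  h.riesz x fun a => part10 (dReal (fun y => h.inner y (s y)
    ((trivializationAt F E x).symm y (trivializationAt F E x ⟨x, a⟩).2)) x) v

/-- The Chern connection `∇ = ∂̄_E + ∂_{E,h}`. -/
def HermitianMetric.chern (h : HermitianMetric F E) (s : ∀ x, E x) (x : X) (v : T x) : E x :=
  dbar F s x v + h.del s x v

/-- The adjoint of the Higgs field: `h (θ†(v) b, a) = h (b, θ(v) a)`. -/
def HiggsField.adj (θ : HiggsField F E) (h : HermitianMetric F E) (x : X) (v : T x) (b : E x) :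
    E x :=
  h.riesz x fun a => h.inner x b (θ.toFun x v a)

/-- `∂̄_E + θ` on sections. -/
def opD'' (θ : HiggsField F E) (s : ∀ x, E x) (x : X) (v : T x) : E x :=
  dbar F s x v + θ.toFun x v (s x)

/-- `∂_{E,h} + θ†` on sections. -/
def opD' (θ : HiggsField F E) (h : HermitianMetric F E) (s : ∀ x, E x) (x : X) (v : T x) : E x :=
  h.del s x v + θ.adj h x v (s x)

/-- `𝔻^μ = ∂̄_E + θ + μ (∂_{E,h} + θ†)` on sections. -/
def opDD (μ : ℂ) (θ : HiggsField F E) (h : HermitianMetric F E) (s : ∀ x, E x) (x : X) (v : T x) :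
    E x :=
  opD'' θ s x v + μ • opD' θ h s x v

/-- The extension to 1-forms of a first order operator `D` from sections to 1-forms, with values in
2-forms: in a chart with coordinate vector fields `V`, `W`,
`(D τ)(V, W) = (D (τ W)) V - (D (τ V)) W`; that is, `D (s dx) = D s ∧ dx`, `D (s dy) = D s ∧ dy`. -/
def ext1 (D : (∀ x, E x) → ∀ x : X, T x → E x) (τ : ∀ x : X, T x → E x) (x : X) (v w : T x) :
    E x :=
  D (fun y => τ y (coordVec x w y)) x v - D (fun y => τ y (coordVec x v y)) x w

/-- `h` is a harmonic metric of `(E, θ)`: `R(h) + [θ, θ†] = 0`, where `R(h) = ∇ ∘ ∇`. -/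
def IsHarmonicMetric (θ : HiggsField F E) (h : HermitianMetric F E) : Prop :=
  ∀ (V : Set X), IsOpen V → ∀ s : ∀ x, E x, SmoothSectionOn F V s → ∀ x ∈ V, ∀ v w : T x,
    ext1 h.chern (h.chern s) x v w
      + (θ.toFun x v (θ.adj h x w (s x)) - θ.toFun x w (θ.adj h x v (s x))
        + (θ.adj h x v (θ.toFun x w (s x)) - θ.adj h x w (θ.toFun x v (s x)))) = 0

/-- For `E`-valued 1-forms `α`, `β`, the 2-form `h (α, β)`, with
`h (a ⊗ κ, b ⊗ κ') = h (a, b) κ ∧ conj κ'`. -/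
def HermitianMetric.wedge (h : HermitianMetric F E) (α β : ∀ x : X, T x → E x) (x : X)
    (v w : T x) : ℂ :=
  h.inner x (α x v) (β x w) - h.inner x (α x w) (β x v)

/-- The pointwise Hermitian product of `E`-valued 1-forms induced by `h` and `g`: the sum of
`h (α e, β e)` over a `g`-orthonormal basis, here proportional to `v`, `i v`. -/
def formInner (g : ConformalMetric X) (h : HermitianMetric F E) (α β : ∀ x : X, T x → E x)
    (x : X) : ℂ :=
  let v : T x := coordVec x 1 x
  (h.inner x (α x v) (β x v) + h.inner x (α x (Complex.I • v)) (β x (Complex.I • v)))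
    / (g.inner x v v : ℂ)

variable [T2Space X] [SigmaCompactSpace X]

/-- `β` is the image of the 1-form `τ` under the formal adjoint of the operator `D` from sections
to 1-forms, with respect to `h` and `g`: `(D s, τ) = (s, β)` in the `L²` sense for all smooth
sections `s` with compact support. -/
def IsFormalAdjointImage (g : ConformalMetric X) (h : HermitianMetric F E)
    (D : (∀ x, E x) → ∀ x : X, T x → E x) (τ : ∀ x : X, T x → E x) (β : ∀ x, E x) : Prop :=
  ∀ s : ∀ x, E x, SmoothSectionOn F univ s → (∃ K : Set X, IsCompact K ∧ ∀ x ∉ K, s x = 0) →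
    surfaceIntegral univ (fun x v w => formInner g h (D s) τ x * (g.vol x v w : ℂ)) =
      surfaceIntegral univ (fun x v w => h.inner x (s x) (β x) * (g.vol x v w : ℂ))

/-- `τ` is a harmonic 1-form of `(E, θ, h)`: it is smooth, `(∂̄_E + θ) τ = 0`, and
`(∂̄_E + θ)^* τ = 0` for the formal adjoint with respect to `h` and `g`. -/
structure IsHarmonicForm (g : ConformalMetric X) (θ : HiggsField F E) (h : HermitianMetric F E)
    (τ : ∀ x : X, T x →ₗ[ℝ] E x) : Prop where
  smooth : SmoothForm F τ
  closed : ∀ (x : X) (v w : T x), ext1 (opD'' θ) (fun y => τ y) x v w = 0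
  coclosed : IsFormalAdjointImage g h (opD'' θ) (fun x => τ x) (fun _ => 0)

/-- `σ` is a smooth section over `U` with `𝔻^1 σ = τ` on `U`. -/
def IsPrimitiveOn (θ : HiggsField F E) (h : HermitianMetric F E) (U : Set X)
    (τ : ∀ x : X, T x →ₗ[ℝ] E x) (σ : ∀ x, E x) : Prop :=
  SmoothSectionOn F U σ ∧ ∀ x ∈ U, ∀ v : T x, opDD 1 θ h σ x v = τ x v

end Bundle

end HiggsSurface

end

open HiggsSurface

open scoped Topology

noncomputable section

set_option linter.unusedSectionVars false

namespace HiggsSurface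

/-! ### Total differential equations -/

section TotalDifferential

open Filter Topology

variable {V G : Type*} [NormedAddCommGroup V] [NormedSpace ℝ V]
  [NormedAddCommGroup G] [NormedSpace ℝ G]

/-! Write `τ = α dz + β dz̄` in a holomorphic frame and coordinate, and let `H` be the metric, `G`
the Chern coefficient, `Θ` the Higgs field and `S` its adjoint there. Closedness under `∂̄_E + θ`
reads `∂α/∂z̄ = Θβ`. The product of 1-forms times the area form is conformally invariant on a
surface, so `g` drops out of the formal adjoint. Testing against sections supported in a chart and
integrating by parts therefore turns coclosedness into `∂β/∂z + Gβ = Sα`, which is closedness under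
`∂_{E,h} + θ†` (`LocalHiggs.coclosed_of_integral`, `IsHarmonicForm.isHarmonicPair`). Hence a
harmonic form is closed for `𝔻^1`, whose local connection form is `(G + Θ) dz + S dz̄`. The harmonic
metric equation, holomorphy of `θ` and the identity `∂_{E,h} θ† = 0` make this connection flat
(`LocalHiggs.connForm_flat`).

Flatness and closedness are the integrability conditions of `du = τ - B u`. Local solutions with
prescribed initial value come from a Picard iteration built on the radial Poincaré homotopy
(`exists_hasFDerivAt_eq_sub`); uniqueness is a Grönwall argument along segments. The germs of
solutions form a covering space, so over a simply connected `U` there is a global one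
(`LocalSystem.exists_global`, `exists_primitive`). At a frontier point, `U` looks like a half disc,
which is connected. A primitive on a full neighbourhood that agrees with `σ` at one point of the
half disc therefore agrees on all of it, and so `σ` extends smoothly across the frontier locally
(`exists_boundary_extension`).

The integral formula is Stokes' theorem for `η = h(σ₁, τ₂^{1,0}) - h(σ₁, τ₂^{0,1})`, once `dη` is
known to be the integrand on the left (`isStokesPair_boundaryForm`). The Leibniz rule for the Chern
connection produces the two desired terms, and the terms in `Θ` and `S` cancel in pairs by
adjointness. Stokes itself (`IsStokesPair.surfaceIntegral_eq_boundaryIntegral`) reduces by a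
partition of unity to the divergence theorem on a rectangle in the upper half plane. The integrals
in the statement are tied to chosen charts and partitions, so the change of variables formula is
used to recompute them in other oriented charts (`surfaceIntegral_eq_sum`). -/

theorem hasFDerivAt_intervalIntegral_of_contDiff [ProperSpace V] {K : V × ℝ → G}
    (hK : ContDiff ℝ 1 K) (z : V) :
    HasFDerivAt (fun z => ∫ t in (0 : ℝ)..1, K (z, t))
      (∫ t in (0 : ℝ)..1, (fderiv ℝ K (z, t)).comp (ContinuousLinearMap.inl ℝ V ℝ)) z := by
  have hc : Continuous fun p : V × ℝ =>
      (fderiv ℝ K p).comp (ContinuousLinearMap.inl ℝ V ℝ) :=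
    (hK.continuous_fderiv (by simp)).clm_comp continuous_const
  obtain ⟨C, hC⟩ := ((isCompact_closedBall z 1).prod
    (isCompact_Icc (a := (0 : ℝ)) (b := 1))).exists_bound_of_continuousOn hc.continuousOn
  refine intervalIntegral.hasFDerivAt_integral_of_dominated_of_fderiv_le
    (F' := fun z t => (fderiv ℝ K (z, t)).comp (ContinuousLinearMap.inl ℝ V ℝ))
    (bound := fun _ => C)
    (Metric.closedBall_mem_nhds z one_pos) ?_ ?_ ?_ ?_ ?_ ?_
  · exact Eventually.of_forall fun y =>
      (hK.continuous.comp (by fun_prop : Continuous fun t : ℝ => (y, t))).aestronglyMeasurable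
  · exact (hK.continuous.comp (by fun_prop : Continuous fun t : ℝ => (z, t))).intervalIntegrable _ _
  · exact (hc.comp (by fun_prop : Continuous fun t : ℝ => (z, t))).aestronglyMeasurable
  · refine Eventually.of_forall fun t ht y hy => hC (y, t) ⟨hy, ?_⟩
    rw [uIoc_of_le zero_le_one] at ht
    exact ⟨ht.1.le, ht.2⟩
  · exact intervalIntegrable_const
  · refine Eventually.of_forall fun t _ y _ => ?_
    have h1 : HasFDerivAt K (fderiv ℝ K (y, t)) (y, t) :=
      (hK.differentiable (by simp)).differentiableAt.hasFDerivAt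
    exact h1.comp y (hasFDerivAt_prodMk_left y t)

theorem contDiff_one_intervalIntegral [ProperSpace V] {K : V × ℝ → G}
    (hK : ContDiff ℝ 1 K) : ContDiff ℝ 1 (fun z => ∫ t in (0 : ℝ)..1, K (z, t)) := by
  rw [contDiff_one_iff_fderiv]
  have hc : Continuous fun p : V × ℝ =>
      (fderiv ℝ K p).comp (ContinuousLinearMap.inl ℝ V ℝ) :=
    (hK.continuous_fderiv (by simp)).clm_comp continuous_const
  refine ⟨fun z => (hasFDerivAt_intervalIntegral_of_contDiff hK z).differentiableAt, ?_⟩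
  rw [funext fun z => (hasFDerivAt_intervalIntegral_of_contDiff hK z).fderiv]
  exact intervalIntegral.continuous_parametric_intervalIntegral_of_continuous' (by exact hc) _ _

/-- The integral of the 1-form `α` along the segment from `q` to `z`. -/
def radialPrimitive (q : V) (α : V → V →L[ℝ] G) (z : V) : G :=
  ∫ t in (0 : ℝ)..1, α (q + t • (z - q)) (z - q)

theorem contDiff_radialPrimitive [ProperSpace V] {α : V → V →L[ℝ] G} (hα : ContDiff ℝ 1 α)
    (q : V) : ContDiff ℝ 1 (radialPrimitive q α) :=
  contDiff_one_intervalIntegral (K := fun p : V × ℝ => α (q + p.2 • (p.1 - q)) (p.1 - q))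
    (by fun_prop)

/-- The Poincaré homotopy formula: the radial primitive fails to be a primitive by the radial
contraction of `dα`. Differentiate under the integral sign, then compare with the derivative in `t`
of `t α(q + t(z - q)) v`, which integrates to `α z v`. -/
theorem fderiv_radialPrimitive [ProperSpace V] [CompleteSpace G] {α : V → V →L[ℝ] G}
    (hα : ContDiff ℝ 1 α) (q z v : V) :
    fderiv ℝ (radialPrimitive q α) z v = α z v + ∫ t in (0 : ℝ)..1,
      t • (fderiv ℝ α (q + t • (z - q)) v (z - q) - fderiv ℝ α (q + t • (z - q)) (z - q) v) := by
  obtain ⟨K, hKdef⟩ : ∃ K : V × ℝ → G, K = fun p => α (q + p.2 • (p.1 - q)) (p.1 - q) := ⟨_, rfl⟩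
  have hK : ContDiff ℝ 1 K := by rw [hKdef]; fun_prop
  have hα' : Continuous (fderiv ℝ α) := hα.continuous_fderiv (by simp)
  have hαd (x : V) : HasFDerivAt α (fderiv ℝ α x) x :=
    (hα.differentiable (by simp)).differentiableAt.hasFDerivAt
  have h1 := (hasFDerivAt_intervalIntegral_of_contDiff hK z).fderiv
  have h2 : ∀ t : ℝ, ((fderiv ℝ K (z, t)).comp
      (ContinuousLinearMap.inl ℝ V ℝ)) v
      = t • fderiv ℝ α (q + t • (z - q)) v (z - q) + α (q + t • (z - q)) v := by
    intro t
    have e1 : HasFDerivAt (fun y : V => α (q + t • (y - q)) (y - q))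
        ((fderiv ℝ K (z, t)).comp
          (ContinuousLinearMap.inl ℝ V ℝ)) z := by
      have e0 : HasFDerivAt K (fderiv ℝ K (z, t)) (z, t) :=
        (hK.differentiable (by simp)).differentiableAt.hasFDerivAt
      have := HasFDerivAt.comp (f := fun y : V => (y, t)) z e0 (hasFDerivAt_prodMk_left z t)
      rwa [hKdef] at this ⊢
    have e2 : HasFDerivAt (fun y : V => q + t • (y - q)) (t • ContinuousLinearMap.id ℝ V) z :=
      (((hasFDerivAt_id z).sub_const q).const_smul t).const_add q
    have e3 : HasFDerivAt (fun y : V => α (q + t • (y - q)))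
        ((fderiv ℝ α (q + t • (z - q))).comp (t • ContinuousLinearMap.id ℝ V)) z :=
      (hαd (q + t • (z - q))).comp z e2
    rw [e1.unique (e3.clm_apply ((hasFDerivAt_id z).sub_const q))]
    simp [add_comm]
  have hcont : Continuous fun t : ℝ => (fderiv ℝ K (z, t)).comp (ContinuousLinearMap.inl ℝ V ℝ) :=
    ((hK.continuous_fderiv (by simp)).comp
      (by fun_prop : Continuous fun t : ℝ => (z, t))).clm_comp continuous_const
  have h3 : α z v = ∫ t in (0 : ℝ)..1,
      (α (q + t • (z - q)) v + t • fderiv ℝ α (q + t • (z - q)) (z - q) v) := by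
    have : ∀ t ∈ uIcc (0 : ℝ) 1, HasDerivAt (fun t : ℝ => t • α (q + t • (z - q)) v)
        (α (q + t • (z - q)) v + t • fderiv ℝ α (q + t • (z - q)) (z - q) v) t := by
      intro t _
      have e2 : HasDerivAt (fun t : ℝ => q + t • (z - q)) (z - q) t := by
        simpa using ((hasDerivAt_id t).smul_const (z - q)).const_add q
      have e3 : HasDerivAt (fun t : ℝ => α (q + t • (z - q)))
          (fderiv ℝ α (q + t • (z - q)) (z - q)) t :=
        (hαd (q + t • (z - q))).comp_hasDerivAt t e2
      have e4 : HasDerivAt (fun t : ℝ => α (q + t • (z - q)) v)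
          (fderiv ℝ α (q + t • (z - q)) (z - q) v) t := by
        simpa using e3.clm_apply (hasDerivAt_const t v)
      have e5 := (hasDerivAt_id' t).fun_smul e4
      rwa [one_smul, add_comm] at e5
    rw [intervalIntegral.integral_eq_sub_of_hasDerivAt this]
    · simp
    · apply Continuous.intervalIntegrable
      fun_prop
  rw [show radialPrimitive q α = fun z => ∫ t in (0 : ℝ)..1, K (z, t) by rw [hKdef]; rfl, h1, ContinuousLinearMap.intervalIntegral_apply (hcont.intervalIntegrable _ _), h3,
    ← intervalIntegral.integral_add]
  · refine intervalIntegral.integral_congr fun t _ => ?_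
    simp only [h2, smul_sub]
    abel
  · apply Continuous.intervalIntegrable
    fun_prop
  · apply Continuous.intervalIntegrable
    fun_prop

theorem norm_radialPrimitive_le {s : Set V} (hs : Convex ℝ s) {q z : V} (hq : q ∈ s) (hz : z ∈ s)
    {α : V → V →L[ℝ] G} {C : ℝ} (hC : ∀ x ∈ s, ‖α x‖ ≤ C) :
    ‖radialPrimitive q α z‖ ≤ C * ‖z - q‖ := by
  have := intervalIntegral.norm_integral_le_of_norm_le_const (a := (0 : ℝ)) (b := 1)
    (f := fun t => α (q + t • (z - q)) (z - q)) (C := C * ‖z - q‖) ?_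
  · simpa [radialPrimitive] using this
  · intro t ht
    rw [uIoc_of_le zero_le_one] at ht
    refine (ContinuousLinearMap.le_opNorm _ _).trans ?_
    gcongr
    exact hC _ (hs.add_smul_sub_mem hq hz ⟨ht.1.le, ht.2⟩)

theorem radialPrimitive_sub {α β : V → V →L[ℝ] G} (hα : Continuous α) (hβ : Continuous β)
    (q z : V) :
    radialPrimitive q (fun x => α x - β x) z = radialPrimitive q α z - radialPrimitive q β z := by
  unfold radialPrimitive
  rw [← intervalIntegral.integral_sub]
  · simp
  · apply Continuous.intervalIntegrable
    fun_prop
  · apply Continuous.intervalIntegrable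
    fun_prop

/-- The successive approximations to the solution of `du = τ - B u` with value `f₀` at `q`. -/
def picardSeq (B : V → G →L[ℝ] V →L[ℝ] G) (τ : V → V →L[ℝ] G) (q : V) (f₀ : G) : ℕ → V → G
  | 0 => fun _ => f₀
  | n + 1 => fun z => f₀ + radialPrimitive q (fun x => τ x - B x (picardSeq B τ q f₀ n x)) z

theorem contDiff_picardSeq [ProperSpace V] {B : V → G →L[ℝ] V →L[ℝ] G} {τ : V → V →L[ℝ] G}
    (hB : ContDiff ℝ 1 B) (hτ : ContDiff ℝ 1 τ) (q : V) (f₀ : G) (n : ℕ) :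
    ContDiff ℝ 1 (picardSeq B τ q f₀ n) := by
  induction n with
  | zero => exact contDiff_const
  | succ n ih =>
    exact contDiff_const.add (contDiff_radialPrimitive (hτ.sub (hB.clm_apply ih)) q)

/-- Closedness of `τ` and flatness of `B` remove everything from `d(τ - B u)` except terms linear in
the defect `du + B u - τ`. So an approximate solution gives an approximately closed right-hand side.
-/
theorem antisymm_fderiv_sub {B : V → G →L[ℝ] V →L[ℝ] G} {τ : V → V →L[ℝ] G} {u : V → G} {x : V}
    (hB : DifferentiableAt ℝ B x) (hτ : DifferentiableAt ℝ τ x) (hu : DifferentiableAt ℝ u x)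
    (hflat : ∀ f v w, fderiv ℝ B x v f w - fderiv ℝ B x w f v
      + B x (B x f w) v - B x (B x f v) w = 0)
    (hclosed : ∀ v w, fderiv ℝ τ x v w - fderiv ℝ τ x w v + B x (τ x w) v - B x (τ x v) w = 0)
    (v y : V) :
    fderiv ℝ (fun x => τ x - B x (u x)) x v y - fderiv ℝ (fun x => τ x - B x (u x)) x y v
      = B x (fderiv ℝ u x y + B x (u x) y - τ x y) v
        - B x (fderiv ℝ u x v + B x (u x) v - τ x v) y := by
  have h : HasFDerivAt (fun x => τ x - B x (u x)) _ x :=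
    hτ.hasFDerivAt.sub (hB.hasFDerivAt.clm_apply hu.hasFDerivAt)
  rw [h.fderiv]
  have h1 := hflat (u x) v y
  have h2 := hclosed v y
  simp only [sub_apply, add_apply,
    ContinuousLinearMap.comp_apply, ContinuousLinearMap.flip_apply, map_add, map_sub]
  rw [← sub_eq_zero]
  have h3 := congrArg₂ (· - ·) h2 h1
  simp only [sub_zero] at h3
  rw [← h3]
  abel

/-- A quantitative Frobenius theorem. The iterates contract in sup norm because `a` times the
diameter of `s` is small. By the homotopy formula and `antisymm_fderiv_sub`, the defect of each
iterate is controlled by the last increment and half the previous defect, so the derivatives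
converge uniformly as well. -/
theorem exists_hasFDerivAt_eq_sub [ProperSpace V] [CompleteSpace G]
    {B : V → G →L[ℝ] V →L[ℝ] G} {τ : V → V →L[ℝ] G}
    (hB : ContDiff ℝ 1 B) (hτ : ContDiff ℝ 1 τ) {s : Set V} (hs : Convex ℝ s) (hso : IsOpen s)
    {a C : ℝ} (ha : ∀ x ∈ s, ‖B x‖ ≤ a) (hC : ∀ x ∈ s, ‖τ x‖ ≤ C)
    (hd : ∀ x ∈ s, ∀ y ∈ s, ‖x - y‖ ≤ 1) (had : ∀ x ∈ s, ∀ y ∈ s, a * ‖x - y‖ ≤ 1 / 4)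
    (hflat : ∀ x ∈ s, ∀ f v w, fderiv ℝ B x v f w - fderiv ℝ B x w f v
      + B x (B x f w) v - B x (B x f v) w = 0)
    (hclosed : ∀ x ∈ s, ∀ v w,
      fderiv ℝ τ x v w - fderiv ℝ τ x w v + B x (τ x w) v - B x (τ x v) w = 0)
    {q : V} (hq : q ∈ s) (f₀ : G) :
    ∃ u : V → G, u q = f₀ ∧ ∀ x ∈ s, HasFDerivAt u (τ x - B x (u x)) x := by
  set u := picardSeq B τ q f₀ with hu
  have huc (n) : ContDiff ℝ 1 (u n) := contDiff_picardSeq hB hτ q f₀ n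
  have hud (n x) : DifferentiableAt ℝ (u n) x := ((huc n).differentiable (by simp)) x
  have hα (n) : ContDiff ℝ 1 (fun x => τ x - B x (u n x)) := hτ.sub (hB.clm_apply (huc n))
  have ha0 : 0 ≤ a := (norm_nonneg (B q)).trans (ha q hq)
  have hC0 : 0 ≤ C := (norm_nonneg (τ q)).trans (hC q hq)
  have hstep (n z) : u (n + 1) z = f₀ + radialPrimitive q (fun x => τ x - B x (u n x)) z := rfl
  -- This bounds `τ - B f₀`, which is up to sign the defect of the constant iterate; as `s` has
  -- diameter at most 1, it bounds the first increment too.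
  set M := C + a * ‖f₀‖ with hM
  have hM0 : 0 ≤ M := by positivity
  have hdiff : ∀ n, ∀ z ∈ s, ‖u (n + 1) z - u n z‖ ≤ M * (1 / 2) ^ n := by
    intro n
    induction n with
    | zero =>
      intro z hz
      rw [hstep, show u 0 z = f₀ from rfl, add_sub_cancel_left, pow_zero]
      refine (norm_radialPrimitive_le hs hq hz (C := M) fun x hx => ?_).trans ?_
      · refine (norm_sub_le _ _).trans (add_le_add (hC x hx) ?_)
        exact (ContinuousLinearMap.le_opNorm _ _).trans
          (mul_le_mul_of_nonneg_right (ha x hx) (norm_nonneg f₀))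
      · exact mul_le_mul_of_nonneg_left (hd z hz q hq) hM0
    | succ n ih =>
      intro z hz
      rw [hstep, hstep, add_sub_add_left_eq_sub,
        ← radialPrimitive_sub (hα _).continuous (hα _).continuous]
      refine (norm_radialPrimitive_le hs hq hz (C := a * (M * (1 / 2) ^ n)) fun x hx => ?_).trans ?_
      · rw [sub_sub_sub_cancel_left, ← map_sub, ← norm_neg, ← map_neg, neg_sub]
        exact (ContinuousLinearMap.le_opNorm _ _).trans
          (mul_le_mul (ha x hx) (ih x hx) (norm_nonneg _) ha0)
      · have := had z hz q hq
        have h2 : 0 ≤ M * (1 / 2) ^ n := by positivity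
        calc a * (M * (1 / 2) ^ n) * ‖z - q‖ = (a * ‖z - q‖) * (M * (1 / 2) ^ n) := by ring
          _ ≤ 1 / 4 * (M * (1 / 2) ^ n) := by gcongr
          _ ≤ M * (1 / 2) ^ (n + 1) := by rw [pow_succ]; nlinarith
  -- The induction needs `a M + N / 2 ≤ 3 N / 4`, that is `N ≥ 4 a M`; the summand `M` covers the
  -- start.
  set N := M + 4 * (a * M) with hN
  have hN0 : 0 ≤ N := by positivity
  have hw : ∀ n, ∀ z ∈ s, ‖fderiv ℝ (u n) z + B z (u n z) - τ z‖ ≤ N * (3 / 4) ^ n := by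
    intro n
    induction n with
    | zero =>
      intro z hz
      rw [show u 0 = fun _ => f₀ from rfl, pow_zero, mul_one]
      simp only [fderiv_const_apply, zero_add]
      refine (norm_sub_le _ _).trans ?_
      have := (ContinuousLinearMap.le_opNorm (B z) f₀).trans
        (mul_le_mul_of_nonneg_right (ha z hz) (norm_nonneg f₀))
      have := hC z hz
      have : 0 ≤ a * M := by positivity
      linarith
    | succ n ih =>
      intro z hz
      refine ContinuousLinearMap.opNorm_le_bound _ (by positivity) fun v => ?_
      have h0 : fderiv ℝ (u (n + 1)) z
          = fderiv ℝ (radialPrimitive q (fun x => τ x - B x (u n x))) z := by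
        rw [show u (n + 1) = fun z => f₀ + radialPrimitive q (fun x => τ x - B x (u n x)) z from rfl,
          fderiv_const_add]
      simp only [sub_apply, add_apply, h0, fderiv_radialPrimitive (hα n)]
      set J := ∫ t in (0 : ℝ)..1, t • (fderiv ℝ (fun x => τ x - B x (u n x)) (q + t • (z - q)) v
        (z - q) - fderiv ℝ (fun x => τ x - B x (u n x)) (q + t • (z - q)) (z - q) v) with hJ
      have h2 : ‖J‖ ≤ 1 / 2 * (N * (3 / 4) ^ n) * ‖v‖ := by
        have h := intervalIntegral.norm_integral_le_of_norm_le_const (a := (0 : ℝ)) (b := 1)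
          (f := fun t => t • (fderiv ℝ (fun x => τ x - B x (u n x)) (q + t • (z - q)) v
            (z - q) - fderiv ℝ (fun x => τ x - B x (u n x)) (q + t • (z - q)) (z - q) v))
          (C := 1 / 2 * (N * (3 / 4) ^ n) * ‖v‖) ?_
        · rwa [sub_zero, abs_one, mul_one] at h
        intro t ht
        rw [uIoc_of_le zero_le_one] at ht
        have hx : q + t • (z - q) ∈ s := hs.add_smul_sub_mem hq hz ⟨ht.1.le, ht.2⟩
        set x := q + t • (z - q)
        rw [antisymm_fderiv_sub ((hB.differentiable (by simp)) x) ((hτ.differentiable (by simp)) x)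
          (hud n x) (hflat x hx) (hclosed x hx), norm_smul, Real.norm_of_nonneg ht.1.le]
        have key : ∀ v y : V, ‖B x (fderiv ℝ (u n) x y + B x (u n x) y - τ x y) v‖
            ≤ a * (N * (3 / 4) ^ n * ‖y‖) * ‖v‖ := by
          intro v y
          refine (ContinuousLinearMap.le_opNorm _ _).trans ?_
          refine mul_le_mul_of_nonneg_right ?_ (norm_nonneg v)
          refine (ContinuousLinearMap.le_opNorm _ _).trans ?_
          refine mul_le_mul (ha x hx) ?_ (norm_nonneg _) ha0
          exact (ContinuousLinearMap.le_opNorm (fderiv ℝ (u n) x + B x (u n x) - τ x) y).trans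
            (mul_le_mul_of_nonneg_right (ih x hx) (norm_nonneg y))
        have k1 := key v (z - q)
        have k2 := key (z - q) v
        have k3 := had z hz q hq
        have hP : 0 ≤ N * (3 / 4) ^ n * ‖v‖ := by positivity
        calc t * _ ≤ 1 * _ := mul_le_mul_of_nonneg_right ht.2 (norm_nonneg _)
          _ ≤ 2 * ((a * ‖z - q‖) * (N * (3 / 4) ^ n * ‖v‖)) := by
              rw [one_mul]
              refine (norm_sub_le _ _).trans ((add_le_add k1 k2).trans (le_of_eq (by ring)))
          _ ≤ 2 * (1 / 4 * (N * (3 / 4) ^ n * ‖v‖)) := by gcongr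
          _ = _ := by ring
      -- The new defect is `B` applied to the increment plus the homotopy error `J`.
      have h3 : τ z v - B z (u n z) v + J + B z (u (n + 1) z) v - τ z v
          = B z (u (n + 1) z - u n z) v + J := by
        rw [map_sub, sub_apply]; abel
      rw [h3]
      have h4 : ‖B z (u (n + 1) z - u n z) v‖ ≤ a * (M * (1 / 2) ^ n) * ‖v‖ := by
        refine (ContinuousLinearMap.le_opNorm _ _).trans ?_
        refine mul_le_mul_of_nonneg_right ?_ (norm_nonneg v)
        exact (ContinuousLinearMap.le_opNorm _ _).trans
          (mul_le_mul (ha z hz) (hdiff n z hz) (norm_nonneg _) ha0)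
      refine (norm_add_le _ _).trans ((add_le_add h4 h2).trans ?_)
      rw [← add_mul]
      refine mul_le_mul_of_nonneg_right ?_ (norm_nonneg v)
      have h5 : ((1 : ℝ) / 2) ^ n ≤ (3 / 4) ^ n :=
        pow_le_pow_left₀ (by norm_num) (by norm_num) n
      have h6 : 0 ≤ a * M := by positivity
      have h7 : (0 : ℝ) ≤ (3 / 4) ^ n := by positivity
      have h8 : a * (M * (1 / 2) ^ n) ≤ (a * M) * (3 / 4) ^ n := by
        rw [← mul_assoc]; gcongr
      have h9 : 0 ≤ M * (3 / 4) ^ n := by positivity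
      rw [pow_succ, hN]
      nlinarith
  -- Off `s` the limit is arbitrary; the statement ranges over all `z` only so that a total function
  -- can be chosen.
  have hlim : ∀ z, ∃ l, z ∈ s → Tendsto (fun n => u n z) atTop (𝓝 l) := by
    intro z
    by_cases hz : z ∈ s
    · have : CauchySeq fun n => u n z := cauchySeq_of_le_geometric (1 / 2) M (by norm_num)
        fun n => by rw [dist_comm, dist_eq_norm]; exact hdiff n z hz
      obtain ⟨l, hl⟩ := cauchySeq_tendsto_of_complete this
      exact ⟨l, fun _ => hl⟩
    · exact ⟨0, fun h => absurd h hz⟩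
  choose U hU using hlim
  have hrate : ∀ n, ∀ z ∈ s, ‖u n z - U z‖ ≤ 2 * M * (1 / 2) ^ n := by
    intro n z hz
    have := dist_le_of_le_geometric_of_tendsto (1 / 2) M (by norm_num)
      (fun n => by rw [dist_comm, dist_eq_norm]; exact hdiff n z hz) (hU z hz) n
    rw [dist_eq_norm] at this
    refine this.trans (le_of_eq ?_)
    norm_num
    ring
  have hUq : U q = f₀ := by
    refine tendsto_nhds_unique (hU q hq) (tendsto_const_nhds.congr fun n => ?_)
    cases n with
    | zero => rfl
    | succ n => simp [hstep, radialPrimitive]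
  refine ⟨U, hUq, fun x hx => ?_⟩
  refine hasFDerivAt_of_tendstoUniformlyOn hso (f := u) (f' := fun n => fderiv ℝ (u n))
    (g' := fun x => τ x - B x (U x)) (l := atTop) ?_ (fun n y _ => (hud n y).hasFDerivAt) hU hx
  rw [Metric.tendstoUniformlyOn_iff]
  intro ε hε
  have ht : Tendsto (fun n : ℕ => N * (3 / 4) ^ n + a * (2 * M * (1 / 2) ^ n)) atTop (𝓝 0) := by
    have h1 : Tendsto (fun n : ℕ => ((3 : ℝ) / 4) ^ n) atTop (𝓝 0) :=
      tendsto_pow_atTop_nhds_zero_of_lt_one (by norm_num) (by norm_num)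
    have h2 : Tendsto (fun n : ℕ => ((1 : ℝ) / 2) ^ n) atTop (𝓝 0) :=
      tendsto_pow_atTop_nhds_zero_of_lt_one (by norm_num) (by norm_num)
    simpa using (h1.const_mul N).add ((h2.const_mul (2 * M)).const_mul a)
  filter_upwards [ht.eventually_lt_const hε] with n hn y hy
  refine lt_of_le_of_lt ?_ hn
  rw [dist_comm, dist_eq_norm]
  have e : fderiv ℝ (u n) y - (τ y - B y (U y))
      = (fderiv ℝ (u n) y + B y (u n y) - τ y) - B y (u n y - U y) := by
    rw [map_sub]; abel
  rw [e]
  refine (norm_sub_le _ _).trans (add_le_add (hw n y hy) ?_)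
  exact (ContinuousLinearMap.le_opNorm _ _).trans
    (mul_le_mul (ha y hy) (hrate n y hy) (norm_nonneg _) ha0)

/-- Along the segment from `q` the derivative is bounded by a multiple of the function, so
Grönwall's inequality applies. -/
theorem eq_zero_of_hasFDerivAt_eq_neg {B : V → G →L[ℝ] V →L[ℝ] G} {s : Set V}
    {K : ℝ} (hK : ∀ x ∈ s, ‖B x‖ ≤ K) (hs : Convex ℝ s) {u : V → G}
    (hu : ∀ x ∈ s, HasFDerivAt u (-B x (u x)) x) {q : V} (hq : q ∈ s) (h0 : u q = 0) :
    ∀ z ∈ s, u z = 0 := by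
  intro z hz
  have hmem : ∀ t ∈ Icc (0 : ℝ) 1, q + t • (z - q) ∈ s := fun t ht => hs.add_smul_sub_mem hq hz ht
  have hd : ∀ t ∈ Icc (0 : ℝ) 1, HasDerivAt (fun t : ℝ => u (q + t • (z - q)))
      ((-B (q + t • (z - q)) (u (q + t • (z - q)))) (z - q)) t := by
    intro t ht
    have e2 : HasDerivAt (fun t : ℝ => q + t • (z - q)) (z - q) t := by
      simpa using ((hasDerivAt_id t).smul_const (z - q)).const_add q
    exact (hu _ (hmem t ht)).comp_hasDerivAt t e2
  have := eq_zero_of_abs_deriv_le_mul_abs_self_of_eq_zero_right (a := (0 : ℝ)) (b := 1)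
    (f := fun t : ℝ => u (q + t • (z - q))) (K := K * ‖z - q‖)
    (fun t ht => (hd t ht).continuousAt.continuousWithinAt)
    (fun t ht => (hd t (Ico_subset_Icc_self ht)).hasDerivWithinAt) (by simpa using h0)
    (fun t ht => by
      rw [neg_apply, norm_neg]
      refine (ContinuousLinearMap.le_opNorm _ _).trans ?_
      have := (ContinuousLinearMap.le_opNorm (B (q + t • (z - q))) (u (q + t • (z - q)))).trans
        (mul_le_mul_of_nonneg_right (hK _ (hmem t (Ico_subset_Icc_self ht))) (norm_nonneg _))
      calc _ ≤ K * ‖u (q + t • (z - q))‖ * ‖z - q‖ := by gcongr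
        _ = _ := by ring) 1 (by simp)
  simpa using this

/-- Bootstrapping: the equation expresses the derivative through `u` itself, so each order of
regularity gives the next. -/
theorem contDiffOn_of_hasFDerivAt_eq_sub {B : V → G →L[ℝ] V →L[ℝ] G} {τ : V → V →L[ℝ] G}
    {s : Set V} (hso : IsOpen s) (hB : ContDiffOn ℝ ∞ B s) (hτ : ContDiffOn ℝ ∞ τ s) {u : V → G}
    (hu : ∀ x ∈ s, HasFDerivAt u (τ x - B x (u x)) x) : ContDiffOn ℝ ∞ u s := by
  rw [contDiffOn_infty]
  intro n
  induction n with
  | zero =>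
    exact contDiffOn_zero.2 fun x hx => (hu x hx).continuousAt.continuousWithinAt
  | succ n ih =>
    push_cast
    rw [contDiffOn_succ_iff_fderiv_of_isOpen hso]
    refine ⟨fun x hx => (hu x hx).differentiableAt.differentiableWithinAt, by simp, ?_⟩
    have h1 : ContDiffOn ℝ n (fun x => τ x - B x (u x)) s :=
      (hτ.of_le (by exact_mod_cast le_top)).sub
        ((hB.of_le (by exact_mod_cast le_top)).clm_apply ih)
    exact h1.congr fun x hx => (hu x hx).fderiv

end TotalDifferential

end HiggsSurface

namespace HiggsSurface

/-! ### Wirtinger derivatives -/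

section Wirtinger

variable {G : Type*} [NormedAddCommGroup G] [NormedSpace ℂ G]

/-- The derivative `∂f/∂z`. -/
def dz (f : ℂ → G) (ζ : ℂ) : G :=
  (1 / 2 : ℂ) • (fderiv ℝ f ζ 1 - Complex.I • fderiv ℝ f ζ Complex.I)

/-- The derivative `∂f/∂z̄`. -/
def dzb (f : ℂ → G) (ζ : ℂ) : G :=
  (1 / 2 : ℂ) • (fderiv ℝ f ζ 1 + Complex.I • fderiv ℝ f ζ Complex.I)

theorem realLinear_apply {W : Type*} [AddCommGroup W] [Module ℂ W] (L : ℂ →ₗ[ℝ] W) (c : ℂ) :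
    L c = (c.re : ℂ) • L 1 + (c.im : ℂ) • L Complex.I := by
  conv_lhs => rw [← Complex.re_add_im c]
  have h1 : (c.re : ℂ) + c.im * Complex.I = c.re • (1 : ℂ) + c.im • Complex.I := by simp
  rw [h1, map_add, map_smul, map_smul, Complex.coe_smul, Complex.coe_smul]

/-- The part of type `(1,0)` is complex linear in `c`, hence a multiple of `dz`; the next lemma is
the conjugate statement. -/
theorem part10_realLinear {W : Type*} [AddCommGroup W] [Module ℂ W] (L : ℂ →ₗ[ℝ] W) (c : ℂ) :
    part10 L c = c • (1 / 2 : ℂ) • (L 1 - Complex.I • L Complex.I) := by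
  unfold part10
  rw [realLinear_apply L c, realLinear_apply L (Complex.I • c)]
  have h : Complex.I • c = -c.im + c.re * Complex.I := by
    apply Complex.ext <;> simp
  simp only [h]
  conv_rhs => rw [← Complex.re_add_im c]
  simp only [Complex.add_re, Complex.add_im, Complex.neg_re, Complex.neg_im, Complex.mul_re,
    Complex.mul_im, Complex.ofReal_re, Complex.ofReal_im, Complex.I_re, Complex.I_im]
  simp only [mul_zero, mul_one, sub_zero, add_zero, neg_zero, zero_add]
  match_scalars
  · ring
  · linear_combination (c.im : ℂ) / 2 * Complex.I_sq

theorem part01_realLinear {W : Type*} [AddCommGroup W] [Module ℂ W] (L : ℂ →ₗ[ℝ] W) (c : ℂ) :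
    part01 L c = conj c • (1 / 2 : ℂ) • (L 1 + Complex.I • L Complex.I) := by
  unfold part01
  rw [realLinear_apply L c, realLinear_apply L (Complex.I • c)]
  have h : Complex.I • c = -c.im + c.re * Complex.I := by
    apply Complex.ext <;> simp
  have h' : conj c = c.re - c.im * Complex.I := by
    apply Complex.ext <;> simp
  simp only [h, h']
  simp only [Complex.add_re, Complex.add_im, Complex.neg_re, Complex.neg_im, Complex.mul_re,
    Complex.mul_im, Complex.ofReal_re, Complex.ofReal_im, Complex.I_re, Complex.I_im]
  simp only [mul_zero, mul_one, sub_zero, add_zero, neg_zero, zero_add]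
  match_scalars
  · ring
  · linear_combination (c.im : ℂ) / 2 * Complex.I_sq

theorem part10_fderiv (f : ℂ → G) (ζ c : ℂ) : part10 (fderiv ℝ f ζ) c = c • dz f ζ :=
  part10_realLinear (fderiv ℝ f ζ : ℂ →ₗ[ℝ] G) c

theorem part01_fderiv (f : ℂ → G) (ζ c : ℂ) : part01 (fderiv ℝ f ζ) c = conj c • dzb f ζ :=
  part01_realLinear (fderiv ℝ f ζ : ℂ →ₗ[ℝ] G) c

theorem part10_add_part01 {V W : Type*} [AddCommGroup V] [Module ℂ V] [AddCommGroup W] [Module ℂ W]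
    (α : V → W) (v : V) : part10 α v + part01 α v = α v := by
  unfold part10 part01
  module

theorem fderiv_eq_wirtinger (f : ℂ → G) (ζ c : ℂ) :
    fderiv ℝ f ζ c = c • dz f ζ + conj c • dzb f ζ := by
  rw [← part10_fderiv, ← part01_fderiv, part10_add_part01]

theorem dzb_eq_zero_of_differentiableAt {f : ℂ → G} {ζ : ℂ} (hf : DifferentiableAt ℂ f ζ) :
    dzb f ζ = 0 := by
  have h : fderiv ℝ f ζ = (fderiv ℂ f ζ).restrictScalars ℝ := hf.fderiv_restrictScalars ℝ
  have h2 : fderiv ℂ f ζ Complex.I = Complex.I • fderiv ℂ f ζ 1 := by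
    rw [← map_smul]; simp
  simp [dzb, h, h2, smul_smul]

theorem dz_const (u : G) (ζ : ℂ) : dz (fun _ => u) ζ = 0 := by simp [dz]

theorem dzb_const (u : G) (ζ : ℂ) : dzb (fun _ => u) ζ = 0 := by simp [dzb]

end Wirtinger

/-! ### Hermitian forms depending smoothly on a point of the plane -/

section HermitianForms

variable {F : Type*} [NormedAddCommGroup F] [NormedSpace ℂ F] [FiniteDimensional ℂ F]

/-- A sesquilinear form, as a continuous real bilinear map. -/
def realForm (H : F →ₗ[ℂ] F →ₗ⋆[ℂ] ℂ) : F →L[ℝ] F →L[ℝ] ℂ :=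
  LinearMap.toContinuousLinearMap
    { toFun := fun u => LinearMap.toContinuousLinearMap
        { toFun := fun a => H u a
          map_add' := fun a b => by simp
          map_smul' := fun r a => by
            rw [← Complex.coe_smul, map_smulₛₗ]; simp }
      map_add' := fun u v => by ext a; simp
      map_smul' := fun r u => by
        ext a
        simp only [LinearMap.coe_toContinuousLinearMap', LinearMap.coe_mk, AddHom.coe_mk,
          RingHom.id_apply, smul_apply]
        rw [← Complex.coe_smul, map_smul]
        simp }

@[simp]
theorem realForm_apply (H : F →ₗ[ℂ] F →ₗ⋆[ℂ] ℂ) (u a : F) : realForm H u a = H u a := rfl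

variable {H : ℂ → F →ₗ[ℂ] F →ₗ⋆[ℂ] ℂ} {Ω : Set ℂ}

theorem contDiffOn_realForm {n : WithTop ℕ∞}
    (hH : ∀ u a, ContDiffOn ℝ n (fun ζ => H ζ u a) Ω) :
    ContDiffOn ℝ n (fun ζ => realForm (H ζ)) Ω :=
  contDiffOn_clm_apply.2 fun u => contDiffOn_clm_apply.2 fun a => hH u a

theorem contDiffOn_form {n : WithTop ℕ∞} (hH : ∀ u a, ContDiffOn ℝ n (fun ζ => H ζ u a) Ω)
    {f g : ℂ → F} (hf : ContDiffOn ℝ n f Ω) (hg : ContDiffOn ℝ n g Ω) :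
    ContDiffOn ℝ n (fun ζ => H ζ (f ζ) (g ζ)) Ω :=
  ((contDiffOn_realForm hH).clm_apply hf).clm_apply hg

/-- The real part of a form, as a map to the real dual space. -/
def reForm (H : F →ₗ[ℂ] F →ₗ⋆[ℂ] ℂ) : F →L[ℝ] F →L[ℝ] ℝ :=
  (ContinuousLinearMap.compL ℝ F ℂ ℝ Complex.reCLM).comp (realForm H)

@[simp]
theorem reForm_apply (H : F →ₗ[ℂ] F →ₗ⋆[ℂ] ℂ) (u a : F) : reForm H u a = (H u a).re := rfl

/-- Positivity makes `Re H` injective into the real dual, and the dimensions agree. -/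
theorem exists_equiv_reForm {H : F →ₗ[ℂ] F →ₗ⋆[ℂ] ℂ} (hpos : ∀ a, a ≠ 0 → 0 < (H a a).re) :
    ∃ e : F ≃L[ℝ] (F →L[ℝ] ℝ), (e : F →L[ℝ] F →L[ℝ] ℝ) = reForm H := by
  have hinj : Function.Injective (reForm H) := by
    rw [injective_iff_map_eq_zero]
    intro a ha
    by_contra hne
    have := hpos a hne
    rw [← reForm_apply, ha] at this
    simp at this
  have hdim : Module.finrank ℝ F = Module.finrank ℝ (F →L[ℝ] ℝ) := by
    rw [← (LinearMap.toContinuousLinearMap (𝕜 := ℝ) (E := F) (F' := ℝ)).finrank_eq]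
    exact (Subspace.dual_finrank_eq (K := ℝ) (V := F)).symm
  refine ⟨(LinearEquiv.ofInjectiveOfFinrankEq (reForm H : F →ₗ[ℝ] F →L[ℝ] ℝ) hinj
    hdim).toContinuousLinearEquiv, ?_⟩
  ext u a
  rfl

/-- A vector known only through its pairings is recovered by inverting `Re H`, and inversion is
smooth at invertible operators. -/
theorem contDiffOn_of_form {n : WithTop ℕ∞}
    (hH : ∀ u a, ContDiffOn ℝ n (fun ζ => H ζ u a) Ω)
    (hpos : ∀ ζ ∈ Ω, ∀ a, a ≠ 0 → 0 < (H ζ a a).re) {b : ℂ → F}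
    (hb : ∀ a, ContDiffOn ℝ n (fun ζ => H ζ (b ζ) a) Ω) : ContDiffOn ℝ n b Ω := by
  have hR : ContDiffOn ℝ n (fun ζ => reForm (H ζ)) Ω :=
    contDiffOn_const.clm_comp (contDiffOn_realForm hH)
  have hRb : ContDiffOn ℝ n (fun ζ => reForm (H ζ) (b ζ)) Ω :=
    contDiffOn_clm_apply.2 fun a => Complex.reCLM.contDiff.comp_contDiffOn (hb a)
  have hinv : ContDiffOn ℝ n (fun ζ => (reForm (H ζ)).inverse) Ω := by
    intro ζ hζ
    obtain ⟨e, he⟩ := exists_equiv_reForm (hpos ζ hζ)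
    have := contDiffAt_map_inverse (𝕜 := ℝ) (n := n) e
    rw [he] at this
    exact this.comp_contDiffWithinAt (f := fun ζ => reForm (H ζ)) ζ (hR ζ hζ)
  refine (hinv.clm_apply hRb).congr fun ζ hζ => ?_
  obtain ⟨e, he⟩ := exists_equiv_reForm (hpos ζ hζ)
  rw [← he]
  simp

theorem form_ext {H : F →ₗ[ℂ] F →ₗ⋆[ℂ] ℂ} (hpos : ∀ a, a ≠ 0 → 0 < (H a a).re) {u v : F}
    (h : ∀ a, H u a = H v a) : u = v := by
  by_contra hne
  have h1 := hpos (u - v) (sub_ne_zero.2 hne)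
  have h2 : H (u - v) (u - v) = 0 := by rw [map_sub H, LinearMap.sub_apply, h, sub_self]
  rw [h2] at h1
  exact lt_irrefl _ h1

theorem hasFDerivAt_form (hΩ : IsOpen Ω) (hH : ∀ u a, ContDiffOn ℝ ∞ (fun ζ => H ζ u a) Ω) {ζ : ℂ}
    (hζ : ζ ∈ Ω) {f g : ℂ → F} (hf : DifferentiableAt ℝ f ζ) (hg : DifferentiableAt ℝ g ζ) :
    DifferentiableAt ℝ (fun ξ => H ξ (f ξ) (g ξ)) ζ ∧ ∀ c,
    fderiv ℝ (fun ξ => H ξ (f ξ) (g ξ)) ζ c = fderiv ℝ (fun ξ => H ξ (f ζ) (g ζ)) ζ c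
      + H ζ (fderiv ℝ f ζ c) (g ζ) + H ζ (f ζ) (fderiv ℝ g ζ c) := by
  have h1 : ContDiffAt ℝ ∞ (fun ζ => realForm (H ζ)) ζ :=
    (contDiffOn_realForm hH).contDiffAt (hΩ.mem_nhds hζ)
  have h2 : HasFDerivAt (fun ζ => realForm (H ζ)) _ ζ :=
    (h1.differentiableAt (by simp)).hasFDerivAt
  have h3 : HasFDerivAt (fun ξ => realForm (H ξ) (f ξ) (g ξ)) _ ζ :=
    (h2.clm_apply hf.hasFDerivAt).clm_apply hg.hasFDerivAt
  have h4 : HasFDerivAt (fun ξ => realForm (H ξ) (f ζ) (g ζ)) _ ζ :=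
    (h2.clm_apply (hasFDerivAt_const (f ζ) ζ)).clm_apply (hasFDerivAt_const (g ζ) ζ)
  simp only [realForm_apply] at h3 h4
  refine ⟨h3.differentiableAt, fun c => ?_⟩
  rw [h3.fderiv, h4.fderiv]
  simp
  ring

theorem dz_form (hΩ : IsOpen Ω) (hH : ∀ u a, ContDiffOn ℝ ∞ (fun ζ => H ζ u a) Ω) {ζ : ℂ}
    (hζ : ζ ∈ Ω) {f g : ℂ → F} (hf : DifferentiableAt ℝ f ζ) (hg : DifferentiableAt ℝ g ζ) :
    dz (fun ξ => H ξ (f ξ) (g ξ)) ζ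
      = dz (fun ξ => H ξ (f ζ) (g ζ)) ζ + H ζ (dz f ζ) (g ζ) + H ζ (f ζ) (dzb g ζ) := by
  unfold dz dzb
  simp only [(hasFDerivAt_form hΩ hH hζ hf hg).2, map_smul, map_sub, map_smulₛₗ, map_add,
    LinearMap.sub_apply, LinearMap.smul_apply, smul_eq_mul]
  simp [map_ofNat (starRingEnd ℂ) 2]
  ring

/-- The local coefficients of a Higgs bundle with harmonic metric in a holomorphic frame over the
coordinate domain `Ω`: the metric `H`, the connection coefficient `G`, the Higgs field `Θ` and its
adjoint `S`. -/
structure LocalHiggs (Ω : Set ℂ) (H : ℂ → F →ₗ[ℂ] F →ₗ⋆[ℂ] ℂ) (G Θ S : ℂ → F →ₗ[ℂ] F) : Prop where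
  isOpen : IsOpen Ω
  symm : ∀ ζ ∈ Ω, ∀ u a, H ζ a u = conj (H ζ u a)
  pos : ∀ ζ ∈ Ω, ∀ a, a ≠ 0 → 0 < (H ζ a a).re
  smooth : ∀ u a, ContDiffOn ℝ ∞ (fun ζ => H ζ u a) Ω
  chern : ∀ ζ ∈ Ω, ∀ u a, H ζ (G ζ u) a = dz (fun ξ => H ξ u a) ζ
  adjoint : ∀ ζ ∈ Ω, ∀ u a, H ζ (S ζ u) a = H ζ u (Θ ζ a)
  holomorphic : ∀ u, DifferentiableOn ℂ (fun ζ => Θ ζ u) Ω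
  harmonic : ∀ ζ ∈ Ω, ∀ u, dzb (fun ξ => G ξ u) ζ = Θ ζ (S ζ u) - S ζ (Θ ζ u)

namespace LocalHiggs

variable {G Θ S : ℂ → F →ₗ[ℂ] F} (M : LocalHiggs Ω H G Θ S)
include M

theorem dz_form {ζ : ℂ} (hζ : ζ ∈ Ω) {f g : ℂ → F} (hf : DifferentiableAt ℝ f ζ)
    (hg : DifferentiableAt ℝ g ζ) :
    dz (fun ξ => H ξ (f ξ) (g ξ)) ζ = H ζ (dz f ζ + G ζ (f ζ)) (g ζ) + H ζ (f ζ) (dzb g ζ) := by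
  rw [HiggsSurface.dz_form M.isOpen M.smooth hζ hf hg, ← M.chern ζ hζ, map_add,
    LinearMap.add_apply]
  ring

/-- Conjugate `dz_form`, using that `H` is Hermitian on the open set `Ω`. -/
theorem dzb_form {ζ : ℂ} (hζ : ζ ∈ Ω) {f g : ℂ → F} (hf : DifferentiableAt ℝ f ζ)
    (hg : DifferentiableAt ℝ g ζ) :
    dzb (fun ξ => H ξ (f ξ) (g ξ)) ζ = H ζ (dzb f ζ) (g ζ) + H ζ (f ζ) (dz g ζ + G ζ (g ζ)) := by
  have h1 := M.dz_form hζ hg hf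
  have hd := (hasFDerivAt_form M.isOpen M.smooth hζ hg hf).1
  have h2 : (fun ξ => H ξ (f ξ) (g ξ)) =ᶠ[nhds ζ] fun ξ => Complex.conjCLE (H ξ (g ξ) (f ξ)) := by
    filter_upwards [M.isOpen.mem_nhds hζ] with ξ hξ
    simpa using M.symm ξ hξ (g ξ) (f ξ)
  have h3 : ∀ c, fderiv ℝ (fun ξ => H ξ (f ξ) (g ξ)) ζ c
      = conj (fderiv ℝ (fun ξ => H ξ (g ξ) (f ξ)) ζ c) := by
    intro c
    have h5 : HasFDerivAt (fun ξ => Complex.conjCLE (H ξ (g ξ) (f ξ))) _ ζ :=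
      Complex.conjCLE.hasFDerivAt.comp ζ hd.hasFDerivAt
    rw [h2.fderiv_eq, h5.fderiv]
    simp
  have h4 : dzb (fun ξ => H ξ (f ξ) (g ξ)) ζ = conj (dz (fun ξ => H ξ (g ξ) (f ξ)) ζ) := by
    simp [dzb, dz, h3, map_ofNat (starRingEnd ℂ) 2]
  rw [h4, h1, map_add, ← M.symm ζ hζ, ← M.symm ζ hζ, add_comm]

theorem contDiffOn_higgs (u : F) : ContDiffOn ℝ ∞ (fun ζ => Θ ζ u) Ω :=
  ((M.holomorphic u).contDiffOn M.isOpen).restrict_scalars ℝ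

theorem contDiffOn_connection (u : F) : ContDiffOn ℝ ∞ (fun ζ => G ζ u) Ω := by
  refine contDiffOn_of_form M.smooth M.pos fun a => ?_
  have h : ContDiffOn ℝ ∞ (fderiv ℝ fun ξ => H ξ u a) Ω :=
    (M.smooth u a).fderiv_of_isOpen M.isOpen (by simp)
  have h2 : ContDiffOn ℝ ∞ (dz fun ξ => H ξ u a) Ω := by
    unfold dz
    exact ((h.clm_apply contDiffOn_const).sub
      ((h.clm_apply contDiffOn_const).const_smul Complex.I)).const_smul (1 / 2 : ℂ)
  exact h2.congr fun ζ hζ => M.chern ζ hζ u a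

theorem contDiffOn_adjoint (u : F) : ContDiffOn ℝ ∞ (fun ζ => S ζ u) Ω := by
  refine contDiffOn_of_form M.smooth M.pos fun a => ?_
  exact (contDiffOn_form M.smooth contDiffOn_const (M.contDiffOn_higgs a)).congr
    fun ζ hζ => M.adjoint ζ hζ u a

theorem adjoint' {ζ : ℂ} (hζ : ζ ∈ Ω) (u a : F) : H ζ (Θ ζ u) a = H ζ u (S ζ a) := by
  rw [M.symm ζ hζ a, ← M.adjoint ζ hζ, ← M.symm ζ hζ]

/-- This is `∂_{E,h} θ† = 0`. Apply `∂/∂z` to `H(S u, a) = H(u, Θ a)`: on the right, `Θ a` enters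
through `∂(Θ a)/∂z̄`, which vanishes by holomorphy. -/
theorem dz_adjoint {ζ : ℂ} (hζ : ζ ∈ Ω) (u : F) :
    dz (fun ξ => S ξ u) ζ = S ζ (G ζ u) - G ζ (S ζ u) := by
  have hn := M.isOpen.mem_nhds hζ
  have hS : DifferentiableAt ℝ (fun ξ => S ξ u) ζ :=
    ((M.contDiffOn_adjoint u).contDiffAt hn).differentiableAt (by simp)
  rw [eq_sub_iff_add_eq]
  refine form_ext (M.pos ζ hζ) fun a => ?_
  have hΘ : DifferentiableAt ℝ (fun ξ => Θ ξ a) ζ :=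
    ((M.contDiffOn_higgs a).contDiffAt hn).differentiableAt (by simp)
  have h1 := M.dz_form hζ hS (differentiableAt_const a)
  have h2 := M.dz_form hζ (differentiableAt_const u) hΘ
  have h3 : (fun ξ => H ξ (S ξ u) a) =ᶠ[nhds ζ] fun ξ => H ξ u (Θ ξ a) := by
    filter_upwards [hn] with ξ hξ using M.adjoint ξ hξ u a
  have h4 : dz (fun ξ => H ξ (S ξ u) a) ζ = dz (fun ξ => H ξ u (Θ ξ a)) ζ := by
    simp only [dz, h3.fderiv_eq]
  rw [h1, h2, dzb_const, dz_const, zero_add,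
    dzb_eq_zero_of_differentiableAt ((M.holomorphic a).differentiableAt hn), map_zero, map_zero,
    add_zero, add_zero] at h4
  rw [h4, M.adjoint ζ hζ]

end LocalHiggs

end HermitianForms
end HiggsSurface

namespace HiggsSurface

/-! ### Local primitives -/

section LocalPrimitives

variable {F : Type*} [NormedAddCommGroup F] [NormedSpace ℂ F] [FiniteDimensional ℂ F]

/-- The covector `u dz + v dz̄`. -/
def covec (u v : F) : ℂ →L[ℝ] F :=
  (ContinuousLinearMap.id ℝ ℂ).smulRight u + (Complex.conjCLE : ℂ →L[ℝ] ℂ).smulRight v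

@[simp]
theorem covec_apply (u v : F) (c : ℂ) : covec u v c = c • u + conj c • v := rfl

/-- The connection form `(G + Θ) dz + S dz̄`. -/
def connForm (G Θ S : F →ₗ[ℂ] F) : F →L[ℝ] ℂ →L[ℝ] F :=
  LinearMap.toContinuousLinearMap
    { toFun := fun f => covec (G f + Θ f) (S f)
      map_add' := fun f g => by
        ext c
        simp only [covec_apply, map_add, add_apply]
        module
      map_smul' := fun r f => by
        ext c
        simp only [covec_apply, smul_apply, RingHom.id_apply, LinearMap.map_smul_of_tower]
        module }

@[simp]
theorem connForm_apply (G Θ S : F →ₗ[ℂ] F) (f : F) (c : ℂ) :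
    connForm G Θ S f c = c • (G f + Θ f) + conj c • S f := rfl

variable {Ω : Set ℂ}

theorem contDiffOn_covec {a b : ℂ → F} (ha : ContDiffOn ℝ ∞ a Ω) (hb : ContDiffOn ℝ ∞ b Ω) :
    ContDiffOn ℝ ∞ (fun ζ => covec (a ζ) (b ζ)) Ω :=
  contDiffOn_clm_apply.2 fun c => (ha.const_smul c).add (hb.const_smul (conj c))

theorem fderiv_covec_sub {a b : ℂ → F} {ζ : ℂ} (hΩ : IsOpen Ω) (hζ : ζ ∈ Ω)
    (ha : ContDiffOn ℝ ∞ a Ω) (hb : ContDiffOn ℝ ∞ b Ω) (v w : ℂ) :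
    fderiv ℝ (fun ξ => covec (a ξ) (b ξ)) ζ v w - fderiv ℝ (fun ξ => covec (a ξ) (b ξ)) ζ w v
      = (w * conj v - v * conj w) • (dzb a ζ - dz b ζ) := by
  have hn := hΩ.mem_nhds hζ
  have hd := ((contDiffOn_covec ha hb).contDiffAt hn).differentiableAt (by simp)
  have had := (ha.contDiffAt hn).differentiableAt (by simp)
  have hbd := (hb.contDiffAt hn).differentiableAt (by simp)
  have key : ∀ v w : ℂ, fderiv ℝ (fun ξ => covec (a ξ) (b ξ)) ζ v w
      = w • (v • dz a ζ + conj v • dzb a ζ) + conj w • (v • dz b ζ + conj v • dzb b ζ) := by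
    intro v w
    have h1 : fderiv ℝ (fun ξ => covec (a ξ) (b ξ) w) ζ v
        = fderiv ℝ (fun ξ => covec (a ξ) (b ξ)) ζ v w := by
      have h : HasFDerivAt (fun ξ => covec (a ξ) (b ξ) w) _ ζ :=
        hd.hasFDerivAt.clm_apply (hasFDerivAt_const w ζ)
      rw [h.fderiv]
      simp
    have h2 : HasFDerivAt (fun ξ => covec (a ξ) (b ξ) w)
        (w • fderiv ℝ a ζ + conj w • fderiv ℝ b ζ) ζ :=
      (had.hasFDerivAt.const_smul w).add (hbd.hasFDerivAt.const_smul (conj w))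
    rw [← h1, h2.fderiv, ← fderiv_eq_wirtinger, ← fderiv_eq_wirtinger]
    rfl
  rw [key, key]
  module

/-- The integration theorem above asks for coefficients that are `C¹` on the whole plane; cutting
off near the centre provides them. -/
theorem contDiff_bump_smul {W : Type*} [NormedAddCommGroup W] [NormedSpace ℝ W] {f : ℂ → W}
    (hΩ : IsOpen Ω) (hf : ContDiffOn ℝ ∞ f Ω) {ζ₀ : ℂ} (χ : ContDiffBump ζ₀)
    (hχ : Metric.closedBall ζ₀ χ.rOut ⊆ Ω) : ContDiff ℝ ∞ (fun ζ => χ ζ • f ζ) := by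
  rw [contDiff_iff_contDiffAt]
  intro ζ
  by_cases hζ : ζ ∈ Metric.closedBall ζ₀ χ.rOut
  · exact χ.contDiff.contDiffAt.smul (hf.contDiffAt (hΩ.mem_nhds (hχ hζ)))
  · have : (fun ζ => χ ζ • f ζ) =ᶠ[nhds ζ] fun _ => 0 := by
      filter_upwards [Metric.isClosed_closedBall.isOpen_compl.mem_nhds hζ] with ξ hξ
      have : χ ξ = 0 := by
        apply χ.zero_of_le_dist
        have hξ' : ¬ dist ξ ζ₀ ≤ χ.rOut := hξ
        exact (not_le.1 hξ').le
      simp [this]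
    exact contDiffAt_const.congr_of_eventuallyEq this

theorem exists_norm_le_on_closedBall {W : Type*} [NormedAddCommGroup W] [NormedSpace ℝ W]
    {f : ℂ → W} (hf : ContDiff ℝ ∞ f) (ζ₀ : ℂ) (R : ℝ) :
    ∃ a, 0 ≤ a ∧ ∀ ζ ∈ Metric.closedBall ζ₀ R, ‖f ζ‖ ≤ a := by
  obtain ⟨a, ha⟩ := (isCompact_closedBall ζ₀ R).exists_bound_of_continuousOn hf.continuous.continuousOn
  exact ⟨max a 0, le_max_right _ _, fun ζ hζ => (ha ζ hζ).trans (le_max_left _ _)⟩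

namespace LocalHiggs

variable {H : ℂ → F →ₗ[ℂ] F →ₗ⋆[ℂ] ℂ} {G Θ S : ℂ → F →ₗ[ℂ] F} (M : LocalHiggs Ω H G Θ S)
include M

theorem contDiffOn_connForm : ContDiffOn ℝ ∞ (fun ζ => connForm (G ζ) (Θ ζ) (S ζ)) Ω :=
  contDiffOn_clm_apply.2 fun u => contDiffOn_covec
    ((M.contDiffOn_connection u).add (M.contDiffOn_higgs u)) (M.contDiffOn_adjoint u)

/-- The curvature coefficient is `∂(G + Θ)/∂z̄ - ∂S/∂z` minus the commutator `[G + Θ, S]`. The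
harmonic equation gives `[Θ, S]` for the first term, and `dz_adjoint` gives `-[G, S]` for `∂S/∂z`,
so the sum is zero. -/
theorem connForm_flat {ζ : ℂ} (hζ : ζ ∈ Ω) (f : F) (v w : ℂ) :
    fderiv ℝ (fun ζ => connForm (G ζ) (Θ ζ) (S ζ)) ζ v f w
      - fderiv ℝ (fun ζ => connForm (G ζ) (Θ ζ) (S ζ)) ζ w f v
      + connForm (G ζ) (Θ ζ) (S ζ) (connForm (G ζ) (Θ ζ) (S ζ) f w) v
      - connForm (G ζ) (Θ ζ) (S ζ) (connForm (G ζ) (Θ ζ) (S ζ) f v) w = 0 := by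
  have hn := M.isOpen.mem_nhds hζ
  have hd := (M.contDiffOn_connForm.contDiffAt hn).differentiableAt (by simp)
  have key : ∀ v w : ℂ, fderiv ℝ (fun ζ => connForm (G ζ) (Θ ζ) (S ζ)) ζ v f w
      = fderiv ℝ (fun ζ => covec (G ζ f + Θ ζ f) (S ζ f)) ζ v w := by
    intro v w
    have h : HasFDerivAt (fun ξ => connForm (G ξ) (Θ ξ) (S ξ) f) _ ζ :=
      hd.hasFDerivAt.clm_apply (hasFDerivAt_const f ζ)
    have h' : HasFDerivAt (fun ξ => covec (G ξ f + Θ ξ f) (S ξ f)) _ ζ := h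
    rw [h'.fderiv]
    simp
  rw [key, key, fderiv_covec_sub M.isOpen hζ
    ((M.contDiffOn_connection f).add (M.contDiffOn_higgs f)) (M.contDiffOn_adjoint f)]
  have hG := ((M.contDiffOn_connection f).contDiffAt hn).differentiableAt (by simp)
  have hΘ := ((M.contDiffOn_higgs f).contDiffAt hn).differentiableAt (by simp)
  have h1 : dzb (fun ζ => G ζ f + Θ ζ f) ζ = dzb (fun ζ => G ζ f) ζ + dzb (fun ζ => Θ ζ f) ζ := by
    have h : HasFDerivAt (fun ζ => G ζ f + Θ ζ f) _ ζ := hG.hasFDerivAt.add hΘ.hasFDerivAt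
    simp only [dzb, h.fderiv, add_apply]
    module
  rw [h1, dzb_eq_zero_of_differentiableAt ((M.holomorphic f).differentiableAt hn),
    M.harmonic ζ hζ, M.dz_adjoint hζ]
  simp only [connForm_apply]
  simp only [map_add, LinearMap.map_smul]
  module

/-- `α dz + β dz̄` is annihilated by `∂̄ + Θ` and by `∂_h + Θ†`. -/
structure IsHarmonicPair (Ω : Set ℂ) (G Θ S : ℂ → F →ₗ[ℂ] F) (α β : ℂ → F) : Prop where
  smooth_left : ContDiffOn ℝ ∞ α Ω
  smooth_right : ContDiffOn ℝ ∞ β Ω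
  closed : ∀ ζ ∈ Ω, dzb α ζ = Θ ζ (β ζ)
  coclosed : ∀ ζ ∈ Ω, dz β ζ + G ζ (β ζ) = S ζ (α ζ)

/-- The two equations of a harmonic pair say exactly that `α dz + β dz̄` is closed for the flat
connection form. After a cutoff that is 1 on a small ball, the integration theorem applies there.
Uniqueness is stated on convex subsets and needs a solution only on the subset. -/
theorem exists_ball_primitive {α β : ℂ → F} (hαβ : IsHarmonicPair Ω G Θ S α β) {ζ₀ : ℂ}
    (hζ₀ : ζ₀ ∈ Ω) {O : Set ℂ} (hO : O ∈ nhds ζ₀) : ∃ r > 0, Metric.ball ζ₀ r ⊆ Ω ∩ O ∧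
      (∀ q ∈ Metric.ball ζ₀ r, ∀ f₀ : F, ∃ u : ℂ → F, u q = f₀ ∧
        ContDiffOn ℝ ∞ u (Metric.ball ζ₀ r) ∧ ∀ ζ ∈ Metric.ball ζ₀ r,
          HasFDerivAt u (covec (α ζ) (β ζ) - connForm (G ζ) (Θ ζ) (S ζ) (u ζ)) ζ) ∧
      (∀ u v : ℂ → F, ∀ s ⊆ Metric.ball ζ₀ r, Convex ℝ s →
        (∀ ζ ∈ s, HasFDerivAt u (covec (α ζ) (β ζ) - connForm (G ζ) (Θ ζ) (S ζ) (u ζ)) ζ) →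
        (∀ ζ ∈ s, HasFDerivAt v (covec (α ζ) (β ζ) - connForm (G ζ) (Θ ζ) (S ζ) (v ζ)) ζ) →
        ∀ q ∈ s, u q = v q → EqOn u v s) := by
  obtain ⟨R, hR, hRΩ⟩ := Metric.nhds_basis_closedBall.mem_iff.1
    (Filter.inter_mem (M.isOpen.mem_nhds hζ₀) hO)
  let χ : ContDiffBump ζ₀ := ⟨R / 2, R, by positivity, by linarith⟩
  have hχ : Metric.closedBall ζ₀ χ.rOut ⊆ Ω := fun x hx => (hRΩ hx).1
  set B := fun ζ => connForm (G ζ) (Θ ζ) (S ζ) with hBdef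
  set τ := fun ζ => covec (α ζ) (β ζ) with hτdef
  have hB' : ContDiff ℝ ∞ (fun ζ => χ ζ • B ζ) := contDiff_bump_smul M.isOpen M.contDiffOn_connForm χ hχ
  have hτ' : ContDiff ℝ ∞ (fun ζ => χ ζ • τ ζ) := contDiff_bump_smul M.isOpen
    (contDiffOn_covec hαβ.smooth_left hαβ.smooth_right) χ hχ
  obtain ⟨a, ha0, ha⟩ := exists_norm_le_on_closedBall hB' ζ₀ R
  obtain ⟨C, -, hC⟩ := exists_norm_le_on_closedBall hτ' ζ₀ R
  -- The three bounds make the cutoff equal to 1, the diameter at most 1, and `a` times the diameter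
  -- at most `1 / 4`; `a + 1` avoids division by zero.
  set r := min (R / 2) (min (1 / 2) (1 / (8 * (a + 1)))) with hr
  have hr0 : 0 < r := by positivity
  have hrR : r ≤ R / 2 := min_le_left _ _
  have hr1 : r ≤ 1 / 2 := (min_le_right _ _).trans (min_le_left _ _)
  have hr2 : r ≤ 1 / (8 * (a + 1)) := (min_le_right _ _).trans (min_le_right _ _)
  have hsub : Metric.ball ζ₀ r ⊆ Metric.closedBall ζ₀ R :=
    Metric.ball_subset_closedBall.trans (Metric.closedBall_subset_closedBall (by linarith))
  have hone : ∀ ζ ∈ Metric.ball ζ₀ r, χ ζ = 1 := fun ζ hζ =>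
    χ.one_of_mem_closedBall (Metric.mem_closedBall.2
      ((Metric.mem_ball.1 hζ).le.trans hrR))
  have hBeq : ∀ ζ ∈ Metric.ball ζ₀ r, χ ζ • B ζ = B ζ := fun ζ hζ => by rw [hone ζ hζ, one_smul]
  have hτeq : ∀ ζ ∈ Metric.ball ζ₀ r, χ ζ • τ ζ = τ ζ := fun ζ hζ => by rw [hone ζ hζ, one_smul]
  have hdist : ∀ x ∈ Metric.ball ζ₀ r, ∀ y ∈ Metric.ball ζ₀ r, ‖x - y‖ ≤ 2 * r := by
    intro x hx y hy
    rw [← dist_eq_norm]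
    have := dist_triangle_right x y ζ₀
    rw [Metric.mem_ball] at hx hy
    linarith
  have hball : Metric.ball ζ₀ r ⊆ Ω := fun ζ hζ => (hRΩ (hsub hζ)).1
  refine ⟨r, hr0, fun ζ hζ => hRΩ (hsub hζ), fun q hq f₀ => ?_, ?_⟩
  · obtain ⟨u, huq, hu⟩ := exists_hasFDerivAt_eq_sub (B := fun ζ => χ ζ • B ζ)
      (τ := fun ζ => χ ζ • τ ζ) (hB'.of_le (by exact_mod_cast le_top))
      (hτ'.of_le (by exact_mod_cast le_top))
      (convex_ball ζ₀ r) Metric.isOpen_ball (a := a) (C := C)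
      (fun x hx => ha x (hsub hx))
      (fun x hx => hC x (hsub hx))
      (fun x hx y hy => (hdist x hx y hy).trans (by linarith))
      (fun x hx y hy => by
        calc a * ‖x - y‖ ≤ (a + 1) * (2 * r) :=
              mul_le_mul (by linarith) (hdist x hx y hy) (norm_nonneg _) (by linarith)
          _ ≤ (a + 1) * (2 * (1 / (8 * (a + 1)))) := by gcongr
          _ = 1 / 4 := by field_simp; norm_num)
      (fun x hx f v w => by
        have he : (fun ζ => χ ζ • B ζ) =ᶠ[nhds x] B := by
          filter_upwards [Metric.isOpen_ball.mem_nhds hx] with ξ hξ using hBeq ξ hξ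
        rw [he.fderiv_eq, hBeq x hx]
        exact M.connForm_flat (hball hx) f v w)
      (fun x hx v w => by
        have he : (fun ζ => χ ζ • τ ζ) =ᶠ[nhds x] τ := by
          filter_upwards [Metric.isOpen_ball.mem_nhds hx] with ξ hξ using hτeq ξ hξ
        rw [he.fderiv_eq, hBeq x hx, hτeq x hx, fderiv_covec_sub M.isOpen (hball hx)
          hαβ.smooth_left hαβ.smooth_right, hαβ.closed x (hball hx),
          eq_sub_of_add_eq (hαβ.coclosed x (hball hx))]
        simp only [hBdef, hτdef, connForm_apply, covec_apply]
        simp only [map_add, LinearMap.map_smul]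
        module) hq f₀
    have hu' : ∀ ζ ∈ Metric.ball ζ₀ r, HasFDerivAt u (τ ζ - B ζ (u ζ)) ζ := by
      intro ζ hζ
      have := hu ζ hζ
      rwa [hBeq ζ hζ, hτeq ζ hζ] at this
    exact ⟨u, huq, contDiffOn_of_hasFDerivAt_eq_sub Metric.isOpen_ball
      (M.contDiffOn_connForm.mono hball)
      ((contDiffOn_covec hαβ.smooth_left hαβ.smooth_right).mono hball) hu', hu'⟩
  · intro u v s hs hconv hu hv q hq huv ζ hζ
    have := eq_zero_of_hasFDerivAt_eq_neg (B := B) (K := a)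
      (fun x hx => by
        rw [← hBeq x (hs hx)]; exact ha x (hsub (hs hx))) hconv
      (u := fun ζ => u ζ - v ζ) (fun x hx => by
        have h := (hu x hx).sub (hv x hx)
        refine h.congr_fderiv ?_
        rw [map_sub]
        abel) hq (sub_eq_zero.2 huv) ζ hζ
    exact sub_eq_zero.1 this

end LocalHiggs

end LocalPrimitives

end HiggsSurface

namespace HiggsSurface

/-! ### Charts and tangent vectors -/

section Charts

variable {X : Type*} [TopologicalSpace X] [ChartedSpace ℂ X]

/-- The tangent vector with coefficient `c` in the chart `φ`, at the point with coordinate `ξ`. -/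
def chartVec (φ : OpenPartialHomeomorph X ℂ) (ξ c : ℂ) : T (φ.symm ξ) :=
  (fderiv ℝ (chartAt ℂ (φ.symm ξ) ∘ φ.symm) ξ c : ℂ)

variable [IsManifold 𝓘(ℂ, ℂ) ω X]

theorem chartAt_mem_realAtlas (x : X) :
    chartAt ℂ x ∈ IsManifold.maximalAtlas 𝓘(ℝ, ℂ) ∞ X :=
  IsManifold.chart_mem_maximalAtlas x

theorem contDiffOn_transition {φ ψ : OpenPartialHomeomorph X ℂ}
    (hφ : φ ∈ IsManifold.maximalAtlas 𝓘(ℝ, ℂ) ∞ X) (hψ : ψ ∈ IsManifold.maximalAtlas 𝓘(ℝ, ℂ) ∞ X) :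
    ContDiffOn ℝ ∞ (ψ ∘ φ.symm) (φ.target ∩ φ.symm ⁻¹' ψ.source) := by
  rw [← contMDiffOn_iff_contDiffOn]
  exact (contMDiffOn_of_mem_maximalAtlas hψ).comp
    ((contMDiffOn_symm_of_mem_maximalAtlas hφ).mono inter_subset_left) fun x hx => hx.2

theorem isOpen_transition_domain (φ ψ : OpenPartialHomeomorph X ℂ) :
    IsOpen (φ.target ∩ φ.symm ⁻¹' ψ.source) :=
  φ.symm.isOpen_inter_preimage ψ.open_source

theorem contDiffAt_transition {φ ψ : OpenPartialHomeomorph X ℂ}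
    (hφ : φ ∈ IsManifold.maximalAtlas 𝓘(ℝ, ℂ) ∞ X) (hψ : ψ ∈ IsManifold.maximalAtlas 𝓘(ℝ, ℂ) ∞ X)
    {ξ : ℂ} (hξ : ξ ∈ φ.target) (hξ' : φ.symm ξ ∈ ψ.source) :
    ContDiffAt ℝ ∞ (ψ ∘ φ.symm) ξ :=
  (contDiffOn_transition hφ hψ).contDiffAt ((isOpen_transition_domain φ ψ).mem_nhds ⟨hξ, hξ'⟩)

theorem differentiableAt_transition {φ ψ : OpenPartialHomeomorph X ℂ}
    (hφ : φ ∈ IsManifold.maximalAtlas 𝓘(ℝ, ℂ) ∞ X) (hψ : ψ ∈ IsManifold.maximalAtlas 𝓘(ℝ, ℂ) ∞ X)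
    {ξ : ℂ} (hξ : ξ ∈ φ.target) (hξ' : φ.symm ξ ∈ ψ.source) :
    DifferentiableAt ℝ (ψ ∘ φ.symm) ξ :=
  (contDiffAt_transition hφ hψ hξ hξ').differentiableAt (by simp)

theorem differentiableAt_chart_comp {G : Type*} [NormedAddCommGroup G] [NormedSpace ℝ G]
    {φ ψ : OpenPartialHomeomorph X ℂ}
    (hφ : φ ∈ IsManifold.maximalAtlas 𝓘(ℝ, ℂ) ∞ X) (hψ : ψ ∈ IsManifold.maximalAtlas 𝓘(ℝ, ℂ) ∞ X)
    {f : X → G} {y : X} (hy : y ∈ φ.source) (hy' : y ∈ ψ.source)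
    (hf : DifferentiableAt ℝ (f ∘ φ.symm) (φ y)) :
    DifferentiableAt ℝ (f ∘ ψ.symm) (ψ y) ∧
      fderiv ℝ (f ∘ ψ.symm) (ψ y) = (fderiv ℝ (f ∘ φ.symm) (φ y)).comp
        (fderiv ℝ (φ ∘ ψ.symm) (ψ y)) := by
  have h1 : (f ∘ ψ.symm) =ᶠ[𝓝 (ψ y)] (f ∘ φ.symm) ∘ (φ ∘ ψ.symm) := by
    filter_upwards [(isOpen_transition_domain ψ φ).mem_nhds
      ⟨ψ.map_source hy', by simpa [ψ.left_inv hy'] using hy⟩] with ξ hξ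
    simp [φ.left_inv hξ.2]
  have h2 : DifferentiableAt ℝ (φ ∘ ψ.symm) (ψ y) :=
    differentiableAt_transition hψ hφ (ψ.map_source hy') (by rwa [ψ.left_inv hy'])
  have h3 : HasFDerivAt (f ∘ φ.symm) (fderiv ℝ (f ∘ φ.symm) (φ y)) ((φ ∘ ψ.symm) (ψ y)) := by
    rw [Function.comp_apply, ψ.left_inv hy']
    exact hf.hasFDerivAt
  have h4 := (h3.comp (ψ y) h2.hasFDerivAt).congr_of_eventuallyEq h1
  exact ⟨h4.differentiableAt, h4.fderiv⟩

theorem mdifferentiableAt_iff_chart {G : Type*} [NormedAddCommGroup G] [NormedSpace ℝ G]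
    {f : X → G} {y : X} : MDifferentiableAt 𝓘(ℝ, ℂ) 𝓘(ℝ, G) f y ↔
      DifferentiableAt ℝ (f ∘ (chartAt ℂ y).symm) (chartAt ℂ y y) := by
  rw [mdifferentiableAt_iff]
  simp only [writtenInExtChartAt, extChartAt, mfld_simps, differentiableWithinAt_univ]
  refine ⟨fun h => h.2, fun h => ⟨?_, h⟩⟩
  have := (ContinuousAt.comp h.continuousAt ((chartAt ℂ y).continuousAt (mem_chart_source ℂ y)))
  refine this.congr ?_
  filter_upwards [(chartAt ℂ y).open_source.mem_nhds (mem_chart_source ℂ y)] with x hx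
  simp [(chartAt ℂ y).left_inv hx]

theorem dReal_eq_fderiv {G : Type*} [NormedAddCommGroup G] [NormedSpace ℂ G] {f : X → G} {y : X}
    (hf : DifferentiableAt ℝ (f ∘ (chartAt ℂ y).symm) (chartAt ℂ y y)) (v : T y) :
    dReal f y v = fderiv ℝ (f ∘ (chartAt ℂ y).symm) (chartAt ℂ y y) v := by
  have h := mdifferentiableAt_iff_chart.2 hf
  have h2 : (mfderiv 𝓘(ℝ, ℂ) 𝓘(ℝ, G) f y : ℂ →L[ℝ] G)
      = fderiv ℝ (f ∘ (chartAt ℂ y).symm) (chartAt ℂ y y) := by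
    refine h.mfderiv.trans ?_
    simp only [writtenInExtChartAt, extChartAt, mfld_simps, fderivWithin_univ]
    rfl
  exact DFunLike.congr_fun h2 v

/-- `mfderiv` is computed in the preferred chart at the point. Passing to it and back cancels by the
chain rule, so any smooth chart may be used. -/
theorem dReal_chartVec {G : Type*} [NormedAddCommGroup G] [NormedSpace ℂ G] {f : X → G}
    {φ : OpenPartialHomeomorph X ℂ} (hφ : φ ∈ IsManifold.maximalAtlas 𝓘(ℝ, ℂ) ∞ X) {ξ : ℂ}
    (hξ : ξ ∈ φ.target) (hf : DifferentiableAt ℝ (f ∘ φ.symm) ξ) (c : ℂ) :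
    dReal f (φ.symm ξ) (chartVec φ ξ c) = fderiv ℝ (f ∘ φ.symm) ξ c := by
  set y := φ.symm ξ with hy
  have hys : y ∈ φ.source := φ.map_target hξ
  have hφy : φ y = ξ := φ.right_inv hξ
  have h1 := differentiableAt_chart_comp hφ (chartAt_mem_realAtlas y) hys (mem_chart_source ℂ y)
    (by rwa [hφy])
  have h2 := differentiableAt_chart_comp (chartAt_mem_realAtlas y) hφ (mem_chart_source ℂ y) hys h1.1
  rw [dReal_eq_fderiv h1.1, ← hφy, h2.2]
  simp only [ContinuousLinearMap.comp_apply]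
  unfold chartVec
  rw [hφy]

theorem chartVec_eq {φ ψ : OpenPartialHomeomorph X ℂ}
    (hφ : φ ∈ IsManifold.maximalAtlas 𝓘(ℝ, ℂ) ∞ X) (hψ : ψ ∈ IsManifold.maximalAtlas 𝓘(ℝ, ℂ) ∞ X)
    {y : X} (hy : y ∈ φ.source) (hy' : y ∈ ψ.source) (c : ℂ) :
    (chartVec φ (φ y) c : ℂ) = (chartVec ψ (ψ y) (fderiv ℝ (ψ ∘ φ.symm) (φ y) c) : ℂ) := by
  unfold chartVec
  rw [φ.left_inv hy, ψ.left_inv hy']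
  have h := differentiableAt_chart_comp hψ hφ (f := chartAt ℂ y) hy' hy
    (differentiableAt_transition hψ (chartAt_mem_realAtlas y) (ψ.map_source hy')
      (by rw [ψ.left_inv hy']; exact mem_chart_source ℂ y))
  rw [h.2]
  rfl

/-- `coordVec` comes from a complex derivative of the transition map and `chartVec` from a real one;
they agree since the transition is holomorphic. This links bundle coordinates to arbitrary real
charts. -/
theorem coordVec_eq_chartVec (x₀ : X) (c : ℂ) {ζ : ℂ} (hζ : ζ ∈ (chartAt ℂ x₀).target) :
    coordVec x₀ c ((chartAt ℂ x₀).symm ζ) = chartVec (chartAt ℂ x₀) ζ c := by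
  have hy : (chartAt ℂ x₀).symm ζ ∈ (chartAt ℂ x₀).source := (chartAt ℂ x₀).map_target hζ
  unfold coordVec chartVec
  rw [TangentBundle.symmL_trivializationAt_eq_core hy, tangentBundleCore_coordChange_achart]
  simp only [extChartAt, mfld_simps, fderivWithin_univ, (chartAt ℂ x₀).right_inv hζ]
  have hd : DifferentiableAt ℂ (chartAt ℂ ((chartAt ℂ x₀).symm ζ) ∘ (chartAt ℂ x₀).symm) ζ := by
    have h1 : MDifferentiableAt 𝓘(ℂ, ℂ) 𝓘(ℂ, ℂ)
        (chartAt ℂ ((chartAt ℂ x₀).symm ζ) ∘ (chartAt ℂ x₀).symm) ζ := by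
      refine MDifferentiableAt.comp (I' := 𝓘(ℂ, ℂ)) ζ ?_ ?_
      · exact mdifferentiableAt_atlas (chart_mem_atlas ℂ _) (mem_chart_source ℂ _)
      · exact mdifferentiableAt_atlas_symm (chart_mem_atlas ℂ _) hζ
    exact mdifferentiableAt_iff_differentiableAt.1 h1
  rw [hd.fderiv_restrictScalars ℝ]
  rfl

theorem mfderiv_symm_eq_chartVec {φ : OpenPartialHomeomorph X ℂ}
    (hφ : φ ∈ IsManifold.maximalAtlas 𝓘(ℝ, ℂ) ∞ X) {ξ : ℂ} (hξ : ξ ∈ φ.target) (c : ℂ) :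
    (mfderiv 𝓘(ℝ, ℂ) 𝓘(ℝ, ℂ) φ.symm ξ c : ℂ) = (chartVec φ ξ c : ℂ) := by
  have h : MDifferentiableAt 𝓘(ℝ, ℂ) 𝓘(ℝ, ℂ) φ.symm ξ :=
    ((contMDiffOn_symm_of_mem_maximalAtlas hφ).contMDiffAt
      (φ.open_target.mem_nhds hξ)).mdifferentiableAt (by simp)
  have h2 : (mfderiv 𝓘(ℝ, ℂ) 𝓘(ℝ, ℂ) φ.symm ξ : ℂ →L[ℝ] ℂ)
      = fderiv ℝ (chartAt ℂ (φ.symm ξ) ∘ φ.symm) ξ := by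
    refine h.mfderiv.trans ?_
    simp only [writtenInExtChartAt, extChartAt, mfld_simps, fderivWithin_univ]
    rfl
  exact DFunLike.congr_fun h2 c

theorem mfderiv_chart_eq {φ : OpenPartialHomeomorph X ℂ}
    (hφ : φ ∈ IsManifold.maximalAtlas 𝓘(ℝ, ℂ) ∞ X) {y : X} (hy : y ∈ φ.source) :
    (mfderiv 𝓘(ℝ, ℂ) 𝓘(ℝ, ℂ) φ y : ℂ →L[ℝ] ℂ)
      = fderiv ℝ (φ ∘ (chartAt ℂ y).symm) (chartAt ℂ y y) := by
  have h : MDifferentiableAt 𝓘(ℝ, ℂ) 𝓘(ℝ, ℂ) φ y :=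
    ((contMDiffOn_of_mem_maximalAtlas hφ).contMDiffAt
      (φ.open_source.mem_nhds hy)).mdifferentiableAt (by simp)
  refine h.mfderiv.trans ?_
  simp only [writtenInExtChartAt, extChartAt, mfld_simps, fderivWithin_univ]
  rfl

end Charts

end HiggsSurface

namespace HiggsSurface

/-! ### Representing sesquilinear functionals -/

section Representation

variable {F : Type*} [NormedAddCommGroup F] [NormedSpace ℂ F] [FiniteDimensional ℂ F]

/-- The real isomorphism `Re H` represents `Re ℓ`; testing with `i a` instead of `a` then matches
the imaginary parts. -/
theorem exists_form_eq {H : F →ₗ[ℂ] F →ₗ⋆[ℂ] ℂ} (hpos : ∀ a, a ≠ 0 → 0 < (H a a).re)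
    (ℓ : F → ℂ) (hadd : ∀ a b, ℓ (a + b) = ℓ a + ℓ b) (hsmul : ∀ (c : ℂ) a, ℓ (c • a) = conj c * ℓ a) :
    ∃ w, ∀ a, H w a = ℓ a := by
  obtain ⟨e, he⟩ := exists_equiv_reForm hpos
  let L : F →L[ℝ] ℝ := LinearMap.toContinuousLinearMap
    { toFun := fun a => (ℓ a).re
      map_add' := fun a b => by simp [hadd]
      map_smul' := fun r a => by
        rw [← Complex.coe_smul, hsmul]; simp }
  have h1 : ∀ a, (H (e.symm L) a).re = (ℓ a).re := by
    intro a
    rw [← reForm_apply, ← he]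
    simp [L]
  refine ⟨e.symm L, fun a => Complex.ext (h1 a) ?_⟩
  have h2 := h1 (Complex.I • a)
  rw [map_smulₛₗ, hsmul] at h2
  simpa using h2

theorem exists_linear_form_eq {H : F →ₗ[ℂ] F →ₗ⋆[ℂ] ℂ} (hpos : ∀ a, a ≠ 0 → 0 < (H a a).re)
    (ℓ : F → F → ℂ) (hadd : ∀ u a b, ℓ u (a + b) = ℓ u a + ℓ u b)
    (hsmul : ∀ u (c : ℂ) a, ℓ u (c • a) = conj c * ℓ u a)
    (hadd' : ∀ u v a, ℓ (u + v) a = ℓ u a + ℓ v a) (hsmul' : ∀ (c : ℂ) u a, ℓ (c • u) a = c * ℓ u a) :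
    ∃ G : F →ₗ[ℂ] F, ∀ u a, H (G u) a = ℓ u a := by
  choose w hw using fun u => exists_form_eq hpos (ℓ u) (hadd u) (hsmul u)
  exact ⟨{
    toFun := w
    map_add' := fun u v => form_ext hpos fun a => by simp [hw, hadd']
    map_smul' := fun c u => form_ext hpos fun a => by simp [hw, hsmul'] }, hw⟩

/-- The endomorphism `G` with `H (G u) a = ℓ u a`, if there is one. -/
def represent (H : F →ₗ[ℂ] F →ₗ⋆[ℂ] ℂ) (ℓ : F → F → ℂ) : F →ₗ[ℂ] F :=
  Classical.epsilon fun G => ∀ u a, H (G u) a = ℓ u a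

theorem represent_spec {H : F →ₗ[ℂ] F →ₗ⋆[ℂ] ℂ} (hpos : ∀ a, a ≠ 0 → 0 < (H a a).re)
    (ℓ : F → F → ℂ) (hadd : ∀ u a b, ℓ u (a + b) = ℓ u a + ℓ u b)
    (hsmul : ∀ u (c : ℂ) a, ℓ u (c • a) = conj c * ℓ u a)
    (hadd' : ∀ u v a, ℓ (u + v) a = ℓ u a + ℓ v a) (hsmul' : ∀ (c : ℂ) u a, ℓ (c • u) a = c * ℓ u a)
    (u a : F) : H (represent H ℓ u) a = ℓ u a :=
  Classical.epsilon_spec (p := fun G : F →ₗ[ℂ] F => ∀ u a, H (G u) a = ℓ u a)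
    (exists_linear_form_eq hpos ℓ hadd hsmul hadd' hsmul') u a

end Representation

/-! ### Local coefficients of a Higgs bundle -/

section Local

variable {X : Type*} [TopologicalSpace X] [ChartedSpace ℂ X] [IsManifold 𝓘(ℂ, ℂ) ω X]
  (F : Type*) [NormedAddCommGroup F] [NormedSpace ℂ F] [FiniteDimensional ℂ F]
  (E : X → Type*) [∀ x, AddCommGroup (E x)] [∀ x, Module ℂ (E x)]
  [TopologicalSpace (TotalSpace F E)] [∀ x, TopologicalSpace (E x)]
  [FiberBundle F E] [VectorBundle ℂ F E] [ContMDiffVectorBundle ω F E 𝓘(ℂ, ℂ)]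

theorem coordVec_mul (x₀ : X) (a c : ℂ) (y : X) : coordVec x₀ (a * c) y = a • coordVec x₀ c y := by
  unfold coordVec
  rw [← smul_eq_mul, map_smul]

theorem coordVec_eq_smul (x₀ : X) (c : ℂ) (y : X) : coordVec x₀ c y = c • coordVec x₀ 1 y := by
  rw [← coordVec_mul, mul_one]

/-- The frame of `E` over the base set of the trivialization at `x₀`. -/
def frame (x₀ y : X) : F →ₗ[ℂ] E y := (trivializationAt F E x₀).symmₗ ℂ y

/-- The coordinates of a vector in the trivialization at `x₀`. -/
def coord (x₀ y : X) : E y →ₗ[ℂ] F := (trivializationAt F E x₀).linearMapAt ℂ y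

variable {E} in
/-- The coordinates of a section, in the chart and the trivialization at `x₀`. -/
def loc (x₀ : X) (s : ∀ x, E x) (ζ : ℂ) : F :=
  coord F E x₀ ((chartAt ℂ x₀).symm ζ) (s ((chartAt ℂ x₀).symm ζ))

/-- The part of the target of the chart at `x₀` over which the trivialization at `x₀` lives. -/
def locDom (x₀ : X) : Set ℂ :=
  (chartAt ℂ x₀).target ∩ (chartAt ℂ x₀).symm ⁻¹' (trivializationAt F E x₀).baseSet

theorem isOpen_locDom (x₀ : X) : IsOpen (locDom F E x₀) :=
  (chartAt ℂ x₀).symm.isOpen_inter_preimage (trivializationAt F E x₀).open_baseSet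

theorem chart_mem_locDom (x₀ : X) : chartAt ℂ x₀ x₀ ∈ locDom F E x₀ :=
  ⟨mem_chart_target ℂ x₀, by
    rw [mem_preimage, (chartAt ℂ x₀).left_inv (mem_chart_source ℂ x₀)]
    exact FiberBundle.mem_baseSet_trivializationAt' x₀⟩

variable {E}

theorem coord_apply {x₀ y : X} (hy : y ∈ (trivializationAt F E x₀).baseSet) (a : E y) :
    coord F E x₀ y a = (trivializationAt F E x₀ ⟨y, a⟩).2 := by
  rw [coord, Trivialization.coe_linearMapAt_of_mem _ hy]

theorem frame_apply {x₀ y : X} (hy : y ∈ (trivializationAt F E x₀).baseSet) (u : F) :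
    frame F E x₀ y u = (trivializationAt F E x₀).symm y u := by
  rw [frame, Trivialization.symmₗ_apply _ hy]

theorem frame_coord {x₀ y : X} (hy : y ∈ (trivializationAt F E x₀).baseSet) (a : E y) :
    frame F E x₀ y (coord F E x₀ y a) = a :=
  Trivialization.symmₗ_linearMapAt _ hy a

theorem coord_frame {x₀ y : X} (hy : y ∈ (trivializationAt F E x₀).baseSet) (u : F) :
    coord F E x₀ y (frame F E x₀ y u) = u :=
  Trivialization.linearMapAt_symmₗ _ hy u

variable {F}

/-- The Hermitian metric in the trivialization and chart at `x₀`. -/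
def locForm (h : HermitianMetric F E) (x₀ : X) (ζ : ℂ) : F →ₗ[ℂ] F →ₗ⋆[ℂ] ℂ :=
  LinearMap.mk₂'ₛₗ (RingHom.id ℂ) (starRingEnd ℂ)
    (fun u a => h.inner ((chartAt ℂ x₀).symm ζ) (frame F E x₀ _ u) (frame F E x₀ _ a))
    (by simp) (by simp) (by simp) (by simp)

theorem locForm_apply (h : HermitianMetric F E) (x₀ : X) (ζ : ℂ) (u a : F) :
    locForm h x₀ ζ u a =
      h.inner ((chartAt ℂ x₀).symm ζ) (frame F E x₀ _ u) (frame F E x₀ _ a) := rfl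

/-- The Higgs field in the trivialization and chart at `x₀`. -/
def locHiggs (θ : HiggsField F E) (x₀ : X) (ζ : ℂ) : F →ₗ[ℂ] F :=
  coord F E x₀ _ ∘ₗ θ.toFun ((chartAt ℂ x₀).symm ζ) (coordVec x₀ 1 _) ∘ₗ frame F E x₀ _

/-- The coefficient of the Chern connection in the trivialization and chart at `x₀`. -/
def locConn (h : HermitianMetric F E) (x₀ : X) (ζ : ℂ) : F →ₗ[ℂ] F :=
  represent (locForm h x₀ ζ) fun u a => dz (fun ξ => locForm h x₀ ξ u a) ζ

/-- The adjoint of the Higgs field in the trivialization and chart at `x₀`. -/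
def locAdj (θ : HiggsField F E) (h : HermitianMetric F E) (x₀ : X) (ζ : ℂ) : F →ₗ[ℂ] F :=
  represent (locForm h x₀ ζ) fun u a => locForm h x₀ ζ u (locHiggs θ x₀ ζ a)

section LocForm

variable (h : HermitianMetric F E) (x₀ : X)

theorem locForm_symm (ζ : ℂ) (u a : F) : locForm h x₀ ζ a u = conj (locForm h x₀ ζ u a) :=
  h.symm _ _ _

theorem locForm_pos {ζ : ℂ} (hζ : ζ ∈ locDom F E x₀) (a : F) (ha : a ≠ 0) :
    0 < (locForm h x₀ ζ a a).re := by
  refine h.pos _ _ fun h0 => ha ?_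
  rw [← coord_frame F hζ.2 a, h0, map_zero]

theorem contDiffOn_comp_chart_symm {G : Type*} [NormedAddCommGroup G] [NormedSpace ℝ G] {f : X → G}
    {A : Set X} (hf : ContMDiffOn 𝓘(ℝ, ℂ) 𝓘(ℝ, G) ∞ f A) :
    ContDiffOn ℝ ∞ (f ∘ (chartAt ℂ x₀).symm)
      ((chartAt ℂ x₀).target ∩ (chartAt ℂ x₀).symm ⁻¹' A) := by
  rw [← contMDiffOn_iff_contDiffOn]
  exact hf.comp ((contMDiffOn_symm_of_mem_maximalAtlas (chartAt_mem_realAtlas x₀)).mono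
    inter_subset_left) fun x hx => hx.2

theorem contDiffOn_locForm (u a : F) :
    ContDiffOn ℝ ∞ (fun ζ => locForm h x₀ ζ u a) (locDom F E x₀) :=
  (contDiffOn_comp_chart_symm x₀ (h.smooth x₀ u a)).congr fun ζ hζ => by
    simp [locForm_apply, frame_apply F hζ.2]

theorem differentiableAt_locForm {ζ : ℂ} (hζ : ζ ∈ locDom F E x₀) (u a : F) :
    DifferentiableAt ℝ (fun ζ => locForm h x₀ ζ u a) ζ :=
  ((contDiffOn_locForm h x₀ u a).contDiffAt ((isOpen_locDom F E x₀).mem_nhds hζ)).differentiableAt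
    (by simp)

theorem dz_add {G : Type*} [NormedAddCommGroup G] [NormedSpace ℂ G] {f g : ℂ → G} {ζ : ℂ}
    (hf : DifferentiableAt ℝ f ζ) (hg : DifferentiableAt ℝ g ζ) :
    dz (fun ξ => f ξ + g ξ) ζ = dz f ζ + dz g ζ := by
  have h : HasFDerivAt (fun ξ => f ξ + g ξ) _ ζ := hf.hasFDerivAt.add hg.hasFDerivAt
  simp only [dz, h.fderiv, add_apply]
  module

theorem dz_const_smul {G : Type*} [NormedAddCommGroup G] [NormedSpace ℂ G] {f : ℂ → G} {ζ : ℂ}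
    (hf : DifferentiableAt ℝ f ζ) (c : ℂ) : dz (fun ξ => c • f ξ) ζ = c • dz f ζ := by
  have h : HasFDerivAt (fun ξ => c • f ξ) _ ζ := hf.hasFDerivAt.const_smul c
  simp only [dz, h.fderiv, smul_apply]
  module

/-- The derivative `∂/∂z` of the metric coefficients is linear in `u` and conjugate-linear in `a`,
hence representable by an endomorphism. -/
theorem locConn_spec {ζ : ℂ} (hζ : ζ ∈ locDom F E x₀) (u a : F) :
    locForm h x₀ ζ (locConn h x₀ ζ u) a = dz (fun ξ => locForm h x₀ ξ u a) ζ := by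
  refine represent_spec (locForm_pos h x₀ hζ) (fun u a => dz (fun ξ => locForm h x₀ ξ u a) ζ)
    ?_ ?_ ?_ ?_ u a
  · intro u a b
    simp only [map_add]
    exact dz_add (differentiableAt_locForm h x₀ hζ _ _) (differentiableAt_locForm h x₀ hζ _ _)
  · intro u c a
    simp only [map_smulₛₗ]
    exact dz_const_smul (differentiableAt_locForm h x₀ hζ _ _) _
  · intro u v a
    simp only [map_add, LinearMap.add_apply]
    exact dz_add (differentiableAt_locForm h x₀ hζ _ _) (differentiableAt_locForm h x₀ hζ _ _)
  · intro c u a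
    simp only [map_smul, LinearMap.smul_apply]
    exact dz_const_smul (differentiableAt_locForm h x₀ hζ _ _) _

theorem locAdj_spec (θ : HiggsField F E) {ζ : ℂ} (hζ : ζ ∈ locDom F E x₀) (u a : F) :
    locForm h x₀ ζ (locAdj θ h x₀ ζ u) a = locForm h x₀ ζ u (locHiggs θ x₀ ζ a) :=
  represent_spec (locForm_pos h x₀ hζ) (fun u a => locForm h x₀ ζ u (locHiggs θ x₀ ζ a))
    (by simp) (by simp) (by simp) (by simp) u a

theorem differentiableOn_locHiggs (θ : HiggsField F E) (u : F) :
    DifferentiableOn ℂ (fun ζ => locHiggs θ x₀ ζ u) (locDom F E x₀) := by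
  rw [← mdifferentiableOn_iff_differentiableOn]
  have h1 : MDifferentiableOn 𝓘(ℂ, ℂ) 𝓘(ℂ, ℂ) (chartAt ℂ x₀).symm (chartAt ℂ x₀).target :=
    mdifferentiableOn_atlas_symm (chart_mem_atlas ℂ x₀)
  refine ((θ.holomorphic x₀ u).comp (h1.mono inter_subset_left) ?_).congr fun ζ hζ => ?_
  · exact fun ζ hζ => ⟨(chartAt ℂ x₀).map_target hζ.1, hζ.2⟩
  · simp [locHiggs, coord_apply F hζ.2, frame_apply F hζ.2]

end LocForm

end Local

end HiggsSurface

namespace HiggsSurface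

/-! ### First order operators in local coordinates -/

section LocalOperators

variable {X : Type*} [TopologicalSpace X] [ChartedSpace ℂ X] [IsManifold 𝓘(ℂ, ℂ) ω X]
  {F : Type*} [NormedAddCommGroup F] [NormedSpace ℂ F] [FiniteDimensional ℂ F]
  {E : X → Type*} [∀ x, AddCommGroup (E x)] [∀ x, Module ℂ (E x)]
  [TopologicalSpace (TotalSpace F E)] [∀ x, TopologicalSpace (E x)]
  [FiberBundle F E] [VectorBundle ℂ F E] [ContMDiffVectorBundle ω F E 𝓘(ℂ, ℂ)]

theorem part10_dReal_coordVec {G : Type*} [NormedAddCommGroup G] [NormedSpace ℂ G] {f : X → G}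
    {x₀ : X} {ζ : ℂ} (hζ : ζ ∈ (chartAt ℂ x₀).target)
    (hf : DifferentiableAt ℝ (f ∘ (chartAt ℂ x₀).symm) ζ) (c : ℂ) :
    part10 (dReal f ((chartAt ℂ x₀).symm ζ)) (coordVec x₀ c ((chartAt ℂ x₀).symm ζ))
      = c • dz (f ∘ (chartAt ℂ x₀).symm) ζ := by
  rw [← part10_fderiv]
  unfold part10
  rw [← coordVec_mul]
  simp only [coordVec_eq_chartVec x₀ _ hζ, dReal_chartVec (chartAt_mem_realAtlas x₀) hζ hf,
    smul_eq_mul]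

theorem part01_dReal_coordVec {G : Type*} [NormedAddCommGroup G] [NormedSpace ℂ G] {f : X → G}
    {x₀ : X} {ζ : ℂ} (hζ : ζ ∈ (chartAt ℂ x₀).target)
    (hf : DifferentiableAt ℝ (f ∘ (chartAt ℂ x₀).symm) ζ) (c : ℂ) :
    part01 (dReal f ((chartAt ℂ x₀).symm ζ)) (coordVec x₀ c ((chartAt ℂ x₀).symm ζ))
      = conj c • dzb (f ∘ (chartAt ℂ x₀).symm) ζ := by
  rw [← part01_fderiv]
  unfold part01
  rw [← coordVec_mul]
  simp only [coordVec_eq_chartVec x₀ _ hζ, dReal_chartVec (chartAt_mem_realAtlas x₀) hζ hf,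
    smul_eq_mul]

/-- The transition from the trivialization at `x₁` to the one at `x₂`, in the chart at `x₀`. -/
def transition (F : Type*) [NormedAddCommGroup F] [NormedSpace ℂ F]
    (E : X → Type*) [∀ x, AddCommGroup (E x)] [∀ x, Module ℂ (E x)]
    [TopologicalSpace (TotalSpace F E)] [∀ x, TopologicalSpace (E x)]
    [FiberBundle F E] [VectorBundle ℂ F E] (x₀ x₁ x₂ : X) (ζ : ℂ) : F →L[ℂ] F :=
  (trivializationAt F E x₁).coordChangeL ℂ (trivializationAt F E x₂) ((chartAt ℂ x₀).symm ζ)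

theorem transition_coord {x₀ x₁ x₂ : X} {ζ : ℂ}
    (h₁ : (chartAt ℂ x₀).symm ζ ∈ (trivializationAt F E x₁).baseSet)
    (h₂ : (chartAt ℂ x₀).symm ζ ∈ (trivializationAt F E x₂).baseSet) (a : E ((chartAt ℂ x₀).symm ζ)) :
    transition F E x₀ x₁ x₂ ζ (coord F E x₁ _ a) = coord F E x₂ _ a := by
  unfold transition
  rw [ContinuousLinearEquiv.coe_coe, Trivialization.coordChangeL_apply _ _ ⟨h₁, h₂⟩,
    ← frame_apply F h₁, frame_coord F h₁, coord_apply F h₂]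

theorem contDiffAt_transition_coord {x₀ x₁ x₂ : X} {ζ : ℂ} (hζ : ζ ∈ (chartAt ℂ x₀).target)
    (h₁ : (chartAt ℂ x₀).symm ζ ∈ (trivializationAt F E x₁).baseSet)
    (h₂ : (chartAt ℂ x₀).symm ζ ∈ (trivializationAt F E x₂).baseSet) :
    ContDiffAt ℂ ω (transition F E x₀ x₁ x₂) ζ := by
  rw [← contMDiffAt_iff_contDiffAt]
  have h := contMDiffAt_coordChangeL (n := ω) (IB := 𝓘(ℂ, ℂ)) h₁ h₂
  exact h.comp ζ ((contMDiffOn_chart_symm (I := 𝓘(ℂ, ℂ)) (n := ω) (x := x₀)).contMDiffAt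
    ((chartAt ℂ x₀).open_target.mem_nhds hζ))

theorem eventually_mem_baseSet {x₀ x : X} {ζ : ℂ} (hζ : ζ ∈ (chartAt ℂ x₀).target)
    (hx : (chartAt ℂ x₀).symm ζ ∈ (trivializationAt F E x).baseSet) :
    ∀ᶠ ξ in 𝓝 ζ, (chartAt ℂ x₀).symm ξ ∈ (trivializationAt F E x).baseSet :=
  ((chartAt ℂ x₀).continuousAt_symm hζ).eventually
    ((trivializationAt F E x).open_baseSet.mem_nhds hx)

theorem hasFDerivAt_clm_apply {A : ℂ → F →L[ℂ] F} {f : ℂ → F} {ζ : ℂ} (hA : DifferentiableAt ℂ A ζ)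
    (hf : DifferentiableAt ℝ f ζ) : DifferentiableAt ℝ (fun ξ => A ξ (f ξ)) ζ ∧ ∀ c,
      fderiv ℝ (fun ξ => A ξ (f ξ)) ζ c = c • deriv A ζ (f ζ) + A ζ (fderiv ℝ f ζ c) := by
  have h1 : HasFDerivAt (fun ξ => (A ξ).restrictScalars ℝ) _ ζ :=
    (ContinuousLinearMap.restrictScalarsL ℂ F F ℝ ℝ).hasFDerivAt.comp ζ
      (hA.hasFDerivAt.restrictScalars ℝ)
  have h2 : HasFDerivAt (fun ξ => (A ξ).restrictScalars ℝ (f ξ)) _ ζ := h1.clm_apply hf.hasFDerivAt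
  simp only [ContinuousLinearMap.coe_restrictScalars'] at h2
  refine ⟨h2.differentiableAt, fun c => ?_⟩
  rw [h2.fderiv]
  simp [add_comm]

/-- A holomorphic factor has no `∂/∂z̄`, so it passes through. -/
theorem dzb_clm_apply {A : ℂ → F →L[ℂ] F} {f : ℂ → F} {ζ : ℂ} (hA : DifferentiableAt ℂ A ζ)
    (hf : DifferentiableAt ℝ f ζ) : dzb (fun ξ => A ξ (f ξ)) ζ = A ζ (dzb f ζ) := by
  simp only [dzb, (hasFDerivAt_clm_apply hA hf).2, map_smul, map_add, one_smul, smul_add, smul_smul,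
    Complex.I_mul_I]
  module

/-- Positivity gives uniqueness of the representing vector, so the choice made in `riesz` is forced.
-/
theorem HermitianMetric.riesz_eq (h : HermitianMetric F E) {x : X} {ℓ : E x → ℂ} {w : E x}
    (hw : ∀ a, h.inner x w a = ℓ a) : h.riesz x ℓ = w := by
  have h1 : ∀ a, h.inner x (h.riesz x ℓ) a = ℓ a :=
    Classical.epsilon_spec (p := fun w => ∀ a, h.inner x w a = ℓ a) ⟨w, hw⟩
  by_contra hne
  have h2 := h.pos x _ (sub_ne_zero.2 hne)
  rw [map_sub (h.inner x), LinearMap.sub_apply, h1, hw, sub_self] at h2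
  exact lt_irrefl _ h2

theorem inner_eq_locForm (h : HermitianMetric F E) {x₀ : X} {ζ : ℂ} (hζ : ζ ∈ locDom F E x₀)
    (a b : E ((chartAt ℂ x₀).symm ζ)) :
    h.inner _ a b = locForm h x₀ ζ (coord F E x₀ _ a) (coord F E x₀ _ b) := by
  rw [locForm_apply, frame_coord F hζ.2, frame_coord F hζ.2]

variable {x₀ : X} {ζ : ℂ} (hζ : ζ ∈ locDom F E x₀)
include hζ

theorem eventuallyEq_coord_section (x : X)
    (hx : (chartAt ℂ x₀).symm ζ ∈ (trivializationAt F E x).baseSet) (s : ∀ x, E x) :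
    (fun y => (trivializationAt F E x ⟨y, s y⟩).2) ∘ (chartAt ℂ x₀).symm
      =ᶠ[𝓝 ζ] fun ξ => transition F E x₀ x₀ x ξ (loc F x₀ s ξ) := by
  filter_upwards [eventually_mem_baseSet hζ.1 hx, (isOpen_locDom F E x₀).mem_nhds hζ] with ξ hξ hξ'
  rw [loc, transition_coord hξ'.2 hξ, coord_apply F hξ]
  rfl

/-- `dbar` uses the trivialization attached to the point of evaluation, which moves. Replacing it by
the fixed one at `x₀` costs a holomorphic transition, which commutes with `∂/∂z̄`. -/
theorem dbar_coordVec {s : ∀ x, E x} (hs : DifferentiableAt ℝ (loc F x₀ s) ζ) (c : ℂ) :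
    dbar F s ((chartAt ℂ x₀).symm ζ) (coordVec x₀ c _)
      = frame F E x₀ _ (conj c • dzb (loc F x₀ s) ζ) := by
  set y := (chartAt ℂ x₀).symm ζ with hy
  have hyb : y ∈ (trivializationAt F E y).baseSet := FiberBundle.mem_baseSet_trivializationAt' y
  have hA := (contDiffAt_transition_coord (F := F) (E := E) hζ.1 hζ.2 hyb).differentiableAt (by simp)
  have hev := eventuallyEq_coord_section hζ y hyb s
  have hd := (hasFDerivAt_clm_apply hA hs).1.congr_of_eventuallyEq hev
  have h1 := part01_dReal_coordVec hζ.1 hd c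
  have h2 : dzb ((fun y' => (trivializationAt F E y ⟨y', s y'⟩).2) ∘ (chartAt ℂ x₀).symm) ζ
      = transition F E x₀ x₀ y ζ (dzb (loc F x₀ s) ζ) := by
    rw [← dzb_clm_apply hA hs]
    simp only [dzb, hev.fderiv_eq]
  rw [h2, ← coord_frame F hζ.2 (dzb (loc F x₀ s) ζ), transition_coord hζ.2 hyb] at h1
  unfold dbar
  rw [← frame_apply F hyb]
  refine (congrArg (frame F E y y) h1).trans ?_
  rw [map_smul, frame_coord F hyb, map_smul]

theorem toFun_coordVec (θ : HiggsField F E) (c : ℂ) (b : E ((chartAt ℂ x₀).symm ζ)) :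
    θ.toFun _ (coordVec x₀ c _) b = frame F E x₀ _ (c • locHiggs θ x₀ ζ (coord F E x₀ _ b)) := by
  rw [coordVec_eq_smul]
  simp [locHiggs, frame_coord F hζ.2]

theorem adj_coordVec (θ : HiggsField F E) (h : HermitianMetric F E) (c : ℂ)
    (b : E ((chartAt ℂ x₀).symm ζ)) : θ.adj h _ (coordVec x₀ c _) b
      = frame F E x₀ _ (conj c • locAdj θ h x₀ ζ (coord F E x₀ _ b)) := by
  refine h.riesz_eq fun a => ?_
  rw [inner_eq_locForm h hζ, coord_frame F hζ.2, inner_eq_locForm h hζ, toFun_coordVec hζ,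
    coord_frame F hζ.2]
  simp [locAdj_spec h x₀ θ hζ]

/-- The test section, constant in the trivialization at the point itself, is holomorphic in the
frame at `x₀`. Its `∂/∂z̄` therefore drops out of the Leibniz rule, leaving the Chern coefficient.
-/
theorem del_coordVec (h : HermitianMetric F E) {s : ∀ x, E x}
    (hs : DifferentiableAt ℝ (loc F x₀ s) ζ) (c : ℂ) :
    h.del s ((chartAt ℂ x₀).symm ζ) (coordVec x₀ c _)
      = frame F E x₀ _ (c • (dz (loc F x₀ s) ζ + locConn h x₀ ζ (loc F x₀ s ζ))) := by
  set y := (chartAt ℂ x₀).symm ζ with hy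
  refine h.riesz_eq fun a => ?_
  have hyb : y ∈ (trivializationAt F E y).baseSet := FiberBundle.mem_baseSet_trivializationAt' y
  have hB := (contDiffAt_transition_coord (F := F) (E := E) hζ.1 hyb hζ.2).differentiableAt (by simp)
  set u := (trivializationAt F E y ⟨y, a⟩).2 with hu
  have hev : (fun y' => h.inner y' (s y') ((trivializationAt F E y).symm y' u))
      ∘ (chartAt ℂ x₀).symm =ᶠ[𝓝 ζ]
        fun ξ => locForm h x₀ ξ (loc F x₀ s ξ) (transition F E x₀ y x₀ ξ u) := by
    filter_upwards [eventually_mem_baseSet hζ.1 hyb, (isOpen_locDom F E x₀).mem_nhds hζ]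
      with ξ hξ hξ'
    have h0 := transition_coord hξ hξ'.2 (frame F E y _ u)
    rw [coord_frame F hξ] at h0
    rw [Function.comp_apply, inner_eq_locForm h hξ', ← frame_apply F hξ, loc, h0]
  have hBu : DifferentiableAt ℝ (fun ξ => transition F E x₀ y x₀ ξ u) ζ :=
    (hasFDerivAt_clm_apply hB (differentiableAt_const u)).1
  have hd := (hasFDerivAt_form (isOpen_locDom F E x₀) (contDiffOn_locForm h x₀) hζ hs hBu).1
  have h1 := part10_dReal_coordVec hζ.1 (hd.congr_of_eventuallyEq hev) c
  refine Eq.trans ?_ h1.symm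
  have h2 : dz ((fun y' => h.inner y' (s y') ((trivializationAt F E y).symm y' u))
      ∘ (chartAt ℂ x₀).symm) ζ
        = dz (fun ξ => locForm h x₀ ξ (loc F x₀ s ξ) (transition F E x₀ y x₀ ξ u)) ζ := by
    simp only [dz, hev.fderiv_eq]
  rw [h2, dz_form (isOpen_locDom F E x₀) (contDiffOn_locForm h x₀) hζ hs hBu,
    dzb_clm_apply hB (differentiableAt_const u), dzb_const, map_zero, map_zero, add_zero,
    ← locConn_spec h x₀ hζ, inner_eq_locForm h hζ, coord_frame F hζ.2, hu, ← coord_apply F hyb,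
    transition_coord hyb hζ.2]
  simp
  ring

/-- The bridge to the plane: in the frame at `x₀`, `𝔻^1` is `d` plus the connection form. -/
theorem opDD_one_coordVec (θ : HiggsField F E) (h : HermitianMetric F E) {s : ∀ x, E x}
    (hs : DifferentiableAt ℝ (loc F x₀ s) ζ) (c : ℂ) :
    opDD 1 θ h s ((chartAt ℂ x₀).symm ζ) (coordVec x₀ c _)
      = frame F E x₀ _ (fderiv ℝ (loc F x₀ s) ζ c
        + connForm (locConn h x₀ ζ) (locHiggs θ x₀ ζ) (locAdj θ h x₀ ζ) (loc F x₀ s ζ) c) := by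
  unfold opDD opD'' opD'
  rw [dbar_coordVec hζ hs, del_coordVec hζ h hs, toFun_coordVec hζ, adj_coordVec hζ, one_smul,
    ← map_add, ← map_add, ← map_add]
  congr 1
  rw [connForm_apply, fderiv_eq_wirtinger]
  unfold loc
  module

theorem contMDiffAt_section_iff_loc {s : ∀ x, E x} :
    ContMDiffAt 𝓘(ℝ, ℂ) (𝓘(ℝ, ℂ).prod 𝓘(ℝ, F)) ∞ (fun x => TotalSpace.mk' F x (s x))
      ((chartAt ℂ x₀).symm ζ) ↔ ContDiffAt ℝ ∞ (loc F x₀ s) ζ := by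
  rw [contMDiffAt_section]
  set y := (chartAt ℂ x₀).symm ζ with hy
  have hyb : y ∈ (trivializationAt F E y).baseSet := FiberBundle.mem_baseSet_trivializationAt' y
  have hA : ContDiffAt ℝ ∞ (fun ξ => (transition F E x₀ x₀ y ξ).restrictScalars ℝ) ζ :=
    (ContinuousLinearMap.restrictScalarsL ℂ F F ℝ ℝ).contDiff.contDiffAt.comp ζ
      (((contDiffAt_transition_coord hζ.1 hζ.2 hyb).restrict_scalars ℝ).of_le le_top)
  have hB : ContDiffAt ℝ ∞ (fun ξ => (transition F E x₀ y x₀ ξ).restrictScalars ℝ) ζ :=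
    (ContinuousLinearMap.restrictScalarsL ℂ F F ℝ ℝ).contDiff.contDiffAt.comp ζ
      (((contDiffAt_transition_coord hζ.1 hyb hζ.2).restrict_scalars ℝ).of_le le_top)
  have hev := eventuallyEq_coord_section hζ y hyb s
  have hsymm : ContMDiffAt 𝓘(ℝ, ℂ) 𝓘(ℝ, ℂ) ∞ (chartAt ℂ x₀).symm ζ :=
    (contMDiffOn_symm_of_mem_maximalAtlas (chartAt_mem_realAtlas x₀)).contMDiffAt
      ((chartAt ℂ x₀).open_target.mem_nhds hζ.1)
  have hys : y ∈ (chartAt ℂ x₀).source := (chartAt ℂ x₀).map_target hζ.1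
  constructor
  · intro h
    have h1 : ContDiffAt ℝ ∞ ((fun y' => (trivializationAt F E y ⟨y', s y'⟩).2)
        ∘ (chartAt ℂ x₀).symm) ζ :=
      contMDiffAt_iff_contDiffAt.1 (ContMDiffAt.comp ζ (hy ▸ h) hsymm)
    refine (hB.clm_apply h1).congr_of_eventuallyEq ?_
    filter_upwards [eventually_mem_baseSet hζ.1 hyb, (isOpen_locDom F E x₀).mem_nhds hζ, hev]
      with ξ hξ hξ' h3
    rw [h3, ContinuousLinearMap.coe_restrictScalars', loc, transition_coord hξ'.2 hξ,
      transition_coord hξ hξ'.2]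
  · intro h
    have h1 := (hA.clm_apply h).congr_of_eventuallyEq hev
    have h2 : ContMDiffAt 𝓘(ℝ, ℂ) 𝓘(ℝ, F) ∞ (((fun y' => (trivializationAt F E y ⟨y', s y'⟩).2)
        ∘ (chartAt ℂ x₀).symm) ∘ chartAt ℂ x₀) y := by
      refine ContMDiffAt.comp y ?_ ((contMDiffOn_of_mem_maximalAtlas
        (chartAt_mem_realAtlas x₀)).contMDiffAt ((chartAt ℂ x₀).open_source.mem_nhds hys))
      rw [hy, (chartAt ℂ x₀).right_inv hζ.1]
      exact contMDiffAt_iff_contDiffAt.2 h1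
    refine h2.congr_of_eventuallyEq ?_
    filter_upwards [(chartAt ℂ x₀).open_source.mem_nhds hys] with p hp
    rw [Function.comp_apply, Function.comp_apply, (chartAt ℂ x₀).left_inv hp]

end LocalOperators

end HiggsSurface

namespace HiggsSurface

/-! ### Exterior derivatives in local coordinates -/

section LocalExterior

variable {X : Type*} [TopologicalSpace X] [ChartedSpace ℂ X] [IsManifold 𝓘(ℂ, ℂ) ω X]

theorem coordVec_eq_frame (x₀ : X) (c : ℂ) (y : X) :
    coordVec x₀ c y = frame ℂ (fun x : X => TangentSpace 𝓘(ℂ, ℂ) x) x₀ y c := rfl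

theorem coordVec_self (y : X) (v : T y) : coordVec y v y = v := by
  unfold coordVec
  rw [TangentBundle.symmL_trivializationAt_eq_core (mem_chart_source ℂ y)]
  have := (tangentBundleCore 𝓘(ℂ, ℂ) X).coordChange_self (achart ℂ y) y (mem_chart_source ℂ y) v
  exact this

/-- The factor `κ` is the transition function of the holomorphic tangent bundle applied to 1. If it
vanished at `ζ`, so would a coordinate vector. -/
theorem exists_coordVec_change {x₀ : X} {ζ : ℂ} (hζ : ζ ∈ (chartAt ℂ x₀).target) :
    ∃ κ : ℂ → ℂ, DifferentiableAt ℂ κ ζ ∧ κ ζ ≠ 0 ∧ ∀ᶠ ξ in 𝓝 ζ, ∀ c,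
      coordVec ((chartAt ℂ x₀).symm ζ) c ((chartAt ℂ x₀).symm ξ)
        = coordVec x₀ (c * κ ξ) ((chartAt ℂ x₀).symm ξ) := by
  set y := (chartAt ℂ x₀).symm ζ with hy
  let V := fun x : X => TangentSpace 𝓘(ℂ, ℂ) x
  have hb : ∀ x, (trivializationAt ℂ V x).baseSet = (chartAt ℂ x).source := fun x => rfl
  have h₁ : y ∈ (trivializationAt ℂ V y).baseSet := mem_chart_source ℂ y
  have h₂ : y ∈ (trivializationAt ℂ V x₀).baseSet := (chartAt ℂ x₀).map_target hζ
  have hd : DifferentiableAt ℂ (transition ℂ V x₀ y x₀) ζ :=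
    (contDiffAt_transition_coord hζ h₁ h₂).differentiableAt (by simp)
  have hev : ∀ᶠ ξ in 𝓝 ζ, ∀ c : ℂ, coordVec y c ((chartAt ℂ x₀).symm ξ)
      = coordVec x₀ (c * transition ℂ V x₀ y x₀ ξ 1) ((chartAt ℂ x₀).symm ξ) := by
    filter_upwards [eventually_mem_baseSet (F := ℂ) (E := V) hζ h₁,
      eventually_mem_baseSet (F := ℂ) (E := V) hζ h₂] with ξ hξ₁ hξ₂ c
    have h3 := transition_coord hξ₁ hξ₂ (frame ℂ V y _ c)
    rw [coord_frame ℂ hξ₁] at h3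
    rw [coordVec_eq_frame, coordVec_eq_frame, ← smul_eq_mul, ← map_smul, smul_eq_mul, mul_one, h3,
      frame_coord ℂ hξ₂]
  refine ⟨fun ξ => transition ℂ V x₀ y x₀ ξ 1, hd.clm_apply (differentiableAt_const 1), ?_, hev⟩
  intro h0
  have h1 := hev.self_of_nhds 1
  simp only [h0, mul_zero] at h1
  rw [coordVec_eq_frame x₀, map_zero, ← hy] at h1
  have h2 : (1 : ℂ) = 0 := (coordVec_self y (1 : ℂ)).symm.trans h1
  exact one_ne_zero h2

variable {F : Type*} [NormedAddCommGroup F] [NormedSpace ℂ F] [FiniteDimensional ℂ F]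

theorem fderiv_mul_smul {κ : ℂ → ℂ} {α : ℂ → F} {ζ : ℂ} (hκ : DifferentiableAt ℂ κ ζ)
    (hα : DifferentiableAt ℝ α ζ) (v : ℂ) : HasFDerivAt (fun ξ => (v * κ ξ) • α ξ)
      ((v * κ ζ) • fderiv ℝ α ζ + (LinearMap.toContinuousLinearMap
        ((LinearMap.toSpanSingleton ℂ ℂ (v * deriv κ ζ)).restrictScalars ℝ)).smulRight (α ζ)) ζ := by
  have h1 : HasFDerivAt (fun ξ => v * κ ξ) _ ζ :=
    ((hκ.hasDerivAt.const_mul v).hasFDerivAt).restrictScalars ℝ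
  have h2 : HasFDerivAt (fun ξ => (v * κ ξ) • α ξ) _ ζ := h1.smul hα.hasFDerivAt
  refine h2.congr_fderiv ?_
  ext c
  simp

theorem fderiv_conj_mul_smul {κ : ℂ → ℂ} {α : ℂ → F} {ζ : ℂ} (hκ : DifferentiableAt ℂ κ ζ)
    (hα : DifferentiableAt ℝ α ζ) (v : ℂ) : HasFDerivAt (fun ξ => conj (v * κ ξ) • α ξ)
      (conj (v * κ ζ) • fderiv ℝ α ζ + (LinearMap.toContinuousLinearMap
        (Complex.conjAe.toLinearMap ∘ₗ (LinearMap.toSpanSingleton ℂ ℂ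
          (v * deriv κ ζ)).restrictScalars ℝ)).smulRight (α ζ)) ζ := by
  have h1 : HasFDerivAt (fun ξ => v * κ ξ) _ ζ :=
    ((hκ.hasDerivAt.const_mul v).hasFDerivAt).restrictScalars ℝ
  have h1' : HasFDerivAt (fun ξ => Complex.conjCLE (v * κ ξ)) _ ζ :=
    Complex.conjCLE.hasFDerivAt.comp ζ h1
  have h2 : HasFDerivAt (fun ξ => Complex.conjCLE (v * κ ξ) • α ξ) _ ζ := h1'.smul hα.hasFDerivAt
  refine (h2.congr_fderiv ?_)
  ext c
  simp

variable {E : X → Type*} [∀ x, AddCommGroup (E x)] [∀ x, Module ℂ (E x)]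
  [TopologicalSpace (TotalSpace F E)] [∀ x, TopologicalSpace (E x)]
  [FiberBundle F E] [VectorBundle ℂ F E] [ContMDiffVectorBundle ω F E 𝓘(ℂ, ℂ)]

variable {x₀ : X} {ζ : ℂ} (hζ : ζ ∈ locDom F E x₀)

/-- The coefficients of a 1-form contracted with a coordinate field of another chart. -/
theorem exists_loc_contraction (hζ : ζ ∈ (chartAt ℂ x₀).target) {τ : ∀ x : X, T x → E x}
    {α β : ℂ → F} (hτ : ∀ᶠ ξ in 𝓝 ζ, ∀ c, coord F E x₀ ((chartAt ℂ x₀).symm ξ)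
      (τ _ (coordVec x₀ c _)) = c • α ξ + conj c • β ξ)
    (hα : DifferentiableAt ℝ α ζ) (hβ : DifferentiableAt ℝ β ζ) :
    ∃ m : ℂ, ∀ a : ℂ, ∀ f : ℂ → F,
      f = loc F x₀ (fun y => τ y (coordVec ((chartAt ℂ x₀).symm ζ)
        (coordVec x₀ a ((chartAt ℂ x₀).symm ζ)) y)) →
      DifferentiableAt ℝ f ζ ∧ f ζ = a • α ζ + conj a • β ζ
        ∧ dz f ζ = a • dz α ζ + conj a • dz β ζ + (a * m) • α ζ
        ∧ dzb f ζ = a • dzb α ζ + conj a • dzb β ζ + conj (a * m) • β ζ := by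
  obtain ⟨κ, hκ, hκ0, hev⟩ := exists_coordVec_change hζ
  -- The logarithmic derivative of the coordinate change: it measures the failure of the other
  -- chart's coordinate field to be constant here, and does not depend on `a`.
  refine ⟨deriv κ ζ / κ ζ, fun a f hf => ?_⟩
  set v : ℂ := a / κ ζ with hv
  have hva : v * κ ζ = a := div_mul_cancel₀ a hκ0
  have hav : (coordVec x₀ a ((chartAt ℂ x₀).symm ζ) : ℂ) = v := by
    have := hev.self_of_nhds v
    rw [hva] at this
    rw [← this]
    exact coordVec_self _ v
  have hf' : f =ᶠ[𝓝 ζ] fun ξ => (v * κ ξ) • α ξ + conj (v * κ ξ) • β ξ := by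
    filter_upwards [hev, hτ] with ξ h1 h2
    rw [hf, loc]
    have h3 : coordVec ((chartAt ℂ x₀).symm ζ) (coordVec x₀ a ((chartAt ℂ x₀).symm ζ))
        ((chartAt ℂ x₀).symm ξ) = coordVec x₀ (v * κ ξ) ((chartAt ℂ x₀).symm ξ) := by
      rw [← h1]
      exact congrArg (fun w : ℂ => coordVec ((chartAt ℂ x₀).symm ζ) w ((chartAt ℂ x₀).symm ξ)) hav
    rw [h3, h2]
  have hd : HasFDerivAt (fun ξ => (v * κ ξ) • α ξ + conj (v * κ ξ) • β ξ) _ ζ :=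
    (fderiv_mul_smul hκ hα v).add (fderiv_conj_mul_smul hκ hβ v)
  have hd' := hd.congr_of_eventuallyEq hf'
  refine ⟨hd'.differentiableAt, by simp only [hf'.self_of_nhds, hva], ?_, ?_⟩
  · have hm : a * (deriv κ ζ / κ ζ) = v * deriv κ ζ := by rw [hv]; ring
    simp only [dz, hd'.fderiv, hva, hm]
    simp
    match_scalars <;> ring_nf <;> simp only [Complex.I_sq] <;> ring
  · have hm : a * (deriv κ ζ / κ ζ) = v * deriv κ ζ := by rw [hv]; ring
    simp only [dzb, hd'.fderiv, hva, hm]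
    simp
    match_scalars <;> ring_nf <;> simp only [Complex.I_sq] <;> ring

-- The definition of `ext1` uses the coordinate fields of the chart at the point. The correction `m`
-- from changing to the chart at `x₀` enters symmetrically in `a` and `b`, so it cancels on
-- antisymmetrizing.
include hζ in
theorem ext1_opD''_coordVec (θ : HiggsField F E) {τ : ∀ x : X, T x → E x}
    {α β : ℂ → F} (hτ : ∀ᶠ ξ in 𝓝 ζ, ∀ c, coord F E x₀ ((chartAt ℂ x₀).symm ξ)
      (τ _ (coordVec x₀ c _)) = c • α ξ + conj c • β ξ)
    (hα : DifferentiableAt ℝ α ζ) (hβ : DifferentiableAt ℝ β ζ) (a b : ℂ) :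
    ext1 (opD'' θ) τ ((chartAt ℂ x₀).symm ζ) (coordVec x₀ a _) (coordVec x₀ b _)
      = frame F E x₀ _ ((conj a * b - a * conj b) • (dzb α ζ - locHiggs θ x₀ ζ (β ζ))) := by
  obtain ⟨m, hm⟩ := exists_loc_contraction hζ.1 hτ hα hβ
  obtain ⟨ha, ha0, -, ha1⟩ := hm a _ rfl
  obtain ⟨hb, hb0, -, hb1⟩ := hm b _ rfl
  unfold ext1 opD''
  rw [dbar_coordVec hζ ha, dbar_coordVec hζ hb, toFun_coordVec hζ, toFun_coordVec hζ,
    ← map_add, ← map_add, ← map_sub, ha1, hb1]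
  unfold loc at ha0 hb0
  rw [ha0, hb0]
  congr 1
  simp only [map_add, map_smul, map_mul]
  module

-- Again the corrections `m` cancel, now in both the `∂/∂z` and the `∂/∂z̄` terms.
include hζ in
theorem ext1_chern_coordVec (h : HermitianMetric F E) {τ : ∀ x : X, T x → E x}
    {α β : ℂ → F} (hτ : ∀ᶠ ξ in 𝓝 ζ, ∀ c, coord F E x₀ ((chartAt ℂ x₀).symm ξ)
      (τ _ (coordVec x₀ c _)) = c • α ξ + conj c • β ξ)
    (hα : DifferentiableAt ℝ α ζ) (hβ : DifferentiableAt ℝ β ζ) (a b : ℂ) :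
    ext1 h.chern τ ((chartAt ℂ x₀).symm ζ) (coordVec x₀ a _) (coordVec x₀ b _)
      = frame F E x₀ _ ((a * conj b - conj a * b) •
        (dz β ζ + locConn h x₀ ζ (β ζ) - dzb α ζ)) := by
  obtain ⟨m, hm⟩ := exists_loc_contraction hζ.1 hτ hα hβ
  obtain ⟨ha, ha0, ha2, ha1⟩ := hm a _ rfl
  obtain ⟨hb, hb0, hb2, hb1⟩ := hm b _ rfl
  unfold ext1 HermitianMetric.chern
  rw [dbar_coordVec hζ ha, dbar_coordVec hζ hb, del_coordVec hζ h ha, del_coordVec hζ h hb,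
    ← map_add, ← map_add, ← map_sub, ha1, hb1, ha2, hb2, ha0, hb0]
  congr 1
  simp only [map_add, map_smul, map_mul]
  module

/-- Only the harmonic equation needs work. Applied to sections constant in the frame, it becomes an
identity between `∂G/∂z̄` and `[Θ, S]`. -/
theorem localHiggs (θ : HiggsField F E) (h : HermitianMetric F E) (hh : IsHarmonicMetric θ h)
    (x₀ : X) : LocalHiggs (locDom F E x₀) (locForm h x₀) (locConn h x₀) (locHiggs θ x₀)
      (locAdj θ h x₀) where
  isOpen := isOpen_locDom F E x₀
  symm ζ _ u a := locForm_symm h x₀ ζ u a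
  pos ζ hζ := locForm_pos h x₀ hζ
  smooth := contDiffOn_locForm h x₀
  chern ζ hζ := locConn_spec h x₀ hζ
  adjoint ζ hζ := locAdj_spec h x₀ θ hζ
  holomorphic := differentiableOn_locHiggs x₀ θ
  harmonic := by
    intro ζ hζ u
    let V : Set X := (chartAt ℂ x₀).source ∩ (trivializationAt F E x₀).baseSet
    have hV : IsOpen V := (chartAt ℂ x₀).open_source.inter (trivializationAt F E x₀).open_baseSet
    have hVζ : ∀ ξ ∈ locDom F E x₀, (chartAt ℂ x₀).symm ξ ∈ V :=
      fun ξ hξ => ⟨(chartAt ℂ x₀).map_target hξ.1, hξ.2⟩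
    -- Constant in the holomorphic frame, so its Chern derivative is `G u dz` with no `dz̄` part.
    let s : ∀ x, E x := fun y => frame F E x₀ y u
    have hloc : ∀ ξ ∈ locDom F E x₀, loc F x₀ s ξ = u := fun ξ hξ => coord_frame F hξ.2 u
    have hlev : ∀ ξ ∈ locDom F E x₀, loc F x₀ s =ᶠ[𝓝 ξ] fun _ => u := fun ξ hξ => by
      filter_upwards [(isOpen_locDom F E x₀).mem_nhds hξ] with η hη using hloc η hη
    have hs : SmoothSectionOn F V s := by
      intro y hy
      have hyd : chartAt ℂ x₀ y ∈ locDom F E x₀ :=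
        ⟨(chartAt ℂ x₀).map_source hy.1, by
          rw [mem_preimage, (chartAt ℂ x₀).left_inv hy.1]; exact hy.2⟩
      have h1 := (contMDiffAt_section_iff_loc (s := s) hyd).2
        (contDiffAt_const.congr_of_eventuallyEq (hlev _ hyd))
      rw [(chartAt ℂ x₀).left_inv hy.1] at h1
      exact h1.contMDiffWithinAt
    have hτ : ∀ᶠ ξ in 𝓝 ζ, ∀ c, coord F E x₀ ((chartAt ℂ x₀).symm ξ)
        (h.chern s _ (coordVec x₀ c _)) = c • locConn h x₀ ξ u + conj c • (0 : F) := by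
      filter_upwards [(isOpen_locDom F E x₀).mem_nhds hζ] with ξ hξ c
      have hd : DifferentiableAt ℝ (loc F x₀ s) ξ :=
        (differentiableAt_const u).congr_of_eventuallyEq (hlev ξ hξ)
      unfold HermitianMetric.chern
      have e1 : dzb (loc F x₀ s) ξ = 0 := by
        rw [← dzb_const u ξ]; simp only [dzb, (hlev ξ hξ).fderiv_eq]
      have e2 : dz (loc F x₀ s) ξ = 0 := by
        rw [← dz_const u ξ]; simp only [dz, (hlev ξ hξ).fderiv_eq]
      rw [dbar_coordVec hξ hd, del_coordVec hξ h hd, e1, e2, hloc ξ hξ, ← map_add,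
        coord_frame F hξ.2]
      module
    -- `LocalHiggs.contDiffOn_connection` takes the structure under construction as input, so its
    -- argument is repeated.
    have hG : DifferentiableAt ℝ (fun ξ => locConn h x₀ ξ u) ζ := by
      have h1 : ContDiffOn ℝ ∞ (fun ξ => locConn h x₀ ξ u) (locDom F E x₀) := by
        refine contDiffOn_of_form (contDiffOn_locForm h x₀) (fun ζ hζ => locForm_pos h x₀ hζ)
          fun a => ?_
        have h2 : ContDiffOn ℝ ∞ (fderiv ℝ fun ξ => locForm h x₀ ξ u a) (locDom F E x₀) :=
          (contDiffOn_locForm h x₀ u a).fderiv_of_isOpen (isOpen_locDom F E x₀) (by simp)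
        have h3 : ContDiffOn ℝ ∞ (dz fun ξ => locForm h x₀ ξ u a) (locDom F E x₀) := by
          unfold dz
          exact ((h2.clm_apply contDiffOn_const).sub
            ((h2.clm_apply contDiffOn_const).const_smul Complex.I)).const_smul (1 / 2 : ℂ)
        exact h3.congr fun ζ hζ => locConn_spec h x₀ hζ u a
      exact (h1.contDiffAt ((isOpen_locDom F E x₀).mem_nhds hζ)).differentiableAt (by simp)
    have key := hh V hV s hs _ (hVζ ζ hζ) (coordVec x₀ 1 _) (coordVec x₀ Complex.I _)
    rw [ext1_chern_coordVec hζ h hτ hG (differentiableAt_const (0 : F))] at key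
    simp only [toFun_coordVec hζ, adj_coordVec hζ, coord_frame F hζ.2] at key
    have hsu : coord F E x₀ ((chartAt ℂ x₀).symm ζ) (s ((chartAt ℂ x₀).symm ζ)) = u := hloc ζ hζ
    rw [hsu] at key
    simp only [← map_sub, ← map_add] at key
    have key2 := congrArg (coord F E x₀ ((chartAt ℂ x₀).symm ζ)) key
    rw [coord_frame F hζ.2, map_zero, dz_const, map_zero] at key2
    simp only [map_smul] at key2
    -- The factor is `(dz ∧ dz̄)(1, i) = -2i`.
    have key3 : (-2 * Complex.I) • (locHiggs θ x₀ ζ (locAdj θ h x₀ ζ u)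
        - locAdj θ h x₀ ζ (locHiggs θ x₀ ζ u) - dzb (fun ξ => locConn h x₀ ξ u) ζ) = 0 := by
      rw [← key2]
      simp
      module
    rw [smul_eq_zero, sub_eq_zero] at key3
    exact (key3.resolve_left (by simp)).symm

/-- The coefficient of `dz` of a 1-form, in the trivialization and chart at `x₀`. -/
def locLeft (F : Type*) [NormedAddCommGroup F] [NormedSpace ℂ F]
    {E : X → Type*} [∀ x, AddCommGroup (E x)] [∀ x, Module ℂ (E x)]
    [TopologicalSpace (TotalSpace F E)] [∀ x, TopologicalSpace (E x)]
    [FiberBundle F E] [VectorBundle ℂ F E] (x₀ : X) (τ : ∀ x : X, T x →ₗ[ℝ] E x) (ζ : ℂ) : F :=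
  (1 / 2 : ℂ) • (loc F x₀ (fun y => τ y (coordVec x₀ 1 y)) ζ
    - Complex.I • loc F x₀ (fun y => τ y (coordVec x₀ Complex.I y)) ζ)

/-- The coefficient of `dz̄` of a 1-form, in the trivialization and chart at `x₀`. -/
def locRight (F : Type*) [NormedAddCommGroup F] [NormedSpace ℂ F]
    {E : X → Type*} [∀ x, AddCommGroup (E x)] [∀ x, Module ℂ (E x)]
    [TopologicalSpace (TotalSpace F E)] [∀ x, TopologicalSpace (E x)]
    [FiberBundle F E] [VectorBundle ℂ F E] (x₀ : X) (τ : ∀ x : X, T x →ₗ[ℝ] E x) (ζ : ℂ) : F :=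
  (1 / 2 : ℂ) • (loc F x₀ (fun y => τ y (coordVec x₀ 1 y)) ζ
    + Complex.I • loc F x₀ (fun y => τ y (coordVec x₀ Complex.I y)) ζ)

/-- In coordinates a covector is a real-linear map from `ℂ`, and it splits into its types. -/
theorem coord_form (τ : ∀ x : X, T x →ₗ[ℝ] E x) (x₀ : X) (ζ c : ℂ) :
    coord F E x₀ ((chartAt ℂ x₀).symm ζ) (τ _ (coordVec x₀ c _))
      = c • locLeft F x₀ τ ζ + conj c • locRight F x₀ τ ζ := by
  let L : ℂ →ₗ[ℝ] F := (coord F E x₀ ((chartAt ℂ x₀).symm ζ)).restrictScalars ℝ ∘ₗ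
    τ ((chartAt ℂ x₀).symm ζ) ∘ₗ
      (frame ℂ (fun x : X => TangentSpace 𝓘(ℂ, ℂ) x) x₀ _).restrictScalars ℝ
  have h10 := part10_realLinear L c
  have h01 := part01_realLinear L c
  have h := part10_add_part01 (⇑L) c
  rw [h10, h01] at h
  exact h.symm

theorem contDiffOn_loc_form {τ : ∀ x : X, T x →ₗ[ℝ] E x} (hτ : SmoothForm F τ) (x₀ : X) (c : ℂ) :
    ContDiffOn ℝ ∞ (loc F x₀ fun y => τ y (coordVec x₀ c y)) (locDom F E x₀) := by
  refine ((contDiffOn_comp_chart_symm x₀ (hτ x₀ c)).mono ?_).congr fun ζ hζ => ?_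
  · exact fun ζ hζ => ⟨hζ.1, (chartAt ℂ x₀).map_target hζ.1, hζ.2⟩
  · rw [loc, coord_apply F hζ.2]
    rfl

theorem contDiffOn_locLeft {τ : ∀ x : X, T x →ₗ[ℝ] E x} (hτ : SmoothForm F τ) (x₀ : X) :
    ContDiffOn ℝ ∞ (locLeft F x₀ τ) (locDom F E x₀) :=
  ((contDiffOn_loc_form hτ x₀ 1).sub
    ((contDiffOn_loc_form hτ x₀ Complex.I).const_smul Complex.I)).const_smul (1 / 2 : ℂ)

theorem contDiffOn_locRight {τ : ∀ x : X, T x →ₗ[ℝ] E x} (hτ : SmoothForm F τ) (x₀ : X) :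
    ContDiffOn ℝ ∞ (locRight F x₀ τ) (locDom F E x₀) :=
  ((contDiffOn_loc_form hτ x₀ 1).add
    ((contDiffOn_loc_form hτ x₀ Complex.I).const_smul Complex.I)).const_smul (1 / 2 : ℂ)

-- Evaluate the closedness equation on the fields with coefficients 1 and `i`, where the scalar
-- factor is `2i`.
include hζ in
theorem dzb_locLeft (θ : HiggsField F E) {τ : ∀ x : X, T x →ₗ[ℝ] E x} (hτ : SmoothForm F τ)
    (hc : ∀ (x : X) (v w : T x), ext1 (opD'' θ) (fun y => τ y) x v w = 0) :
    dzb (locLeft F x₀ τ) ζ = locHiggs θ x₀ ζ (locRight F x₀ τ ζ) := by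
  have hn := (isOpen_locDom F E x₀).mem_nhds hζ
  have h1 := ext1_opD''_coordVec hζ θ (τ := fun y => τ y) (α := locLeft F x₀ τ)
    (β := locRight F x₀ τ) (Filter.Eventually.of_forall fun ξ c => coord_form τ x₀ ξ c)
    (((contDiffOn_locLeft hτ x₀).contDiffAt hn).differentiableAt (by simp))
    (((contDiffOn_locRight hτ x₀).contDiffAt hn).differentiableAt (by simp)) 1 Complex.I
  rw [hc] at h1
  have h2 := congrArg (coord F E x₀ ((chartAt ℂ x₀).symm ζ)) h1
  rw [coord_frame F hζ.2, map_zero, eq_comm, smul_eq_zero] at h2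
  refine sub_eq_zero.1 (h2.resolve_left ?_)
  simp [← two_mul]

end LocalExterior

end HiggsSurface

namespace HiggsSurface

/-! ### Integrals of 2-forms in arbitrary oriented charts -/

section SurfaceIntegral

theorem det_eq_im (L : ℂ →L[ℝ] ℂ) : ContinuousLinearMap.det L = (conj (L 1) * L Complex.I).im := by
  rw [ContinuousLinearMap.det, ← LinearMap.det_toMatrix Complex.basisOneI, Matrix.det_fin_two]
  simp [LinearMap.toMatrix_apply]
  ring

variable {X : Type*} [TopologicalSpace X] [ChartedSpace ℂ X]

/-- `ψ` is, pointwise, an alternating real-bilinear form on the complex line `T x`. -/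
def IsTwoForm (ψ : ∀ x : X, T x → T x → ℂ) : Prop :=
  ∀ (x : X) (p q : ℂ) (v : T x), ψ x (p • v) (q • v) = ((conj p * q).im : ℂ) * ψ x v (Complex.I • v)

/-- The coefficient of a 2-form in a chart. -/
def chartCoeff (φ : OpenPartialHomeomorph X ℂ) (ψ : ∀ x : X, T x → T x → ℂ) (ξ : ℂ) : ℂ :=
  ψ (φ.symm ξ) (chartVec φ ξ 1) (chartVec φ ξ Complex.I)

/-- A real smooth chart that is positively oriented. -/
structure IsOrientedChart [IsManifold 𝓘(ℂ, ℂ) ω X] (φ : OpenPartialHomeomorph X ℂ) : Prop where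
  smooth : φ ∈ IsManifold.maximalAtlas 𝓘(ℝ, ℂ) ∞ X
  oriented : ∀ x ∈ φ.source,
    0 < ContinuousLinearMap.det (R := ℝ) (M := ℂ) (mfderiv 𝓘(ℝ, ℂ) 𝓘(ℝ, ℂ) φ x)

variable [IsManifold 𝓘(ℂ, ℂ) ω X]

theorem smul_chartVec_one (x₀ : X) {ζ : ℂ} (hζ : ζ ∈ (chartAt ℂ x₀).target) (c : ℂ) :
    chartVec (chartAt ℂ x₀) ζ c = c • chartVec (chartAt ℂ x₀) ζ 1 := by
  rw [← coordVec_eq_chartVec x₀ _ hζ, ← coordVec_eq_chartVec x₀ _ hζ, coordVec_eq_smul]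

theorem chartCoeff_chartAt (x₀ : X) (ψ : ∀ x : X, T x → T x → ℂ) {ζ : ℂ}
    (hζ : ζ ∈ (chartAt ℂ x₀).target) : chartCoeff (chartAt ℂ x₀) ψ ζ
      = ψ ((chartAt ℂ x₀).symm ζ) (coordVec x₀ 1 _) (coordVec x₀ Complex.I _) := by
  rw [chartCoeff, coordVec_eq_chartVec x₀ _ hζ, coordVec_eq_chartVec x₀ _ hζ]

/-- The coefficient of a 2-form changes by the Jacobian determinant, since an alternating form on
the plane is a multiple of the area. -/
theorem chartCoeff_change {φ : OpenPartialHomeomorph X ℂ}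
    (hφ : φ ∈ IsManifold.maximalAtlas 𝓘(ℝ, ℂ) ∞ X) {ψ : ∀ x : X, T x → T x → ℂ} (hψ : IsTwoForm ψ)
    {i y : X} (hy : y ∈ φ.source) (hi : y ∈ (chartAt ℂ i).source) :
    chartCoeff φ ψ (φ y) = ((fderiv ℝ (chartAt ℂ i ∘ φ.symm) (φ y)).det : ℂ)
      * chartCoeff (chartAt ℂ i) ψ (chartAt ℂ i y) := by
  have h := chartVec_eq hφ (chartAt_mem_realAtlas i) hy hi
  have hit := (chartAt ℂ i).map_source hi
  -- All tangent spaces are copies of `ℂ`; this moves `ψ` along an equality of base points while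
  -- comparing vectors as complex numbers.
  have key : ∀ (p : X) (hp : p = y) (q : X) (hq : q = y) (a b : T p) (a' b' : T q),
      (a : ℂ) = (a' : ℂ) → (b : ℂ) = (b' : ℂ) → ψ p a b = ψ q a' b' := by
    rintro p rfl q rfl a b a' b' rfl rfl
    rfl
  have h1 : chartCoeff φ ψ (φ y) = ψ ((chartAt ℂ i).symm (chartAt ℂ i y))
      (chartVec (chartAt ℂ i) (chartAt ℂ i y) (fderiv ℝ (chartAt ℂ i ∘ φ.symm) (φ y) 1))
      (chartVec (chartAt ℂ i) (chartAt ℂ i y) (fderiv ℝ (chartAt ℂ i ∘ φ.symm) (φ y) Complex.I)) :=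
    key _ (φ.left_inv hy) _ ((chartAt ℂ i).left_inv hi) _ _ _ _ (h 1) (h Complex.I)
  rw [h1, smul_chartVec_one i hit, smul_chartVec_one i hit (fderiv ℝ _ _ Complex.I), hψ,
    det_eq_im, chartCoeff, smul_chartVec_one i hit Complex.I]

theorem det_comp_plane (A B : ℂ →L[ℝ] ℂ) : (A.comp B).det = A.det * B.det :=
  LinearMap.det_comp _ _

/-- By the Cauchy–Riemann equations the determinant is the squared modulus of the derivative, and
the chain rule with the inverse transition shows that it is not zero. -/
theorem fderiv_chart_transition_det_pos {i y : X} (hi : y ∈ (chartAt ℂ i).source) :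
    0 < (fderiv ℝ (chartAt ℂ i ∘ (chartAt ℂ y).symm) (chartAt ℂ y y)).det := by
  have hya := mem_chart_source ℂ y
  set ζ := chartAt ℂ y y with hζ
  have hζt : ζ ∈ (chartAt ℂ y).target := (chartAt ℂ y).map_source hya
  have hyζ : (chartAt ℂ y).symm ζ = y := (chartAt ℂ y).left_inv hya
  have hdC : DifferentiableAt ℂ (chartAt ℂ i ∘ (chartAt ℂ y).symm) ζ := by
    have h1 : MDifferentiableAt 𝓘(ℂ, ℂ) 𝓘(ℂ, ℂ) (chartAt ℂ i ∘ (chartAt ℂ y).symm) ζ := by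
      refine MDifferentiableAt.comp (I' := 𝓘(ℂ, ℂ)) ζ ?_ ?_
      · exact mdifferentiableAt_atlas (chart_mem_atlas ℂ _) (by rwa [hyζ])
      · exact mdifferentiableAt_atlas_symm (chart_mem_atlas ℂ _) hζt
    exact mdifferentiableAt_iff_differentiableAt.1 h1
  have hinv := (differentiableAt_chart_comp (chartAt_mem_realAtlas i) (chartAt_mem_realAtlas y)
    (f := chartAt ℂ y) hi hya (differentiableAt_transition (chartAt_mem_realAtlas i)
      (chartAt_mem_realAtlas y) ((chartAt ℂ i).map_source hi)
      (by rwa [(chartAt ℂ i).left_inv hi]))).2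
  have hid : fderiv ℝ (chartAt ℂ y ∘ (chartAt ℂ y).symm) ζ = ContinuousLinearMap.id ℝ ℂ := by
    have : (chartAt ℂ y ∘ (chartAt ℂ y).symm) =ᶠ[𝓝 ζ] id := by
      filter_upwards [(chartAt ℂ y).open_target.mem_nhds hζt] with ξ hξ
      simp [(chartAt ℂ y).right_inv hξ]
    rw [this.fderiv_eq, fderiv_id]
  rw [← hζ, hid] at hinv
  have hne := congrArg ContinuousLinearMap.det hinv
  rw [det_comp_plane] at hne
  have hne' : (fderiv ℝ (chartAt ℂ i ∘ (chartAt ℂ y).symm) ζ).det ≠ 0 := by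
    intro h
    rw [h, mul_zero] at hne
    have h1 : (ContinuousLinearMap.id ℝ ℂ).det = 1 := LinearMap.det_id
    rw [h1] at hne
    exact one_ne_zero hne
  refine lt_of_le_of_ne ?_ hne'.symm
  rw [det_eq_im, hdC.fderiv_restrictScalars ℝ]
  set L := fderiv ℂ (chartAt ℂ i ∘ (chartAt ℂ y).symm) ζ with hL
  have hLI : L Complex.I = Complex.I * L 1 := by
    rw [← smul_eq_mul, ← map_smul, smul_eq_mul, mul_one]
  rw [ContinuousLinearMap.coe_restrictScalars', hLI]
  simp only [Complex.mul_im, Complex.conj_re, Complex.conj_im, Complex.mul_re, Complex.I_re,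
    Complex.I_im]
  nlinarith [sq_nonneg (L 1).re, sq_nonneg (L 1).im]

theorem isOrientedChart_chartAt (x₀ : X) : IsOrientedChart (chartAt ℂ x₀) where
  smooth := chartAt_mem_realAtlas x₀
  oriented y hy := by
    rw [mfderiv_chart_eq (chartAt_mem_realAtlas x₀) hy]
    exact fderiv_chart_transition_det_pos hy

/-- Factor the transition between two atlas charts through `φ`: the composite and one factor have
positive determinant, hence so has the other factor. -/
theorem fderiv_transition_det_pos {φ : OpenPartialHomeomorph X ℂ} (hφ : IsOrientedChart φ) {i y : X}
    (hy : y ∈ φ.source) (hi : y ∈ (chartAt ℂ i).source) :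
    0 < (fderiv ℝ (chartAt ℂ i ∘ φ.symm) (φ y)).det := by
  have h0 := hφ.oriented y hy
  rw [mfderiv_chart_eq hφ.smooth hy] at h0
  have hya := mem_chart_source ℂ y
  have hd := differentiableAt_transition (chartAt_mem_realAtlas y) hφ.smooth
    ((chartAt ℂ y).map_source hya) (by rwa [(chartAt ℂ y).left_inv hya])
  have h1 := (differentiableAt_chart_comp hφ.smooth (chartAt_mem_realAtlas y) (f := chartAt ℂ i) hy
    hya (differentiableAt_transition hφ.smooth (chartAt_mem_realAtlas i) (φ.map_source hy)
      (by rwa [φ.left_inv hy]))).2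
  have h2 := fderiv_chart_transition_det_pos hi
  rw [h1, det_comp_plane] at h2
  exact pos_of_mul_pos_left h2 h0.le

variable [T2Space X] [SigmaCompactSpace X]

theorem chartPartition_subordinate (i : X) : tsupport (chartPartition X i) ⊆ (chartAt ℂ i).source :=
  (SmoothPartitionOfUnity.exists_isSubordinate_chartAt_source 𝓘(ℝ, ℂ) X).choose_spec i

theorem chartPartition_eq_zero {i x : X} (hx : x ∉ (chartAt ℂ i).source) :
    chartPartition X i x = 0 :=
  image_eq_zero_of_notMem_tsupport fun h => hx (chartPartition_subordinate i h)

variable {φ : OpenPartialHomeomorph X ℂ} {A K : Set X} {ψ : ∀ x : X, T x → T x → ℂ}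

/-- Change of variables for one chart of the partition. Both integrals live on the overlap of the
two charts: off `K` the form vanishes, and off the chart at `i` the partition function does. -/
theorem surfaceIntegral_term (hφ : IsOrientedChart φ) (hψ : IsTwoForm ψ) (hA : IsOpen A)
    (hK : K ⊆ φ.source) (h0 : ∀ x ∈ A, x ∉ K → ∀ v w, ψ x v w = 0)
    (hint : IntegrableOn (chartCoeff φ ψ) (φ.target ∩ φ.symm ⁻¹' A)) (i : X) :
    IntegrableOn (fun z => (chartPartition X i ((chartAt ℂ i).symm z) : ℂ) *
      ψ ((chartAt ℂ i).symm z) (coordVec i 1 ((chartAt ℂ i).symm z))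
        (coordVec i Complex.I ((chartAt ℂ i).symm z)))
      ((chartAt ℂ i).target ∩ (chartAt ℂ i).symm ⁻¹' A) ∧
    IntegrableOn (fun ξ => (chartPartition X i (φ.symm ξ) : ℂ) * chartCoeff φ ψ ξ)
      (φ.target ∩ φ.symm ⁻¹' A) ∧
    ∫ z in (chartAt ℂ i).target ∩ (chartAt ℂ i).symm ⁻¹' A,
      (chartPartition X i ((chartAt ℂ i).symm z) : ℂ) *
        ψ ((chartAt ℂ i).symm z) (coordVec i 1 ((chartAt ℂ i).symm z))
        (coordVec i Complex.I ((chartAt ℂ i).symm z))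
      = ∫ ξ in φ.target ∩ φ.symm ⁻¹' A, (chartPartition X i (φ.symm ξ) : ℂ) * chartCoeff φ ψ ξ := by
  set z := chartAt ℂ i with hz
  set f : ℂ → ℂ := z ∘ φ.symm with hf
  set S : Set ℂ := φ.target ∩ φ.symm ⁻¹' (A ∩ z.source) with hS
  set D : Set ℂ := z.target ∩ z.symm ⁻¹' A with hD
  set g : ℂ → ℂ := fun ζ => (chartPartition X i (z.symm ζ) : ℂ) *
    ψ (z.symm ζ) (coordVec i 1 (z.symm ζ)) (coordVec i Complex.I (z.symm ζ)) with hg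
  have hSo : IsOpen S := φ.symm.isOpen_inter_preimage (hA.inter z.open_source)
  have hDo : IsOpen D := z.symm.isOpen_inter_preimage hA
  have hTo : IsOpen (φ.target ∩ φ.symm ⁻¹' A) := φ.symm.isOpen_inter_preimage hA
  have hfd : ∀ ξ ∈ S, HasFDerivWithinAt f (fderiv ℝ f ξ) S ξ := fun ξ hξ =>
    (differentiableAt_transition hφ.smooth (chartAt_mem_realAtlas i) hξ.1
      hξ.2.2).hasFDerivAt.hasFDerivWithinAt
  have hinj : InjOn f S := by
    intro a ha b hb hab
    exact φ.symm.injOn ha.1 hb.1 (z.injOn ha.2.2 hb.2.2 hab)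
  have himg : f '' S ⊆ D := by
    rintro _ ⟨ξ, hξ, rfl⟩
    refine ⟨z.map_source hξ.2.2, ?_⟩
    simpa [f, z.left_inv hξ.2.2] using hξ.2.1
  have hzero : ∀ ζ ∈ D \ f '' S, g ζ = 0 := by
    intro ζ hζ
    have hK' : z.symm ζ ∉ K := by
      intro hk
      refine hζ.2 ⟨φ (z.symm ζ), ⟨φ.map_source (hK hk), ?_⟩, ?_⟩
      · rw [mem_preimage, φ.left_inv (hK hk)]
        exact ⟨hζ.1.2, z.map_target hζ.1.1⟩
      · simp [f, φ.left_inv (hK hk), z.right_inv hζ.1.1]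
    simp only [hg, h0 _ hζ.1.2 hK', mul_zero]
  have hgf : ∀ ξ ∈ S, |(fderiv ℝ f ξ).det| • g (f ξ)
      = (chartPartition X i (φ.symm ξ) : ℂ) * chartCoeff φ ψ ξ := by
    intro ξ hξ
    set y := φ.symm ξ with hy
    have hys : y ∈ φ.source := φ.map_target hξ.1
    have hξy : φ y = ξ := φ.right_inv hξ.1
    have h1 := chartCoeff_change hφ.smooth hψ hys hξ.2.2
    have h2 := fderiv_transition_det_pos hφ hys hξ.2.2
    rw [hξy] at h1 h2
    have h3 : g (f ξ) = (chartPartition X i y : ℂ) * chartCoeff z ψ (z y) := by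
      simp only [hg]
      rw [chartCoeff_chartAt i ψ (z.map_source hξ.2.2)]
      have h4 : z.symm (f ξ) = y := z.left_inv hξ.2.2
      have h5 : (chartAt ℂ i).symm (z (φ.symm ξ)) = y := h4
      rw [h4, h5]
    rw [abs_of_pos h2, h3, h1, Complex.real_smul]
    ring
  have hρint : IntegrableOn (fun ξ => (chartPartition X i (φ.symm ξ) : ℂ) * chartCoeff φ ψ ξ)
      (φ.target ∩ φ.symm ⁻¹' A) := by
    refine Integrable.bdd_mul (c := 1) hint ?_ ?_
    · refine ContinuousOn.aestronglyMeasurable ?_ hTo.measurableSet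
      refine Complex.continuous_ofReal.comp_continuousOn ?_
      exact (chartPartition X i).contMDiff.continuous.comp_continuousOn
        (φ.continuousOn_symm.mono inter_subset_left)
    · refine Filter.Eventually.of_forall fun ξ => ?_
      rw [Complex.norm_real, Real.norm_of_nonneg ((chartPartition X).nonneg i _)]
      exact (chartPartition X).le_one i _
  have hST : S ⊆ φ.target ∩ φ.symm ⁻¹' A := fun ξ hξ => ⟨hξ.1, hξ.2.1⟩
  have hTS : ∀ ξ ∈ (φ.target ∩ φ.symm ⁻¹' A) \ S,
      (chartPartition X i (φ.symm ξ) : ℂ) * chartCoeff φ ψ ξ = 0 := by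
    intro ξ hξ
    have : φ.symm ξ ∉ z.source := fun h => hξ.2 ⟨hξ.1.1, hξ.1.2, h⟩
    rw [chartPartition_eq_zero this]
    simp
  refine ⟨?_, hρint, ?_⟩
  · refine IntegrableOn.of_forall_sdiff_eq_zero (s := f '' S) ?_ hDo.measurableSet hzero
    rw [integrableOn_image_iff_integrableOn_abs_det_fderiv_smul volume hSo.measurableSet hfd hinj]
    exact (hρint.mono_set hST).congr_fun (fun ξ hξ => (hgf ξ hξ).symm) hSo.measurableSet
  · rw [setIntegral_eq_of_subset_of_forall_sdiff_eq_zero hDo.measurableSet himg hzero,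
      integral_image_eq_integral_abs_det_fderiv_smul volume hSo.measurableSet hfd hinj,
      setIntegral_eq_of_subset_of_forall_sdiff_eq_zero hTo.measurableSet hST hTS]
    exact setIntegral_congr_fun hSo.measurableSet hgf

/-- Only finitely many partition functions meet the compact set `K`, and on `K` these sum to 1. -/
theorem surfaceIntegral_chart (hφ : IsOrientedChart φ) (hψ : IsTwoForm ψ) (hA : IsOpen A)
    (hK : K ⊆ φ.source) (hKc : IsCompact K) (h0 : ∀ x ∈ A, x ∉ K → ∀ v w, ψ x v w = 0)
    (hint : IntegrableOn (chartCoeff φ ψ) (φ.target ∩ φ.symm ⁻¹' A)) :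
    {i | ∫ z in (chartAt ℂ i).target ∩ (chartAt ℂ i).symm ⁻¹' A,
      (chartPartition X i ((chartAt ℂ i).symm z) : ℂ) *
        ψ ((chartAt ℂ i).symm z) (coordVec i 1 ((chartAt ℂ i).symm z))
        (coordVec i Complex.I ((chartAt ℂ i).symm z)) ≠ 0}.Finite ∧
    surfaceIntegral A ψ = ∫ ξ in φ.target ∩ φ.symm ⁻¹' A, chartCoeff φ ψ ξ := by
  have hfin := (chartPartition X).locallyFinite.finite_nonempty_inter_compact hKc
  set s := hfin.toFinset with hs
  have hTo : IsOpen (φ.target ∩ φ.symm ⁻¹' A) := φ.symm.isOpen_inter_preimage hA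
  have hterm := surfaceIntegral_term hφ hψ hA hK h0 hint
  have hcoeff : ∀ ξ ∈ φ.target ∩ φ.symm ⁻¹' A, φ.symm ξ ∉ K → chartCoeff φ ψ ξ = 0 :=
    fun ξ hξ hk => h0 _ hξ.2 hk _ _
  have hnot : ∀ i ∉ s, ∫ z in (chartAt ℂ i).target ∩ (chartAt ℂ i).symm ⁻¹' A,
      (chartPartition X i ((chartAt ℂ i).symm z) : ℂ) *
        ψ ((chartAt ℂ i).symm z) (coordVec i 1 ((chartAt ℂ i).symm z))
        (coordVec i Complex.I ((chartAt ℂ i).symm z)) = 0 := by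
    intro i hi
    rw [(hterm i).2.2]
    refine setIntegral_eq_zero_of_forall_eq_zero fun ξ hξ => ?_
    by_cases hk : φ.symm ξ ∈ K
    · have : chartPartition X i (φ.symm ξ) = 0 := by
        by_contra hne
        exact hi (hfin.mem_toFinset.2 ⟨φ.symm ξ, hne, hk⟩)
      simp [this]
    · simp [hcoeff ξ hξ hk]
  refine ⟨s.finite_toSet.subset fun i hi => by_contra fun h => hi (hnot i h), ?_⟩
  unfold surfaceIntegral
  rw [finsum_eq_sum_of_support_subset _ (s := s)
    fun i hi => by_contra fun h => hi (hnot i h)]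
  rw [Finset.sum_congr rfl fun i _ => (hterm i).2.2, ← integral_finsetSum _
    fun i _ => (hterm i).2.1]
  refine setIntegral_congr_fun hTo.measurableSet fun ξ hξ => ?_
  rw [← Finset.sum_mul]
  by_cases hk : φ.symm ξ ∈ K
  · have h1 : ∑ i ∈ s, (chartPartition X i (φ.symm ξ) : ℂ) = 1 := by
      have h2 := (chartPartition X).sum_eq_one (mem_univ (φ.symm ξ))
      rw [finsum_eq_sum_of_support_subset _ (s := s)
        fun i hi => hfin.mem_toFinset.2 ⟨φ.symm ξ, hi, hk⟩] at h2
      exact_mod_cast congrArg (fun r : ℝ => (r : ℂ)) h2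
    rw [h1, one_mul]
  · rw [hcoeff ξ hξ hk, mul_zero]

/-- Additivity of the integral, for 2-forms with compact support in oriented charts. -/
theorem surfaceIntegral_eq_sum {ι : Type*} (J : Finset ι) (Φ : ι → OpenPartialHomeomorph X ℂ)
    (Κ : ι → Set X) (Ψ : ι → ∀ x : X, T x → T x → ℂ) (hΦ : ∀ j ∈ J, IsOrientedChart (Φ j))
    (hΨ : ∀ j ∈ J, IsTwoForm (Ψ j)) (hA : IsOpen A) (hΚ : ∀ j ∈ J, Κ j ⊆ (Φ j).source)
    (hΚc : ∀ j ∈ J, IsCompact (Κ j)) (h0 : ∀ j ∈ J, ∀ x ∈ A, x ∉ Κ j → ∀ v w, Ψ j x v w = 0)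
    (hint : ∀ j ∈ J, IntegrableOn (chartCoeff (Φ j) (Ψ j)) ((Φ j).target ∩ (Φ j).symm ⁻¹' A))
    (hsum : ∀ x ∈ A, ∀ v w, ψ x v w = ∑ j ∈ J, Ψ j x v w) :
    surfaceIntegral A ψ
      = ∑ j ∈ J, ∫ ξ in (Φ j).target ∩ (Φ j).symm ⁻¹' A, chartCoeff (Φ j) (Ψ j) ξ := by
  have h1 : ∀ j ∈ J, surfaceIntegral A (Ψ j)
      = ∫ ξ in (Φ j).target ∩ (Φ j).symm ⁻¹' A, chartCoeff (Φ j) (Ψ j) ξ := fun j hj =>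
    (surfaceIntegral_chart (hΦ j hj) (hΨ j hj) hA (hΚ j hj) (hΚc j hj) (h0 j hj) (hint j hj)).2
  rw [← Finset.sum_congr rfl h1]
  unfold surfaceIntegral
  -- Exchanging the sums is legitimate because each form meets only finitely many charts of the
  -- partition, by the first half of `surfaceIntegral_chart`.
  rw [← finsum_sum_comm J _ fun j hj => (surfaceIntegral_chart (hΦ j hj) (hΨ j hj) hA (hΚ j hj)
    (hΚc j hj) (h0 j hj) (hint j hj)).1]
  refine finsum_congr fun i => ?_
  rw [← integral_finsetSum _ fun j hj => (surfaceIntegral_term (hΦ j hj) (hΨ j hj) hA (hΚ j hj)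
    (h0 j hj) (hint j hj) i).1]
  refine setIntegral_congr_fun ((chartAt ℂ i).symm.isOpen_inter_preimage hA).measurableSet
    fun ζ hζ => ?_
  rw [hsum _ hζ.2, Finset.mul_sum]

end SurfaceIntegral

end HiggsSurface

namespace HiggsSurface

/-! ### The local form of coclosedness -/

section Coclosed

variable {F : Type*} [NormedAddCommGroup F] [NormedSpace ℂ F] [FiniteDimensional ℂ F] {Ω : Set ℂ}

theorem integrable_of_continuousOn_of_support {W : Type*} [NormedAddCommGroup W] [NormedSpace ℝ W]
    {f : ℂ → W} (hf : ContinuousOn f Ω) {C : Set ℂ} (hC : IsCompact C) (hCΩ : C ⊆ Ω)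
    (h0 : ∀ ζ ∉ C, f ζ = 0) : Integrable f := by
  rw [← integrableOn_iff_integrable_of_support_subset (s := C)
    fun ζ hζ => by_contra fun h => hζ (h0 ζ h)]
  exact (hf.mono hCΩ).integrableOn_compact hC

namespace LocalHiggs

variable {H : ℂ → F →ₗ[ℂ] F →ₗ⋆[ℂ] ℂ} {G Θ S : ℂ → F →ₗ[ℂ] F} (M : LocalHiggs Ω H G Θ S)
include M

theorem contDiffOn_connection_apply {β : ℂ → F} (hβ : ContDiffOn ℝ ∞ β Ω) :
    ContDiffOn ℝ ∞ (fun ζ => G ζ (β ζ)) Ω := by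
  have h : ContDiffOn ℝ ∞ (fun ζ => LinearMap.toContinuousLinearMap ((G ζ).restrictScalars ℝ)) Ω :=
    contDiffOn_clm_apply.2 fun u => M.contDiffOn_connection u
  exact h.clm_apply hβ

theorem contDiffOn_adjoint_apply {β : ℂ → F} (hβ : ContDiffOn ℝ ∞ β Ω) :
    ContDiffOn ℝ ∞ (fun ζ => S ζ (β ζ)) Ω := by
  have h : ContDiffOn ℝ ∞ (fun ζ => LinearMap.toContinuousLinearMap ((S ζ).restrictScalars ℝ)) Ω :=
    contDiffOn_clm_apply.2 fun u => M.contDiffOn_adjoint u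
  exact h.clm_apply hβ

/-- Integrating by parts moves the derivative from `ρ` to `H(u, β)`. The pairing of `u` with `Sα -
(∂β/∂z + Gβ)` is then orthogonal to all test functions, hence zero, and positivity of `H` concludes.
-/
theorem coclosed_of_integral {α β : ℂ → F} (hα : ContDiffOn ℝ ∞ α Ω) (hβ : ContDiffOn ℝ ∞ β Ω)
    (h : ∀ ρ : ℂ → ℝ, ContDiff ℝ ∞ ρ → HasCompactSupport ρ → tsupport ρ ⊆ Ω → ∀ u : F,
      ∫ ζ, ((ρ ζ : ℂ) * H ζ (Θ ζ u) (α ζ) + dzb (fun ξ => (ρ ξ : ℂ)) ζ * H ζ u (β ζ)) = 0)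
    {ζ : ℂ} (hζ : ζ ∈ Ω) : dz β ζ + G ζ (β ζ) = S ζ (α ζ) := by
  have hdβ : ContDiffOn ℝ ∞ (dz β) Ω := by
    have h2 : ContDiffOn ℝ ∞ (fderiv ℝ β) Ω := hβ.fderiv_of_isOpen M.isOpen (by simp)
    unfold dz
    exact ((h2.clm_apply contDiffOn_const).sub
      ((h2.clm_apply contDiffOn_const).const_smul Complex.I)).const_smul (1 / 2 : ℂ)
  have hq : ContDiffOn ℝ ∞ (fun ζ => S ζ (α ζ) - (dz β ζ + G ζ (β ζ))) Ω :=
    (M.contDiffOn_adjoint_apply hα).sub (hdβ.add (M.contDiffOn_connection_apply hβ))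
  suffices hu : ∀ u : F, H ζ u (S ζ (α ζ) - (dz β ζ + G ζ (β ζ))) = 0 by
    by_contra hne
    have h1 := M.pos ζ hζ _ (sub_ne_zero.2 (Ne.symm hne))
    rw [hu] at h1
    exact lt_irrefl _ h1
  intro u
  set q : ℂ → ℂ := fun ζ => H ζ u (S ζ (α ζ) - (dz β ζ + G ζ (β ζ))) with hqdef
  have hqc : ContinuousOn q Ω := (contDiffOn_form M.smooth contDiffOn_const hq).continuousOn
  have hae : ∀ᵐ x, x ∈ Ω → q x = 0 := by
    refine M.isOpen.ae_eq_zero_of_integral_contDiff_smul_eq_zero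
      (hqc.locallyIntegrableOn M.isOpen.measurableSet) fun ρ hρ hρc hρΩ => ?_
    have h0 := h ρ hρ hρc hρΩ u
    set g : ℂ → ℂ := fun ζ => H ζ u (β ζ) with hg
    set r : ℂ → ℂ := fun ζ => (ρ ζ : ℂ) with hr
    have hrs : ContDiff ℝ ∞ r := Complex.ofRealCLM.contDiff.comp hρ
    have hrt : tsupport r ⊆ tsupport ρ := by
      refine closure_mono fun x hx => ?_
      simpa [r] using hx
    have hgs : ContDiffOn ℝ ∞ g Ω := contDiffOn_form M.smooth contDiffOn_const hβ
    have hgd : ∀ x ∈ Ω, DifferentiableAt ℝ g x := fun x hx =>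
      (hgs.contDiffAt (M.isOpen.mem_nhds hx)).differentiableAt (by simp)
    have hg' : ContDiffOn ℝ ∞ (fderiv ℝ g) Ω := hgs.fderiv_of_isOpen M.isOpen (by simp)
    have hr' : Continuous (fderiv ℝ r) := hrs.continuous_fderiv (by simp)
    have hr0 : ∀ x ∉ tsupport ρ, r x = 0 := fun x hx => by
      simp [r, image_eq_zero_of_notMem_tsupport hx]
    have hr0' : ∀ x ∉ tsupport ρ, fderiv ℝ r x = 0 := fun x hx =>
      image_eq_zero_of_notMem_tsupport fun h => hx (hrt (tsupport_fderiv_subset ℝ h))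
    have i1 : ∀ v, Integrable fun x => fderiv ℝ r x v • g x := fun v =>
      integrable_of_continuousOn_of_support (Ω := Ω)
        (((hr'.clm_apply continuous_const).continuousOn).smul hgs.continuousOn) hρc hρΩ
        fun x hx => by simp [hr0' x hx]
    have i2 : ∀ v, Integrable fun x => r x • fderiv ℝ g x v := fun v =>
      integrable_of_continuousOn_of_support (Ω := Ω)
        (hrs.continuous.continuousOn.smul (hg'.continuousOn.clm_apply continuousOn_const)) hρc hρΩ
        fun x hx => by simp [hr0 x hx]
    have i3 : Integrable fun x => r x • g x :=
      integrable_of_continuousOn_of_support (Ω := Ω)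
        (hrs.continuous.continuousOn.smul hgs.continuousOn) hρc hρΩ
        fun x hx => by simp [hr0 x hx]
    have parts : ∀ v, ∫ x, r x • fderiv ℝ g x v = -∫ x, fderiv ℝ r x v • g x := fun v =>
      integral_smul_fderiv_eq_neg_fderiv_smul_of_integrable (𝕜 := ℂ) (i1 v) (i2 v) i3
        (fun x _ => (hrs.differentiable (by simp)).differentiableAt)
        (fun x hx => hgd x (hρΩ (hrt hx)))
    have e1 : ∫ x, r x * dzb g x = -∫ x, dzb r x * g x := by
      have l : ∀ x, r x * dzb g x = (1 / 2 : ℂ) * (r x • fderiv ℝ g x 1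
          + Complex.I * (r x • fderiv ℝ g x Complex.I)) := fun x => by
        simp only [dzb, smul_eq_mul]; ring
      have l' : ∀ x, dzb r x * g x = (1 / 2 : ℂ) * (fderiv ℝ r x 1 • g x
          + Complex.I * (fderiv ℝ r x Complex.I • g x)) := fun x => by
        simp only [dzb, smul_eq_mul]; ring
      simp only [l, l', integral_const_mul]
      rw [integral_add (i2 1) ((i2 Complex.I).const_mul _),
        integral_add (i1 1) ((i1 Complex.I).const_mul _), integral_const_mul, integral_const_mul,
        parts, parts]
      ring
    have i4 : Integrable fun x => r x * H x (Θ x u) (α x) :=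
      integrable_of_continuousOn_of_support (Ω := Ω) (hrs.continuous.continuousOn.mul
        (contDiffOn_form M.smooth (M.contDiffOn_higgs u) hα).continuousOn) hρc hρΩ
        fun x hx => by simp [hr0 x hx]
    have i5 : Integrable fun x => dzb r x * g x := by
      refine (((i1 1).add ((i1 Complex.I).const_mul Complex.I)).const_mul (1 / 2 : ℂ)).congr
        (Filter.Eventually.of_forall fun x => ?_)
      simp only [dzb, smul_eq_mul, Pi.add_apply]; ring
    have i6 : Integrable fun x => r x * dzb g x := by
      refine (((i2 1).add ((i2 Complex.I).const_mul Complex.I)).const_mul (1 / 2 : ℂ)).congr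
        (Filter.Eventually.of_forall fun x => ?_)
      simp only [dzb, smul_eq_mul, Pi.add_apply]; ring
    rw [integral_add i4 i5, ← sub_neg_eq_add, ← e1, ← integral_sub i4 i6] at h0
    rw [← h0]
    refine integral_congr_ae (Filter.Eventually.of_forall fun x => ?_)
    simp only [hqdef, Complex.real_smul]
    by_cases hx : x ∈ Ω
    -- As `u` is constant, `∂/∂z̄` of `H(u, β)` is `H(u, ∂β/∂z + Gβ)`; the other term is `H(Θu, α) =
    -- H(u, Sα)`.
    · have hd := M.dzb_form hx (differentiableAt_const u)
        ((hβ.contDiffAt (M.isOpen.mem_nhds hx)).differentiableAt (by simp))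
      rw [dzb_const, map_zero, LinearMap.zero_apply, zero_add] at hd
      rw [hg, hd, map_sub, M.adjoint' hx]
      ring
    · have : r x = 0 := hr0 x fun h => hx (hρΩ h)
      simp only [hr] at this
      simp [hr, this]
  -- Continuity upgrades vanishing almost everywhere to vanishing at every point of `Ω`.
  have := Measure.eqOn_open_of_ae_eq (μ := volume) (U := Ω) (f := q) (g := fun _ => 0)
    ((ae_restrict_iff' M.isOpen.measurableSet).2 hae) M.isOpen hqc continuousOn_const
  exact this hζ

end LocalHiggs

end Coclosed

end HiggsSurface

namespace HiggsSurface

/-! ### Harmonic 1-forms as solutions of a first order system in the plane -/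

section HarmonicForms

variable {X : Type*} [TopologicalSpace X] [ChartedSpace ℂ X] [IsManifold 𝓘(ℂ, ℂ) ω X]
  {F : Type*} [NormedAddCommGroup F] [NormedSpace ℂ F] [FiniteDimensional ℂ F]
  {E : X → Type*} [∀ x, AddCommGroup (E x)] [∀ x, Module ℂ (E x)]
  [TopologicalSpace (TotalSpace F E)] [∀ x, TopologicalSpace (E x)]
  [FiberBundle F E] [VectorBundle ℂ F E] [ContMDiffVectorBundle ω F E 𝓘(ℂ, ℂ)]

/-- Conformality forces `v` and `i v` to be orthogonal and of equal length. -/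
theorem ConformalMetric.inner_smul_smul (g : ConformalMetric X) (x : X) (p q : ℂ) (v : T x) :
    g.inner x (p • v) (q • v) = (conj p * q).re * g.inner x v v := by
  have h0 : g.inner x v (Complex.I • v) = 0 := by
    have h1 := g.conformal x v (Complex.I • v)
    rw [smul_smul, Complex.I_mul_I, neg_one_smul, map_neg, g.symm] at h1
    linarith
  have hs : ∀ c : ℂ, c • v = c.re • v + c.im • (Complex.I • v) := by
    intro c
    conv_lhs => rw [← Complex.re_add_im c, add_smul, mul_smul]
    rfl
  rw [hs p, hs q]
  simp only [map_add, LinearMap.add_apply, map_smul, LinearMap.smul_apply, smul_eq_mul, h0,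
    g.conformal x v v, g.symm x (Complex.I • v) v]
  simp
  ring

theorem isTwoForm_mul_vol (g : ConformalMetric X) (f : X → ℂ) :
    IsTwoForm fun x v w => f x * (g.vol x v w : ℂ) := by
  intro x p q v
  have hI : (Complex.I • v : T x) = Complex.I • ((1 : ℂ) • v) := by rw [one_smul]
  simp only [ConformalMetric.vol, smul_smul, g.inner_smul_smul]
  simp
  ring

theorem exists_eq_smul_coordVec {x₀ : X} {ζ : ℂ} (hζ : ζ ∈ (chartAt ℂ x₀).target)
    (v : T ((chartAt ℂ x₀).symm ζ)) : ∃ p : ℂ, v = coordVec x₀ p _ := by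
  obtain ⟨κ, -, -, hev⟩ := exists_coordVec_change hζ
  exact ⟨_, (coordVec_self _ v).symm.trans (hev.self_of_nhds v)⟩

theorem coordVec_one_ne_zero {x₀ : X} {ζ : ℂ} (hζ : ζ ∈ (chartAt ℂ x₀).target) :
    coordVec x₀ 1 ((chartAt ℂ x₀).symm ζ) ≠ 0 := by
  have hb : (chartAt ℂ x₀).symm ζ ∈ (trivializationAt ℂ (fun x : X => TangentSpace 𝓘(ℂ, ℂ) x)
    x₀).baseSet := (chartAt ℂ x₀).map_target hζ
  intro h
  rw [coordVec_eq_frame] at h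
  have h1 := coord_frame ℂ hb 1
  rw [h, map_zero] at h1
  exact zero_ne_one h1

/-- The pointwise product of two 1-forms times the area form, in local coordinates. -/
theorem formInner_mul_vol (g : ConformalMetric X) (h : HermitianMetric F E)
    {a b : ∀ x : X, T x → E x} {x₀ : X} {ζ : ℂ} (hζ : ζ ∈ locDom F E x₀) {P Q α β : F}
    (ha : ∀ c, coord F E x₀ ((chartAt ℂ x₀).symm ζ) (a _ (coordVec x₀ c _)) = c • P + conj c • Q)
    (hb : ∀ c, coord F E x₀ ((chartAt ℂ x₀).symm ζ) (b _ (coordVec x₀ c _)) = c • α + conj c • β) :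
    formInner g h a b ((chartAt ℂ x₀).symm ζ)
      * (g.vol _ (coordVec x₀ 1 ((chartAt ℂ x₀).symm ζ)) (coordVec x₀ Complex.I _) : ℂ)
      = 2 * (locForm h x₀ ζ P α + locForm h x₀ ζ Q β) := by
  set y := (chartAt ℂ x₀).symm ζ with hy
  -- `formInner` uses the coordinate vector of the chart at `y` itself. It is `p` times the one of
  -- the chart at `x₀`, up to identification, and `|p|²` cancels between numerator and denominator,
  -- as does the metric against the area form.
  obtain ⟨p, hp⟩ := exists_eq_smul_coordVec hζ.1 (coordVec y 1 y)
  have hV := coordVec_one_ne_zero hζ.1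
  have hp0 : p ≠ 0 := by
    rintro rfl
    rw [coordVec_eq_smul x₀ 0, zero_smul] at hp
    have h1 : (1 : ℂ) = 0 := (coordVec_self y (1 : ℂ)).symm.trans hp
    exact one_ne_zero h1
  unfold formInner
  simp only [hp, ← coordVec_mul]
  rw [inner_eq_locForm h hζ, inner_eq_locForm h hζ, ha, hb, ha, hb]
  have hg : g.inner y (coordVec x₀ p y) (coordVec x₀ p y)
      = Complex.normSq p * g.inner y (coordVec x₀ 1 y) (coordVec x₀ 1 y) := by
    rw [coordVec_eq_smul, g.inner_smul_smul]
    simp [Complex.normSq_apply]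
  have hgV : (g.inner y (coordVec x₀ 1 y) (coordVec x₀ 1 y) : ℂ) ≠ 0 := by
    exact_mod_cast (g.pos y _ hV).ne'
  have hpp : (Complex.normSq p : ℂ) ≠ 0 := by exact_mod_cast (Complex.normSq_pos.2 hp0).ne'
  have hvol : g.vol y (coordVec x₀ 1 y) (coordVec x₀ Complex.I y)
      = g.inner y (coordVec x₀ 1 y) (coordVec x₀ 1 y) := by
    unfold ConformalMetric.vol
    rw [coordVec_eq_smul x₀ Complex.I, g.conformal]
  rw [hg, hvol, div_mul_eq_mul_div, div_eq_iff (by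
    rw [Complex.ofReal_mul]; exact mul_ne_zero hpp hgV), Complex.ofReal_mul]
  simp only [map_add, map_smul, LinearMap.add_apply, LinearMap.smul_apply, map_smulₛₗ, smul_eq_mul,
    map_mul, Complex.conj_I, Complex.conj_conj]
  have hn : (Complex.normSq p : ℂ) = conj p * p := by rw [Complex.normSq_eq_conj_mul_self]
  rw [hn]
  simp only [map_neg, Complex.conj_I]
  ring_nf
  simp only [Complex.I_sq]
  ring

variable [T2Space X] [SigmaCompactSpace X]

/-- The section with coordinates `ρ • u`, extended by zero. -/
def bumpSection (F : Type*) [NormedAddCommGroup F] [NormedSpace ℂ F]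
    (E : X → Type*) [∀ x, AddCommGroup (E x)] [∀ x, Module ℂ (E x)]
    [TopologicalSpace (TotalSpace F E)] [∀ x, TopologicalSpace (E x)]
    [FiberBundle F E] [VectorBundle ℂ F E] (x₀ : X) (ρ : ℂ → ℝ) (u : F) (y : X) : E y :=
  open Classical in
  if y ∈ (chartAt ℂ x₀).source then (ρ (chartAt ℂ x₀ y) : ℂ) • frame F E x₀ y u else 0

variable {x₀ : X} {ρ : ℂ → ℝ}

theorem isCompact_image_tsupport (hρc : HasCompactSupport ρ) (hρΩ : tsupport ρ ⊆ locDom F E x₀) :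
    IsCompact ((chartAt ℂ x₀).symm '' tsupport ρ) :=
  IsCompact.image_of_continuousOn hρc
    ((chartAt ℂ x₀).continuousOn_symm.mono fun _ h => (hρΩ h).1)

theorem bumpSection_eq_zero (u : F) {y : X} (hy : y ∉ (chartAt ℂ x₀).symm '' tsupport ρ) :
    bumpSection F E x₀ ρ u y = 0 := by
  unfold bumpSection
  split_ifs with h
  · have : ρ (chartAt ℂ x₀ y) = 0 := image_eq_zero_of_notMem_tsupport fun h' =>
      hy ⟨_, h', (chartAt ℂ x₀).left_inv h⟩
    simp [this]
  · rfl

theorem loc_bumpSection (u : F) {ζ : ℂ} (hζ : ζ ∈ locDom F E x₀) :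
    loc F x₀ (bumpSection F E x₀ ρ u) ζ = (ρ ζ : ℂ) • u := by
  unfold loc bumpSection
  rw [if_pos ((chartAt ℂ x₀).map_target hζ.1), map_smul, coord_frame F hζ.2,
    (chartAt ℂ x₀).right_inv hζ.1]

theorem loc_bumpSection_eventuallyEq (u : F) {ζ : ℂ} (hζ : ζ ∈ locDom F E x₀) :
    loc F x₀ (bumpSection F E x₀ ρ u) =ᶠ[𝓝 ζ] fun ξ => (ρ ξ : ℂ) • u := by
  filter_upwards [(isOpen_locDom F E x₀).mem_nhds hζ] with ξ hξ using loc_bumpSection u hξ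

theorem loc_eventuallyEq_zero {s : ∀ x, E x} {y : X} (hs : ∀ᶠ p in 𝓝 y, s p = 0) :
    loc F y s =ᶠ[𝓝 (chartAt ℂ y y)] fun _ => 0 := by
  have hc : Filter.Tendsto (chartAt ℂ y).symm (𝓝 (chartAt ℂ y y)) (𝓝 y) := by
    have := (chartAt ℂ y).continuousAt_symm (mem_chart_target ℂ y)
    rwa [ContinuousAt, (chartAt ℂ y).left_inv (mem_chart_source ℂ y)] at this
  filter_upwards [hc.eventually hs] with ξ hξ
  rw [loc, hξ, map_zero]

theorem bumpSection_eventually_zero (hρc : HasCompactSupport ρ) (hρΩ : tsupport ρ ⊆ locDom F E x₀)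
    (u : F) {y : X} (hy : y ∉ (chartAt ℂ x₀).symm '' tsupport ρ) :
    ∀ᶠ p in 𝓝 y, bumpSection F E x₀ ρ u p = 0 := by
  filter_upwards [(isCompact_image_tsupport hρc hρΩ).isClosed.isOpen_compl.mem_nhds hy] with p hp
    using bumpSection_eq_zero u hp

theorem smooth_bumpSection (hρ : ContDiff ℝ ∞ ρ) (hρc : HasCompactSupport ρ)
    (hρΩ : tsupport ρ ⊆ locDom F E x₀) (u : F) :
    SmoothSectionOn F univ (bumpSection F E x₀ ρ u) := by
  intro y _
  refine ContMDiffAt.contMDiffWithinAt ?_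
  by_cases hy : y ∈ (chartAt ℂ x₀).symm '' tsupport ρ
  · obtain ⟨ζ, hζ, rfl⟩ := hy
    refine (contMDiffAt_section_iff_loc (hρΩ hζ)).2 ?_
    refine ContDiffAt.congr_of_eventuallyEq ?_ (loc_bumpSection_eventuallyEq u (hρΩ hζ))
    exact ((Complex.ofRealCLM.contDiff.comp hρ).smul contDiff_const).contDiffAt
  · have h1 := (contMDiffAt_section_iff_loc (chart_mem_locDom F E y)).2
      (contDiffAt_const.congr_of_eventuallyEq
        (loc_eventuallyEq_zero (bumpSection_eventually_zero hρc hρΩ u hy)))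
    rwa [(chartAt ℂ y).left_inv (mem_chart_source ℂ y)] at h1

theorem opD''_eq_zero (θ : HiggsField F E) {s : ∀ x, E x} {y : X} (hs : ∀ᶠ p in 𝓝 y, s p = 0)
    (v : T y) : opD'' θ s y v = 0 := by
  have h0 := loc_eventuallyEq_zero (F := F) hs
  have hd : DifferentiableAt ℝ (loc F y s) (chartAt ℂ y y) :=
    (differentiableAt_const (0 : F)).congr_of_eventuallyEq h0
  have h1 := dbar_coordVec (chart_mem_locDom F E y) hd (v : ℂ)
  have h2 : dzb (loc F y s) (chartAt ℂ y y) = 0 := by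
    rw [← dzb_const (0 : F) (chartAt ℂ y y)]; simp only [dzb, h0.fderiv_eq]
  rw [h2, smul_zero, map_zero, (chartAt ℂ y).left_inv (mem_chart_source ℂ y)] at h1
  rw [coordVec_self] at h1
  unfold opD''
  rw [h1, hs.self_of_nhds, map_zero, add_zero]

theorem dzb_ofReal_smul (hρ : ContDiff ℝ ∞ ρ) (u : F) (ζ : ℂ) :
    dzb (fun ξ => (ρ ξ : ℂ) • u) ζ = dzb (fun ξ => (ρ ξ : ℂ)) ζ • u := by
  have h1 : HasFDerivAt (fun ξ => (ρ ξ : ℂ)) _ ζ :=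
    (((Complex.ofRealCLM.contDiff.comp hρ).differentiable (by simp)) ζ).hasFDerivAt
  have h2 : HasFDerivAt (fun ξ => (ρ ξ : ℂ) • u) _ ζ := h1.smul_const u
  simp only [dzb, h1.fderiv, h2.fderiv, ContinuousLinearMap.smulRight_apply]
  module

/-- The formal adjoint condition is tested on the sections `ρ u` supported in one chart. There the
integral becomes twice a planar integral not involving `g`, which is the hypothesis of
`coclosed_of_integral`. -/
theorem IsHarmonicForm.isHarmonicPair {g : ConformalMetric X} {θ : HiggsField F E}
    {h : HermitianMetric F E} (hh : IsHarmonicMetric θ h) {τ : ∀ x : X, T x →ₗ[ℝ] E x}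
    (hτ : IsHarmonicForm g θ h τ) (x₀ : X) :
    LocalHiggs.IsHarmonicPair (locDom F E x₀) (locConn h x₀) (locHiggs θ x₀) (locAdj θ h x₀)
      (locLeft F x₀ τ) (locRight F x₀ τ) where
  smooth_left := contDiffOn_locLeft hτ.smooth x₀
  smooth_right := contDiffOn_locRight hτ.smooth x₀
  closed ζ hζ := dzb_locLeft hζ θ hτ.smooth hτ.closed
  coclosed ζ hζ := by
    have M := localHiggs θ h hh x₀
    refine M.coclosed_of_integral (contDiffOn_locLeft hτ.smooth x₀) (contDiffOn_locRight hτ.smooth x₀)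
      (fun ρ hρ hρc hρΩ u => ?_) hζ
    set s := bumpSection F E x₀ ρ u with hs
    have h1 := hτ.coclosed s (smooth_bumpSection hρ hρc hρΩ u)
      ⟨_, isCompact_image_tsupport hρc hρΩ, fun x hx => bumpSection_eq_zero u hx⟩
    simp only [map_zero, zero_mul] at h1
    have h2 : surfaceIntegral (univ : Set X) (fun _ _ _ => (0 : ℂ)) = 0 := by
      simp [surfaceIntegral]
    rw [h2] at h1
    set I : ℂ → ℂ := fun ζ => (ρ ζ : ℂ) * locForm h x₀ ζ (locHiggs θ x₀ ζ u) (locLeft F x₀ τ ζ)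
      + dzb (fun ξ => (ρ ξ : ℂ)) ζ * locForm h x₀ ζ u (locRight F x₀ τ ζ) with hI
    have hcoeff : ∀ ζ ∈ locDom F E x₀, chartCoeff (chartAt ℂ x₀)
        (fun x v w => formInner g h (opD'' θ s) (fun x => τ x) x * (g.vol x v w : ℂ)) ζ
          = 2 * I ζ := by
      intro ζ hζ
      rw [chartCoeff_chartAt _ _ hζ.1]
      have hev : loc F x₀ s =ᶠ[𝓝 ζ] _ := loc_bumpSection_eventuallyEq (ρ := ρ) u hζ
      have hd : DifferentiableAt ℝ (loc F x₀ s) ζ :=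
        ((((Complex.ofRealCLM.contDiff.comp hρ).smul contDiff_const).differentiable
          (by simp)).differentiableAt).congr_of_eventuallyEq hev
      have hdz : dzb (loc F x₀ s) ζ = dzb (fun ξ => (ρ ξ : ℂ)) ζ • u := by
        rw [← dzb_ofReal_smul hρ]; simp only [dzb, hev.fderiv_eq]
      have ha : ∀ c, coord F E x₀ ((chartAt ℂ x₀).symm ζ) (opD'' θ s _ (coordVec x₀ c _))
          = c • ((ρ ζ : ℂ) • locHiggs θ x₀ ζ u) + conj c • (dzb (fun ξ => (ρ ξ : ℂ)) ζ • u) := by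
        intro c
        unfold opD''
        rw [dbar_coordVec hζ hd, toFun_coordVec hζ, ← map_add, coord_frame F hζ.2, hdz]
        have : coord F E x₀ ((chartAt ℂ x₀).symm ζ) (s ((chartAt ℂ x₀).symm ζ)) = (ρ ζ : ℂ) • u :=
          loc_bumpSection u hζ
        rw [this, map_smul]
        module
      rw [formInner_mul_vol g h hζ ha fun c => coord_form τ x₀ ζ c]
      simp [hI]
    have hI0 : ∀ ζ ∉ tsupport ρ, I ζ = 0 := by
      intro ζ hζ
      have e1 : ρ ζ = 0 := image_eq_zero_of_notMem_tsupport hζ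
      have e2 : (fun ξ => (ρ ξ : ℂ)) =ᶠ[𝓝 ζ] fun _ => 0 := by
        filter_upwards [(isClosed_tsupport ρ).isOpen_compl.mem_nhds hζ] with ξ hξ
        simp [image_eq_zero_of_notMem_tsupport hξ]
      have e3 : dzb (fun ξ => (ρ ξ : ℂ)) ζ = 0 := by
        rw [← dzb_const (0 : ℂ) ζ]; simp only [dzb, e2.fderiv_eq]
      simp [hI, e1, e3]
    have hψ0 : ∀ x ∈ (univ : Set X), x ∉ (chartAt ℂ x₀).symm '' tsupport ρ → ∀ v w : T x,
        formInner g h (opD'' θ s) (fun x => τ x) x * (g.vol x v w : ℂ) = 0 := by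
      intro x _ hx v w
      have := opD''_eq_zero θ (bumpSection_eventually_zero hρc hρΩ u hx)
      simp only [formInner, hs, this]
      simp
    have hc0 : ∀ ζ ∈ (chartAt ℂ x₀).target, chartCoeff (chartAt ℂ x₀)
        (fun x v w => formInner g h (opD'' θ s) (fun x => τ x) x * (g.vol x v w : ℂ)) ζ
          = 2 * I ζ := by
      intro ζ hζ
      by_cases hζ' : ζ ∈ tsupport ρ
      · exact hcoeff ζ (hρΩ hζ')
      · rw [hI0 ζ hζ', mul_zero]
        refine hψ0 _ (mem_univ _) ?_ _ _
        rintro ⟨ξ, hξ, hξ'⟩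
        exact hζ' ((chartAt ℂ x₀).symm.injOn (hρΩ hξ).1 hζ hξ' ▸ hξ)
    have hIc : ContinuousOn I (locDom F E x₀) := by
      have hρ' : ContDiff ℝ ∞ fun ξ => (ρ ξ : ℂ) := Complex.ofRealCLM.contDiff.comp hρ
      have hd : Continuous (dzb fun ξ => (ρ ξ : ℂ)) := by
        have := hρ'.continuous_fderiv (by simp)
        unfold dzb
        exact ((this.clm_apply continuous_const).add
          ((this.clm_apply continuous_const).const_smul Complex.I)).const_smul (1 / 2 : ℂ)
      exact (hρ'.continuous.continuousOn.mul (contDiffOn_form M.smooth (M.contDiffOn_higgs u)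
        (contDiffOn_locLeft hτ.smooth x₀)).continuousOn).add (hd.continuousOn.mul
          (contDiffOn_form M.smooth contDiffOn_const
            (contDiffOn_locRight hτ.smooth x₀)).continuousOn)
    have hIint : Integrable I := integrable_of_continuousOn_of_support hIc hρc hρΩ hI0
    have hT : (chartAt ℂ x₀).target ∩ (chartAt ℂ x₀).symm ⁻¹' univ = (chartAt ℂ x₀).target := by simp
    have h3 := (surfaceIntegral_chart (isOrientedChart_chartAt x₀)
      (isTwoForm_mul_vol g (formInner g h (opD'' θ s) fun x => τ x)) isOpen_univ
      (K := (chartAt ℂ x₀).symm '' tsupport ρ)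
      (by rintro _ ⟨ξ, hξ, rfl⟩; exact (chartAt ℂ x₀).map_target (hρΩ hξ).1)
      (isCompact_image_tsupport hρc hρΩ) hψ0 (by
        rw [hT]
        exact ((hIint.const_mul 2).integrableOn).congr_fun (fun ζ hζ => (hc0 ζ hζ).symm)
          (chartAt ℂ x₀).open_target.measurableSet)).2
    rw [h1, hT, setIntegral_congr_fun (chartAt ℂ x₀).open_target.measurableSet hc0,
      integral_const_mul, setIntegral_eq_integral_of_forall_compl_eq_zero] at h3
    · exact (mul_eq_zero.1 h3.symm).resolve_left two_ne_zero
    · exact fun ζ hζ => hI0 ζ fun h => hζ (hρΩ h).1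

end HarmonicForms

end HiggsSurface

namespace HiggsSurface

/-! ### Gluing local solutions over a simply connected space -/

section Monodromy

variable {B V : Type*} {E : B → Type*} [TopologicalSpace B]

/-- A family of local solutions, parametrized by `V`, over a neighbourhood of each point, with
existence, uniqueness and unique continuation. -/
structure LocalSystem (N : B → Set B) (sol : B → V → ∀ b, E b) : Prop where
  isOpen : ∀ i, IsOpen (N i)
  mem : ∀ i, i ∈ N i
  bijective : ∀ i, ∀ b ∈ N i, Function.Bijective fun v => sol i v b
  continuation : ∀ i j v w, ∀ b ∈ N i ∩ N j, sol i v b = sol j w b →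
    ∀ᶠ b' in 𝓝 b, sol i v b' = sol j w b'

/-- Monodromy. Local solutions form a fibre bundle with discrete fibre `V`, that is, a covering of
the base. Over a simply connected base the identity lifts, and the lift is a global solution. -/
theorem LocalSystem.exists_global [Nonempty V] [SimplyConnectedSpace B] [LocallyPathConnectedSpace B]
    {N : B → Set B} {sol : B → V → ∀ b, E b} (S : LocalSystem N sol) :
    ∃ σ : ∀ b, E b, ∀ b, ∃ v, ∀ᶠ b' in 𝓝 b, σ b' = sol b v b' := by
  let _ : TopologicalSpace V := ⊥
  have : DiscreteTopology V := ⟨rfl⟩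
  let cc : B → B → B → V → V := fun i j b v => Function.invFun (fun w => sol j w b) (sol i v b)
  have hcc : ∀ i j b v, b ∈ N j → sol j (cc i j b v) b = sol i v b := fun i j b v hb =>
    Function.invFun_eq (f := fun w => sol j w b) ((S.bijective j b hb).2 _)
  have hcc' : ∀ i j b v w, b ∈ N j → sol j w b = sol i v b → cc i j b v = w :=
    fun i j b v w hb h => (S.bijective j b hb).1 ((hcc i j b v hb).trans h.symm)
  let Z : FiberBundleCore B B V :=
    { baseSet := N
      isOpen_baseSet := S.isOpen
      indexAt := id
      mem_baseSet_at := S.mem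
      coordChange := cc
      coordChange_self := fun i x hx v => hcc' i i x v v hx rfl
      -- Continuation makes the coordinate changes locally constant, which is continuity for a
      -- discrete fibre.
      continuousOn_coordChange := by
        rintro i j ⟨b, v⟩ ⟨hb, -⟩
        refine ContinuousAt.continuousWithinAt ?_
        have h1 := S.continuation j i (cc i j b v) v b ⟨hb.2, hb.1⟩ (hcc i j b v hb.2)
        have h2 : ∀ᶠ p : B × V in 𝓝 (b, v), cc i j p.1 p.2 = cc i j b v := by
          filter_upwards [continuous_fst.continuousAt.eventually
            (h1.and ((S.isOpen j).mem_nhds hb.2)),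
            continuous_snd.continuousAt.eventually (isOpen_discrete {v} |>.mem_nhds rfl)]
          rintro ⟨b', v'⟩ h3 (rfl : v' = v)
          exact hcc' i j b' v' _ h3.2 h3.1
        exact continuousAt_const.congr (h2.mono fun _ h => h.symm)
      coordChange_comp := fun i j k x hx v => by
        refine (hcc' i k x v _ hx.2 ?_).symm
        rw [hcc _ _ _ _ hx.2, hcc _ _ _ _ hx.1.2] }
  have cov : IsCoveringMap (π V Z.Fiber) := FiberBundle.isCoveringMap
  obtain ⟨b₀⟩ : Nonempty B := inferInstance
  obtain ⟨v₀⟩ : Nonempty V := inferInstance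
  let e₀ : TotalSpace V Z.Fiber := ⟨b₀, v₀⟩
  obtain ⟨Φ, ⟨-, hΦ⟩, -⟩ := cov.existsUnique_continuousMap_lifts (ContinuousMap.id B) b₀ e₀ rfl
  have hΦ1 : ∀ b, (Φ b).1 = b := fun b => congrFun hΦ b
  let c : B → B → V := fun i b => (Z.localTriv i (Φ b)).2
  have hc : ∀ i b, b ∈ N i → sol i (c i b) b = sol b (c b b) b := by
    intro i b hb
    -- The base point of `Φ b` equals `b` only propositionally; naming the fibre value allows the
    -- rewriting.
    have e : ∃ v : V, ∀ j, c j b = cc b j b v := by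
      refine ⟨(Φ b).2, fun j => ?_⟩
      change cc (Φ b).1 j (Φ b).1 _ = _
      rw [hΦ1]
    obtain ⟨v, hv⟩ := e
    rw [hv, hv, hcc _ _ _ _ hb, hcc _ _ _ _ (S.mem b)]
  refine ⟨fun b => sol b (c b b) b, fun b => ⟨c b b, ?_⟩⟩
  have hcont : ContinuousAt (c b) b := by
    refine continuous_snd.continuousAt.comp (ContinuousAt.comp ?_ Φ.continuous.continuousAt)
    refine (Z.localTriv b).continuousAt ?_
    rw [Trivialization.mem_source]
    have : Z.proj (Φ b) = b := hΦ1 b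
    rw [this]
    exact S.mem b
  filter_upwards [hcont.eventually (isOpen_discrete {c b b} |>.mem_nhds rfl),
    (S.isOpen b).mem_nhds (S.mem b)] with b' h1 h2
  have h3 : c b b' = c b b := h1
  rw [← hc b b' h2, h3]

end Monodromy

/-! ### Primitives of harmonic 1-forms -/

section Primitives

variable {X : Type*} [TopologicalSpace X] [ChartedSpace ℂ X] [IsManifold 𝓘(ℂ, ℂ) ω X]
  {F : Type*} [NormedAddCommGroup F] [NormedSpace ℂ F] [FiniteDimensional ℂ F]
  {E : X → Type*} [∀ x, AddCommGroup (E x)] [∀ x, Module ℂ (E x)]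
  [TopologicalSpace (TotalSpace F E)] [∀ x, TopologicalSpace (E x)]
  [FiberBundle F E] [VectorBundle ℂ F E] [ContMDiffVectorBundle ω F E 𝓘(ℂ, ℂ)]

variable {θ : HiggsField F E} {h : HermitianMetric F E} {τ : ∀ x : X, T x →ₗ[ℝ] E x} {N : Set X}

theorem SmoothSectionOn.contDiffAt_loc {σ : ∀ x, E x} (hσ : SmoothSectionOn F N σ) (hN : IsOpen N)
    {x₀ : X} {ζ : ℂ} (hζ : ζ ∈ locDom F E x₀) (hζN : (chartAt ℂ x₀).symm ζ ∈ N) :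
    ContDiffAt ℝ ∞ (loc F x₀ σ) ζ :=
  (contMDiffAt_section_iff_loc hζ).1 (hσ.contMDiffAt (hN.mem_nhds hζN))

theorem IsPrimitiveOn.hasFDerivAt_loc {σ : ∀ x, E x} (hσ : IsPrimitiveOn θ h N τ σ) (hN : IsOpen N)
    {x₀ : X} {ζ : ℂ} (hζ : ζ ∈ locDom F E x₀) (hζN : (chartAt ℂ x₀).symm ζ ∈ N) :
    HasFDerivAt (loc F x₀ σ) (covec (locLeft F x₀ τ ζ) (locRight F x₀ τ ζ)
      - connForm (locConn h x₀ ζ) (locHiggs θ x₀ ζ) (locAdj θ h x₀ ζ) (loc F x₀ σ ζ)) ζ := by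
  have hd := (hσ.1.contDiffAt_loc hN hζ hζN).differentiableAt (by simp)
  refine hd.hasFDerivAt.congr_fderiv ?_
  ext1 c
  have h1 := hσ.2 _ hζN (coordVec x₀ c _)
  rw [opDD_one_coordVec hζ θ h hd] at h1
  have h2 := congrArg (coord F E x₀ _) h1
  rw [coord_frame F hζ.2, coord_form, ← covec_apply] at h2
  rw [sub_apply, ← h2, add_sub_cancel_right]

theorem isPrimitiveOn_of_loc {σ : ∀ x, E x} {x₀ : X}
    (hN : ∀ y ∈ N, y ∈ (chartAt ℂ x₀).source ∧ chartAt ℂ x₀ y ∈ locDom F E x₀)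
    (hs : ∀ y ∈ N, ContDiffAt ℝ ∞ (loc F x₀ σ) (chartAt ℂ x₀ y))
    (hd : ∀ y ∈ N, ∀ ζ, ζ = chartAt ℂ x₀ y → HasFDerivAt (loc F x₀ σ)
      (covec (locLeft F x₀ τ ζ) (locRight F x₀ τ ζ)
        - connForm (locConn h x₀ ζ) (locHiggs θ x₀ ζ) (locAdj θ h x₀ ζ) (loc F x₀ σ ζ)) ζ) :
    IsPrimitiveOn θ h N τ σ := by
  constructor
  · intro y hy
    have h1 := (contMDiffAt_section_iff_loc (hN y hy).2).2 (hs y hy)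
    rw [(chartAt ℂ x₀).left_inv (hN y hy).1] at h1
    exact h1.contMDiffWithinAt
  · intro y hy
    obtain ⟨hys, hζ⟩ := hN y hy
    obtain ⟨ζ, hζy⟩ : ∃ ζ, ζ = chartAt ℂ x₀ y := ⟨_, rfl⟩
    have hd' := hd y hy ζ hζy
    rw [← hζy] at hζ
    have hyζ : y = (chartAt ℂ x₀).symm ζ := by rw [hζy, (chartAt ℂ x₀).left_inv hys]
    subst hyζ
    intro v
    obtain ⟨c, rfl⟩ := exists_eq_smul_coordVec hζ.1 v
    rw [opDD_one_coordVec hζ θ h hd'.differentiableAt, hd'.fderiv, sub_apply, sub_add_cancel,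
      covec_apply, ← coord_form, frame_coord F hζ.2]

theorem loc_section_eq_iff {σ σ' : ∀ x, E x} {x₀ : X} {ζ : ℂ} (hζ : ζ ∈ locDom F E x₀) :
    loc F x₀ σ ζ = loc F x₀ σ' ζ ↔ σ ((chartAt ℂ x₀).symm ζ) = σ' ((chartAt ℂ x₀).symm ζ) := by
  constructor
  · intro h1
    rw [← frame_coord F hζ.2 (σ _), ← frame_coord F hζ.2 (σ' _)]
    exact congrArg _ h1
  · intro h1
    unfold loc
    rw [h1]

variable [T2Space X] [SigmaCompactSpace X]

/-- Around each point, primitives exist with arbitrary initial values, and are unique. -/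
theorem exists_local_primitive {g : ConformalMetric X} (hh : IsHarmonicMetric θ h)
    (hτ : IsHarmonicForm g θ h τ) (x₀ : X) {O : Set X} (hO : O ∈ 𝓝 x₀) :
    ∃ N : Set X, IsOpen N ∧ x₀ ∈ N ∧ N ⊆ O ∧
      (∀ q ∈ N, ∀ a : E q, ∃ σ : ∀ x, E x, IsPrimitiveOn θ h N τ σ ∧ σ q = a) ∧
      ∀ σ σ' : ∀ x, E x, IsPrimitiveOn θ h N τ σ → IsPrimitiveOn θ h N τ σ' →
        ∀ q ∈ N, σ q = σ' q → ∀ y ∈ N, σ y = σ' y := by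
  set z := chartAt ℂ x₀ with hz
  have hO' : z.symm ⁻¹' O ∈ 𝓝 (z x₀) := by
    refine (z.continuousAt_symm (mem_chart_target ℂ x₀)).preimage_mem_nhds ?_
    rwa [z.left_inv (mem_chart_source ℂ x₀)]
  obtain ⟨r, hr, hrΩ, hex, huniq⟩ := (localHiggs θ h hh x₀).exists_ball_primitive
    (hτ.isHarmonicPair hh x₀) (chart_mem_locDom F E x₀) hO'
  set N : Set X := z.source ∩ z ⁻¹' Metric.ball (z x₀) r with hN
  have hNo : IsOpen N := z.isOpen_inter_preimage Metric.isOpen_ball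
  have hmem : ∀ ζ ∈ Metric.ball (z x₀) r, z.symm ζ ∈ N := by
    intro ζ hζ
    have hζt : ζ ∈ z.target := (hrΩ hζ).1.1
    exact ⟨z.map_target hζt, by rwa [mem_preimage, z.right_inv hζt]⟩
  refine ⟨N, hNo, ⟨mem_chart_source ℂ x₀, Metric.mem_ball_self hr⟩, ?_, ?_, ?_⟩
  · intro y hy
    have h1 := (hrΩ hy.2).2
    rwa [mem_preimage, z.left_inv hy.1] at h1
  · intro q hq a
    obtain ⟨u, huq, hus, hud⟩ := hex (z q) hq.2 (coord F E x₀ q a)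
    have hloc : ∀ ζ ∈ Metric.ball (z x₀) r,
        loc F x₀ (fun y => frame F E x₀ y (u (z y))) ζ = u ζ := by
      intro ζ hζ
      have hζt : ζ ∈ z.target := (hrΩ hζ).1.1
      rw [loc, coord_frame F (hrΩ hζ).1.2, z.right_inv hζt]
    have hev : ∀ ζ ∈ Metric.ball (z x₀) r,
        loc F x₀ (fun y => frame F E x₀ y (u (z y))) =ᶠ[𝓝 ζ] u := fun ζ hζ => by
      filter_upwards [Metric.isOpen_ball.mem_nhds hζ] with ξ hξ using hloc ξ hξ
    refine ⟨fun y => frame F E x₀ y (u (z y)), isPrimitiveOn_of_loc (x₀ := x₀)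
      (fun y hy => ⟨hy.1, (hrΩ hy.2).1⟩) ?_ ?_, ?_⟩
    · intro y hy
      exact (hus.contDiffAt (Metric.isOpen_ball.mem_nhds hy.2)).congr_of_eventuallyEq (hev _ hy.2)
    · rintro y hy ζ rfl
      rw [hloc _ hy.2]
      exact (hud _ hy.2).congr_of_eventuallyEq (hev _ hy.2)
    · have hqb : q ∈ (trivializationAt F E x₀).baseSet := by
        have := (hrΩ hq.2).1.2
        rwa [mem_preimage, z.left_inv hq.1] at this
      simp only [huq]
      exact frame_coord F hqb a
  · intro σ σ' hσ hσ' q hq hqq y hy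
    have hconv := huniq (loc F x₀ σ) (loc F x₀ σ') _ subset_rfl (convex_ball (z x₀) r)
      (fun ζ hζ => hσ.hasFDerivAt_loc hNo (hrΩ hζ).1 (hmem ζ hζ))
      (fun ζ hζ => hσ'.hasFDerivAt_loc hNo (hrΩ hζ).1 (hmem ζ hζ)) (z q) hq.2
      ((loc_section_eq_iff (hrΩ hq.2).1).2 (by rw [z.left_inv hq.1]; exact hqq))
    have h1 := (loc_section_eq_iff (hrΩ hy.2).1).1 (hconv hy.2)
    rwa [z.left_inv hy.1] at h1

theorem IsPrimitiveOn.mono {σ : ∀ x, E x} (hσ : IsPrimitiveOn θ h N τ σ) {N' : Set X} (hN : N' ⊆ N) :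
    IsPrimitiveOn θ h N' τ σ :=
  ⟨ContMDiffOn.mono hσ.1 hN, fun x hx => hσ.2 x (hN hx)⟩

/-- By local uniqueness, agreement at one point propagates to a neighbourhood, and so does
disagreement. Both sets are open. -/
theorem IsPrimitiveOn.eq_of_isPreconnected {g : ConformalMetric X} (hh : IsHarmonicMetric θ h)
    (hτ : IsHarmonicForm g θ h τ) {W : Set X} (hW : IsOpen W) (hWc : IsPreconnected W)
    {σ σ' : ∀ x, E x} (hσ : IsPrimitiveOn θ h W τ σ) (hσ' : IsPrimitiveOn θ h W τ σ') {q : X}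
    (hq : q ∈ W) (hqq : σ q = σ' q) : ∀ y ∈ W, σ y = σ' y := by
  have key : ∀ y ∈ W, ∃ N, IsOpen N ∧ y ∈ N ∧ N ⊆ W ∧ ∀ p ∈ N, σ p = σ' p → ∀ p' ∈ N, σ p' = σ' p' := by
    intro y hy
    obtain ⟨N, hN, hyN, hNW, -, hu⟩ := exists_local_primitive hh hτ y (hW.mem_nhds hy)
    exact ⟨N, hN, hyN, hNW, hu σ σ' (hσ.mono hNW) (hσ'.mono hNW)⟩
  have h1 : IsOpen {y ∈ W | σ y = σ' y} := by
    rw [isOpen_iff_mem_nhds]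
    rintro y ⟨hy, hyy⟩
    obtain ⟨N, hN, hyN, hNW, hu⟩ := key y hy
    exact Filter.mem_of_superset (hN.mem_nhds hyN) fun p hp => ⟨hNW hp, hu y hyN hyy p hp⟩
  have h2 : IsOpen {y ∈ W | σ y ≠ σ' y} := by
    rw [isOpen_iff_mem_nhds]
    rintro y ⟨hy, hyy⟩
    obtain ⟨N, hN, hyN, hNW, hu⟩ := key y hy
    exact Filter.mem_of_superset (hN.mem_nhds hyN) fun p hp =>
      ⟨hNW hp, fun hpp => hyy (hu p hp hpp y hyN)⟩
  have h3 := hWc.subset_left_of_subset_union h1 h2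
    (disjoint_left.2 fun y hy hy' => hy'.2 hy.2)
    (fun y hy => (em (σ y = σ' y)).imp (fun e => ⟨hy, e⟩) fun e => ⟨hy, e⟩) ⟨q, hq, hq, hqq⟩
  exact fun y hy => (h3 hy).2

theorem locallyPathConnectedSpace_of_isOpen {U : Set X} (hU : IsOpen U) :
    LocallyPathConnectedSpace U := by
  have : LocallyPathConnectedSpace X := ChartedSpace.locallyPathConnectedSpace ℂ X
  exact hU.locallyPathConnectedSpace

theorem IsPrimitiveOn.of_eventuallyEq {σ : ∀ x, E x}
    (hσ : ∀ x ∈ N, ∃ (W : Set X) (σ' : ∀ x, E x), IsOpen W ∧ x ∈ W ∧ IsPrimitiveOn θ h W τ σ' ∧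
      ∀ y ∈ W, σ y = σ' y) : IsPrimitiveOn θ h N τ σ := by
  have key : ∀ x ∈ N, ContMDiffAt 𝓘(ℝ, ℂ) (𝓘(ℝ, ℂ).prod 𝓘(ℝ, F)) ∞
      (fun x => TotalSpace.mk' F x (σ x)) x ∧ ∀ v : T x, opDD 1 θ h σ x v = τ x v := by
    intro x hx
    obtain ⟨W, σ', hW, hxW, hσ', he⟩ := hσ x hx
    have hζ := chart_mem_locDom F E x
    have hxx : (chartAt ℂ x).symm (chartAt ℂ x x) = x := (chartAt ℂ x).left_inv (mem_chart_source ℂ x)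
    have hmem : (chartAt ℂ x).symm (chartAt ℂ x x) ∈ W := by rwa [hxx]
    have hev : loc F x σ =ᶠ[𝓝 (chartAt ℂ x x)] loc F x σ' := by
      filter_upwards [((chartAt ℂ x).continuousAt_symm (mem_chart_target ℂ x)).preimage_mem_nhds
        (hW.mem_nhds hmem)] with ξ hξ
      rw [loc, he _ hξ, loc]
    have hs' := hσ'.1.contDiffAt_loc hW hζ hmem
    have hs := hs'.congr_of_eventuallyEq hev
    refine ⟨?_, ?_⟩
    · have := (contMDiffAt_section_iff_loc hζ).2 hs
      rwa [hxx] at this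
    · have h1 : ∀ v : T ((chartAt ℂ x).symm (chartAt ℂ x x)), opDD 1 θ h σ _ v = τ _ v := by
        intro v
        obtain ⟨c, rfl⟩ := exists_eq_smul_coordVec hζ.1 v
        rw [← hσ'.2 _ hmem, opDD_one_coordVec hζ θ h (hs.differentiableAt (by simp)),
          opDD_one_coordVec hζ θ h (hs'.differentiableAt (by simp)), hev.fderiv_eq, hev.self_of_nhds]
      rw [hxx] at h1
      exact h1
  exact ⟨fun x hx => (key x hx).1.contMDiffWithinAt, fun x hx => (key x hx).2⟩

/-- Local primitives around `i` are parametrized by the coordinates of their value at `i`. Local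
existence and uniqueness make them a local system over `U`. -/
theorem exists_primitive {g : ConformalMetric X} (hh : IsHarmonicMetric θ h)
    (hτ : IsHarmonicForm g θ h τ) {U : Set X} (hU : IsOpen U) (hsc : SimplyConnectedSpace U) :
    ∃ σ : ∀ x, E x, IsPrimitiveOn θ h U τ σ := by
  have := locallyPathConnectedSpace_of_isOpen hU
  choose! N hN hmem hNU hex huniq using fun x (hx : x ∈ U) =>
    exists_local_primitive hh hτ x (hU.mem_nhds hx)
  have hb : ∀ x, x ∈ (trivializationAt F E x).baseSet :=
    fun x => FiberBundle.mem_baseSet_trivializationAt' x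
  choose sol hsol hsolv using fun (i : U) (v : F) =>
    hex i i.2 i (hmem i i.2) (frame F E (i : X) i v)
  have S : LocalSystem (E := fun b : U => E (b : X)) (fun i : U => Subtype.val ⁻¹' N i)
      (fun (i : U) v (b : U) => sol i v b) :=
    { isOpen := fun i => (hN i i.2).preimage continuous_subtype_val
      mem := fun i => hmem i i.2
      bijective := by
        refine fun i b hb' => ⟨fun v w hvw => ?_, fun a => ?_⟩
        · have h1 := huniq i i.2 _ _ (hsol i v) (hsol i w) b hb' hvw i (hmem i i.2)
          rw [hsolv, hsolv] at h1
          rw [← coord_frame F (hb i) v, h1, coord_frame F (hb i)]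
        · obtain ⟨σ, hσ, hσa⟩ := hex i i.2 b hb' a
          refine ⟨coord F E (i : X) i (σ i), ?_⟩
          simp only
          rw [← hσa]
          refine huniq i i.2 _ _ (hsol i _) hσ i (hmem i i.2) ?_ b hb'
          rw [hsolv, frame_coord F (hb i)]
      continuation := by
        intro i j v w b hbij hvw
        obtain ⟨N', hN', hbN', hsub, -, hu⟩ := exists_local_primitive hh hτ (b : X)
          (((hN i i.2).inter (hN j j.2)).mem_nhds hbij)
        filter_upwards [(hN'.preimage continuous_subtype_val).mem_nhds hbN'] with b' hb'
        exact hu _ _ ((hsol i v).mono fun y hy => (hsub hy).1)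
          ((hsol j w).mono fun y hy => (hsub hy).2) b hbN' hvw b' hb' }
  obtain ⟨σ, hσ⟩ := S.exists_global
  classical
  refine ⟨fun x => if hx : x ∈ U then σ ⟨x, hx⟩ else 0, IsPrimitiveOn.of_eventuallyEq fun x hx => ?_⟩
  obtain ⟨v, hv⟩ := hσ ⟨x, hx⟩
  obtain ⟨W, hW, hWo, hxW⟩ := eventually_nhds_iff.1 hv
  refine ⟨Subtype.val '' W ∩ N x, sol ⟨x, hx⟩ v,
    (hU.isOpenMap_subtype_val W hWo).inter (hN x hx), ⟨⟨_, hxW, rfl⟩, hmem x hx⟩,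
    (hsol ⟨x, hx⟩ v).mono inter_subset_right, ?_⟩
  rintro _ ⟨⟨y, hy, rfl⟩, -⟩
  rw [dif_pos y.2]
  exact hW y hy

end Primitives

end HiggsSurface

namespace HiggsSurface

/-! ### Extension of primitives to the boundary -/

section BoundaryExtension

variable {X : Type*} [TopologicalSpace X] [ChartedSpace ℂ X] [IsManifold 𝓘(ℂ, ℂ) ω X]
  {F : Type*} [NormedAddCommGroup F] [NormedSpace ℂ F] [FiniteDimensional ℂ F]
  {E : X → Type*} [∀ x, AddCommGroup (E x)] [∀ x, Module ℂ (E x)]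
  [TopologicalSpace (TotalSpace F E)] [∀ x, TopologicalSpace (E x)]
  [FiberBundle F E] [VectorBundle ℂ F E] [ContMDiffVectorBundle ω F E 𝓘(ℂ, ℂ)]
  [T2Space X] [SigmaCompactSpace X]

variable {θ : HiggsField F E} {h : HermitianMetric F E} {τ : ∀ x : X, T x →ₗ[ℝ] E x} {U : Set X}

theorem continuousAt_loc_chart {W : Set X} (hW : IsOpen W) {σ : ∀ x, E x}
    (hσ : SmoothSectionOn F W σ) {y : X} (hy : y ∈ W) :
    ContinuousAt (fun p => loc F y σ (chartAt ℂ y p)) y := by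
  have h1 := (hσ.contDiffAt_loc hW (chart_mem_locDom F E y)
    (by rwa [(chartAt ℂ y).left_inv (mem_chart_source ℂ y)])).continuousAt
  exact ContinuousAt.comp (f := chartAt ℂ y) h1
    ((chartAt ℂ y).continuousAt (mem_chart_source ℂ y))

/-- Both sections are continuous at `y` and agree at points of `U` arbitrarily close to it. -/
theorem section_eq_of_mem_closure {W W' : Set X} (hW : IsOpen W) (hW' : IsOpen W') {σ σ' : ∀ x, E x}
    (hσ : SmoothSectionOn F W σ) (hσ' : SmoothSectionOn F W' σ') {y : X} (hy : y ∈ W) (hy' : y ∈ W')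
    (hyU : y ∈ closure U) (heq : ∀ p ∈ W ∩ W' ∩ U, σ p = σ' p) : σ y = σ' y := by
  have hyy : (chartAt ℂ y).symm (chartAt ℂ y y) = y := (chartAt ℂ y).left_inv (mem_chart_source ℂ y)
  have h1 : loc F y σ (chartAt ℂ y y) = loc F y σ' (chartAt ℂ y y) := by
    refine tendsto_nhds_unique_of_frequently_eq (continuousAt_loc_chart hW hσ hy)
      (continuousAt_loc_chart hW' hσ' hy') ?_
    refine ((mem_closure_iff_frequently.1 hyU).and_eventually
      (Filter.inter_mem ((hW.inter hW').mem_nhds ⟨hy, hy'⟩)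
        ((chartAt ℂ y).open_source.mem_nhds (mem_chart_source ℂ y)))).mono ?_
    rintro p ⟨hpU, hpW, hps⟩
    unfold loc
    rw [(chartAt ℂ y).left_inv hps, heq p ⟨hpW, hpU⟩]
  have h2 := (loc_section_eq_iff (chart_mem_locDom F E y)).1 h1
  rwa [hyy] at h2

/-- In a boundary chart, a small ball meets `U` in a half ball, which is convex. A primitive on the
full ball that has the value of `σ` at one point of the half ball agrees with `σ` throughout it. -/
theorem exists_primitive_near_closure {g : ConformalMetric X} (hh : IsHarmonicMetric θ h)
    (hτ : IsHarmonicForm g θ h τ) (hUo : IsOpen U) (hU : HasSmoothBoundary U) {σ : ∀ x, E x}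
    (hσ : IsPrimitiveOn θ h U τ σ) {p : X} (hp : p ∈ closure U) :
    ∃ (W : Set X) (σ' : ∀ x, E x), IsOpen W ∧ p ∈ W ∧ IsPrimitiveOn θ h W τ σ' ∧
      ∀ y ∈ W ∩ U, σ y = σ' y := by
  by_cases hpU : p ∈ U
  · exact ⟨U, σ, hUo, hpU, hσ, fun _ _ => rfl⟩
  obtain ⟨φ, hpφ, hφ⟩ := hU p ⟨hp, by rwa [hUo.interior_eq]⟩
  obtain ⟨N, hN, hpN, -, hex, -⟩ := exists_local_primitive hh hτ p (φ.open_source.mem_nhds hpφ)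
  obtain ⟨r, hr, hrN⟩ := Metric.isOpen_iff.1 (φ.symm.isOpen_inter_preimage hN) (φ p)
    ⟨φ.map_source hpφ, by
      change φ.symm (φ p) ∈ N
      rwa [φ.left_inv hpφ]⟩
  set W : Set X := φ.source ∩ φ ⁻¹' Metric.ball (φ p) r with hW
  have hWo : IsOpen W := φ.isOpen_inter_preimage Metric.isOpen_ball
  have hWN : W ⊆ N := by
    intro y hy
    have h1 : φ.symm (φ y) ∈ N := (hrN hy.2).2
    rwa [φ.left_inv hy.1] at h1
  have hpW : p ∈ W := ⟨hpφ, Metric.mem_ball_self hr⟩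
  have hWU : W ∩ U = φ.symm '' (Metric.ball (φ p) r ∩ {ξ : ℂ | 0 < ξ.im}) := by
    ext y
    constructor
    · rintro ⟨hy, hyU⟩
      exact ⟨φ y, ⟨hy.2, (hφ.straight y hy.1).1 hyU⟩, φ.left_inv hy.1⟩
    · rintro ⟨ξ, ⟨hξ, hξ0⟩, rfl⟩
      have hξt : ξ ∈ φ.target := (hrN hξ).1
      have hs := φ.map_target hξt
      refine ⟨⟨hs, by rwa [mem_preimage, φ.right_inv hξt]⟩, (hφ.straight _ hs).2 ?_⟩
      rwa [φ.right_inv hξt]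
  have hconn : IsPreconnected (W ∩ U) := by
    rw [hWU]
    refine (((convex_ball (φ p) r).inter (convex_halfSpace_im_gt 0)).isPreconnected).image _ ?_
    exact φ.continuousOn_symm.mono fun ξ hξ => (hrN hξ.1).1
  obtain ⟨q, hqW, hqU⟩ := mem_closure_iff.1 hp W hWo hpW
  obtain ⟨σ', hσ', hq⟩ := hex q (hWN hqW) (σ q)
  refine ⟨W, σ', hWo, hpW, hσ'.mono hWN, ?_⟩
  exact (hσ.mono inter_subset_right).eq_of_isPreconnected hh hτ (hWo.inter hUo) hconn
    (hσ'.mono (inter_subset_left.trans hWN)) ⟨hqW, hqU⟩ hq.symm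

/-- A primitive on `U` extends to the closure of `U` and, near each point of the closure, the
extension is the restriction of a primitive on an open set. -/
theorem exists_boundary_extension {g : ConformalMetric X} (hh : IsHarmonicMetric θ h)
    (hτ : IsHarmonicForm g θ h τ) (hUo : IsOpen U) (hU : HasSmoothBoundary U) {σ : ∀ x, E x}
    (hσ : IsPrimitiveOn θ h U τ σ) :
    ∃ σ₁ : ∀ x, E x, (∀ x ∈ U, σ₁ x = σ x) ∧ ∀ p ∈ closure U, ∃ (W : Set X) (σ' : ∀ x, E x),
      IsOpen W ∧ p ∈ W ∧ IsPrimitiveOn θ h W τ σ' ∧ ∀ y ∈ W ∩ closure U, σ₁ y = σ' y := by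
  choose! W σ' hW hpW hσ' heq using fun p (hp : p ∈ closure U) =>
    exists_primitive_near_closure hh hτ hUo hU hσ hp
  classical
  -- Off `U` take, at `x`, the value of the primitive chosen around `x`; on the closure, the
  -- different choices are compatible by continuity from inside `U`.
  refine ⟨fun x => if x ∈ U then σ x else σ' x x, fun x hx => if_pos hx, fun p hp =>
    ⟨W p, σ' p, hW p hp, hpW p hp, hσ' p hp, ?_⟩⟩
  rintro y ⟨hyW, hyU⟩
  beta_reduce
  split_ifs with hy
  · exact heq p hp y ⟨hyW, hy⟩
  · refine section_eq_of_mem_closure (hW y hyU) (hW p hp) (hσ' y hyU).1 (hσ' p hp).1 (hpW y hyU) hyW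
      hyU ?_
    rintro x ⟨⟨hx, hx'⟩, hxU⟩
    rw [← heq y hyU x ⟨hx, hxU⟩, heq p hp x ⟨hx', hxU⟩]

theorem continuousSectionOn_of_local {σ₁ : ∀ x, E x} {A : Set X}
    (hσ : ∀ p ∈ A, ∃ (W : Set X) (σ' : ∀ x, E x),
      IsOpen W ∧ p ∈ W ∧ IsPrimitiveOn θ h W τ σ' ∧ ∀ y ∈ W ∩ A, σ₁ y = σ' y) :
    ContinuousSectionOn F A σ₁ := by
  intro p hp
  obtain ⟨W, σ', hW, hpW, hσ', he⟩ := hσ p hp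
  have h1 := (hσ'.1.contMDiffAt (hW.mem_nhds hpW)).continuousAt
  refine h1.continuousWithinAt.congr_of_eventuallyEq ?_ ?_
  · filter_upwards [inter_mem_nhdsWithin A (hW.mem_nhds hpW)] with y hy
    rw [he y ⟨hy.2, hy.1⟩]
  · rw [he p ⟨hpW, hp⟩]

end BoundaryExtension

end HiggsSurface

namespace HiggsSurface

/-! ### Stokes' theorem in the upper half plane -/

section HalfPlane

/-- The divergence theorem for the field `(Q, -P)` on `[-R, R] × [0, R]`. Three sides carry nothing
by the support condition, and the bottom side gives `∫ P`. Differentiability is needed only in the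
open half plane. -/
theorem integral_curl_halfPlane {P Q : ℂ → ℂ} {R : ℝ} (hR : 0 < R)
    (hPc : ContinuousOn P {ξ : ℂ | 0 ≤ ξ.im}) (hQc : ContinuousOn Q {ξ : ℂ | 0 ≤ ξ.im})
    (hPd : ∀ ξ : ℂ, 0 < ξ.im → DifferentiableAt ℝ P ξ)
    (hQd : ∀ ξ : ℂ, 0 < ξ.im → DifferentiableAt ℝ Q ξ)
    (h0 : ∀ ξ : ℂ, 0 ≤ ξ.im → R ≤ ‖ξ‖ → P ξ = 0 ∧ Q ξ = 0)
    (hint : IntegrableOn (fun ξ => fderiv ℝ Q ξ 1 - fderiv ℝ P ξ Complex.I) {ξ : ℂ | 0 < ξ.im}) :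
    ∫ ξ in {ξ : ℂ | 0 < ξ.im}, (fderiv ℝ Q ξ 1 - fderiv ℝ P ξ Complex.I) = ∫ t : ℝ, P t := by
  set k : ℂ → ℂ := fun ξ => fderiv ℝ Q ξ 1 - fderiv ℝ P ξ Complex.I with hk
  set e : (ℝ × ℝ) ≃L[ℝ] ℂ := Complex.equivRealProdCLM.symm with he
  have hee : ∀ x : ℝ × ℝ, e x = ⟨x.1, x.2⟩ := fun x => by
    apply Complex.ext <;> simp [e]
  have hmp : MeasurePreserving Complex.measurableEquivRealProd.symm :=
    Complex.volume_preserving_equiv_real_prod.symm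
  have hme : ∀ x, Complex.measurableEquivRealProd.symm x = e x := fun x => by
    rw [hee]; rfl
  set H : Set ℂ := {ξ : ℂ | 0 < ξ.im} with hH
  set S : Set (ℝ × ℝ) := univ ×ˢ Ioi 0 with hS
  have hpre : Complex.measurableEquivRealProd.symm ⁻¹' H = S := by
    ext x
    simp [hme, hee, H, S]
  set A : Set (ℝ × ℝ) := Icc (-R) R ×ˢ Ioc 0 R with hA
  have hAS : A ⊆ S := fun x hx => ⟨mem_univ _, hx.2.1⟩
  have hSm : MeasurableSet S := MeasurableSet.univ.prod measurableSet_Ioi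
  -- The divergence theorem uses the closed rectangle, the open half plane omits the bottom edge,
  -- and that edge is null.
  have hAI : Icc ((-R, 0) : ℝ × ℝ) (R, R) =ᵐ[volume] A := by
    rw [← Icc_prod_Icc]
    exact (Measure.set_prod_ae_eq (Filter.EventuallyEq.refl _ _) Ioc_ae_eq_Icc).symm
  have hk0 : ∀ x ∈ S \ A, k (e x) = 0 := by
    intro x hx
    have hx2 : 0 < x.2 := hx.1.2
    have hn : R < ‖e x‖ := by
      by_contra hle
      push Not at hle
      refine hx.2 ⟨?_, hx2, ?_⟩
      · have h1 := (Complex.abs_re_le_norm (e x)).trans hle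
        rw [hee] at h1
        exact abs_le.1 h1
      · have h1 := (Complex.abs_im_le_norm (e x)).trans hle
        rw [hee] at h1
        exact (abs_le.1 h1).2
    have him : 0 < (e x).im := by rw [hee]; exact hx2
    have hev : ∀ᶠ ξ in 𝓝 (e x), P ξ = 0 ∧ Q ξ = 0 := by
      filter_upwards [(isOpen_lt continuous_const continuous_norm).mem_nhds hn,
        (isOpen_lt continuous_const Complex.continuous_im).mem_nhds him] with ξ h1 h2
      exact h0 ξ (le_of_lt h2) (le_of_lt h1)
    have hP : P =ᶠ[𝓝 (e x)] fun _ => 0 := hev.mono fun _ h => h.1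
    have hQ : Q =ᶠ[𝓝 (e x)] fun _ => 0 := hev.mono fun _ h => h.2
    simp [hk, hP.fderiv_eq, hQ.fderiv_eq]
  have hintS : IntegrableOn (fun x => k (e x)) S := by
    have h1 := (hmp.integrableOn_comp_preimage
      (Complex.measurableEquivRealProd.symm.measurableEmbedding)).2 hint
    rw [hpre] at h1
    exact h1.congr_fun (fun x _ => by simp [hme]) hSm
  have h1 : ∫ ξ in H, k ξ = ∫ x in Icc ((-R, 0) : ℝ × ℝ) (R, R), k (e x) := by
    rw [← hmp.setIntegral_preimage_emb Complex.measurableEquivRealProd.symm.measurableEmbedding,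
      hpre, setIntegral_congr_set hAI]
    simp only [hme]
    exact setIntegral_eq_of_subset_of_forall_sdiff_eq_zero hSm hAS hk0
  have hmaps : MapsTo e (Icc ((-R, 0) : ℝ × ℝ) (R, R)) {ξ : ℂ | 0 ≤ ξ.im} := by
    intro x hx
    change 0 ≤ (e x).im
    rw [hee]
    exact hx.1.2
  have hder : ∀ {G : ℂ → ℂ}, (∀ ξ : ℂ, 0 < ξ.im → DifferentiableAt ℝ G ξ) →
      ∀ x ∈ Ioo (-R) R ×ˢ Ioo (0 : ℝ) R \ (∅ : Set (ℝ × ℝ)),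
        HasFDerivAt (fun x => G (e x)) ((fderiv ℝ G (e x)).comp (e : (ℝ × ℝ) →L[ℝ] ℂ)) x := by
    intro G hG x hx
    have him : 0 < (e x).im := by rw [hee]; exact hx.1.2.1
    exact (hG _ him).hasFDerivAt.comp x e.hasFDerivAt
  have e1 : e (1, 0) = 1 := by rw [hee]; rfl
  have e2 : e (0, 1) = Complex.I := by rw [hee]; rfl
  have h2 := integral_divergence_prod_Icc_of_hasFDerivAt_off_countable_of_le
    (fun x => Q (e x)) (fun x => -P (e x))
    (fun x => (fderiv ℝ Q (e x)).comp (e : (ℝ × ℝ) →L[ℝ] ℂ))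
    (fun x => -(fderiv ℝ P (e x)).comp (e : (ℝ × ℝ) →L[ℝ] ℂ)) (-R, 0) (R, R)
    ⟨by simp; linarith, hR.le⟩ ∅ countable_empty
    (hQc.comp e.continuous.continuousOn hmaps) (hPc.comp e.continuous.continuousOn hmaps).neg
    (hder hQd) (fun x hx => (hder hPd x hx).neg) (by
      refine (hintS.mono_set hAS).congr_set_ae hAI |>.congr_fun (fun x _ => ?_) measurableSet_Icc
      simp [hk, e1, e2, sub_eq_add_neg])
  have h3 : ∀ x : ℝ × ℝ, (fderiv ℝ Q (e x)).comp (e : (ℝ × ℝ) →L[ℝ] ℂ) (1, 0)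
      + (-(fderiv ℝ P (e x)).comp (e : (ℝ × ℝ) →L[ℝ] ℂ)) (0, 1) = k (e x) := fun x => by
    simp [hk, e1, e2, sub_eq_add_neg]
  simp only [h3] at h2
  rw [h1, h2]
  have hle : -R ≤ R := by linarith
  have top : ∀ x : ℝ, P (e (x, R)) = 0 := fun x => by
    refine (h0 _ ?_ ?_).1
    · rw [hee]; exact hR.le
    · refine le_trans ?_ (Complex.abs_im_le_norm _)
      rw [hee]; exact le_abs_self R
  have right : ∀ y ∈ uIcc 0 R, Q (e (R, y)) = 0 := fun y hy => by
    rw [uIcc_of_le hR.le] at hy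
    refine (h0 _ ?_ ?_).2
    · rw [hee]; exact hy.1
    · refine le_trans ?_ (Complex.abs_re_le_norm _)
      rw [hee]; exact le_abs_self R
  have left : ∀ y ∈ uIcc 0 R, Q (e (-R, y)) = 0 := fun y hy => by
    rw [uIcc_of_le hR.le] at hy
    refine (h0 _ ?_ ?_).2
    · rw [hee]; exact hy.1
    · refine le_trans ?_ (Complex.abs_re_le_norm _)
      rw [hee]; exact (le_abs_self R).trans_eq (abs_neg R).symm
  have bot : ∀ x : ℝ, e (x, 0) = x := fun x => by rw [hee]; rfl
  simp only [top, bot]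
  rw [intervalIntegral.integral_congr right, intervalIntegral.integral_congr left]
  simp only [neg_zero, intervalIntegral.integral_zero, intervalIntegral.integral_neg, sub_zero,
    add_zero, zero_sub, neg_neg]
  rw [intervalIntegral.integral_of_le hle]
  refine setIntegral_eq_integral_of_forall_compl_eq_zero fun t ht => (h0 t ?_ ?_).1
  · simp
  · rw [Complex.norm_real, Real.norm_eq_abs]
    by_contra hlt
    push Not at hlt
    obtain ⟨h4, h5⟩ := abs_lt.1 hlt
    exact ht ⟨h4, h5.le⟩

open Classical in
/-- Stokes' theorem for a 1-form `P dx + Q dy` on the part of an open set `D` in the upper half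
plane, with support in a compact subset of `D`. -/
theorem integral_curl_of_compact {P Q k : ℂ → ℂ} {D C : Set ℂ} (hD : IsOpen D) (hC : IsCompact C)
    (hCD : C ⊆ D) (hPc : ContinuousOn P (D ∩ {ξ : ℂ | 0 ≤ ξ.im}))
    (hQc : ContinuousOn Q (D ∩ {ξ : ℂ | 0 ≤ ξ.im}))
    (hPd : ∀ ξ ∈ D, 0 < ξ.im → DifferentiableAt ℝ P ξ)
    (hQd : ∀ ξ ∈ D, 0 < ξ.im → DifferentiableAt ℝ Q ξ)
    (h0 : ∀ ξ ∈ D, 0 ≤ ξ.im → ξ ∉ C → P ξ = 0 ∧ Q ξ = 0)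
    (hk : ∀ ξ ∈ D, 0 < ξ.im → fderiv ℝ Q ξ 1 - fderiv ℝ P ξ Complex.I = k ξ)
    (hint : IntegrableOn k (D ∩ {ξ : ℂ | 0 < ξ.im})) :
    ∫ ξ in D ∩ {ξ : ℂ | 0 < ξ.im}, k ξ = ∫ t in {t : ℝ | (t : ℂ) ∈ D}, P t := by
  obtain ⟨R, hR, hCR⟩ : ∃ R > 0, ∀ ξ ∈ C, ‖ξ‖ < R := by
    obtain ⟨R, hR⟩ := hC.isBounded.subset_ball (0 : ℂ)
    exact ⟨max R 1, by positivity, fun ξ hξ => lt_of_lt_of_le (by simpa using hR hξ) (le_max_left _ _)⟩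
  -- `P` and `Q` are extended by zero off `D`. The extension stays regular because the support lies
  -- in the compact set `C` inside the open set `D`.
  have zero : ∀ {G : ℂ → ℂ}, (∀ ξ ∈ D, 0 ≤ ξ.im → ξ ∉ C → G ξ = 0) → ∀ ξ : ℂ, 0 ≤ ξ.im → ξ ∉ C →
      D.indicator G ξ = 0 := by
    intro G hG ξ hξ hξC
    by_cases hξD : ξ ∈ D
    · rw [indicator_of_mem hξD, hG ξ hξD hξ hξC]
    · exact indicator_of_notMem hξD G
  have cont : ∀ {G : ℂ → ℂ}, ContinuousOn G (D ∩ {ξ : ℂ | 0 ≤ ξ.im}) →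
      (∀ ξ ∈ D, 0 ≤ ξ.im → ξ ∉ C → G ξ = 0) → ContinuousOn (D.indicator G) {ξ : ℂ | 0 ≤ ξ.im} := by
    intro G hG hG0 ξ hξ
    by_cases hξD : ξ ∈ D
    · have h1 : ContinuousWithinAt G {ξ : ℂ | 0 ≤ ξ.im} ξ := by
        have := hG ξ ⟨hξD, hξ⟩
        rwa [inter_comm, continuousWithinAt_inter (hD.mem_nhds hξD)] at this
      refine h1.congr_of_eventuallyEq ?_ (indicator_of_mem hξD G)
      filter_upwards [mem_nhdsWithin_of_mem_nhds (hD.mem_nhds hξD)] with η hη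
      exact indicator_of_mem hη G
    · have hξC : ξ ∉ C := fun h => hξD (hCD h)
      refine (continuousWithinAt_const (b := (0 : ℂ))).congr_of_eventuallyEq ?_ (zero hG0 ξ hξ hξC)
      filter_upwards [mem_nhdsWithin_of_mem_nhds (hC.isClosed.isOpen_compl.mem_nhds hξC),
        self_mem_nhdsWithin] with η h1 h2
      exact zero hG0 η h2 h1
  have evD : ∀ (G : ℂ → ℂ) {ξ : ℂ}, ξ ∈ D → D.indicator G =ᶠ[𝓝 ξ] G := by
    intro G ξ hξ
    filter_upwards [hD.mem_nhds hξ] with η hη using indicator_of_mem hη G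
  have evC : ∀ {G : ℂ → ℂ}, (∀ ξ ∈ D, 0 ≤ ξ.im → ξ ∉ C → G ξ = 0) → ∀ {ξ : ℂ}, ξ ∉ D → 0 < ξ.im →
      D.indicator G =ᶠ[𝓝 ξ] fun _ => 0 := by
    intro G hG ξ hξ hξ0
    filter_upwards [hC.isClosed.isOpen_compl.mem_nhds fun h => hξ (hCD h),
      (isOpen_lt continuous_const Complex.continuous_im).mem_nhds hξ0] with η h1 h2
    exact zero hG η (le_of_lt h2) h1
  have diff : ∀ {G : ℂ → ℂ}, (∀ ξ ∈ D, 0 < ξ.im → DifferentiableAt ℝ G ξ) →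
      (∀ ξ ∈ D, 0 ≤ ξ.im → ξ ∉ C → G ξ = 0) → ∀ ξ : ℂ, 0 < ξ.im →
        DifferentiableAt ℝ (D.indicator G) ξ := by
    intro G hG hG0 ξ hξ
    by_cases hξD : ξ ∈ D
    · exact (hG ξ hξD hξ).congr_of_eventuallyEq (evD G hξD)
    · exact (differentiableAt_const (0 : ℂ)).congr_of_eventuallyEq (evC hG0 hξD hξ)
  have hP0 : ∀ ξ ∈ D, 0 ≤ ξ.im → ξ ∉ C → P ξ = 0 := fun ξ h1 h2 h3 => (h0 ξ h1 h2 h3).1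
  have hQ0 : ∀ ξ ∈ D, 0 ≤ ξ.im → ξ ∉ C → Q ξ = 0 := fun ξ h1 h2 h3 => (h0 ξ h1 h2 h3).2
  set H : Set ℂ := {ξ : ℂ | 0 < ξ.im} with hH
  have hHm : MeasurableSet H := (isOpen_lt continuous_const Complex.continuous_im).measurableSet
  have hkI : ∀ ξ ∈ H, fderiv ℝ (D.indicator Q) ξ 1 - fderiv ℝ (D.indicator P) ξ Complex.I
      = D.indicator k ξ := by
    intro ξ hξ
    by_cases hξD : ξ ∈ D
    · rw [(evD Q hξD).fderiv_eq, (evD P hξD).fderiv_eq, hk ξ hξD hξ, indicator_of_mem hξD]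
    · rw [(evC hQ0 hξD hξ).fderiv_eq, (evC hP0 hξD hξ).fderiv_eq, indicator_of_notMem hξD]
      simp
  have h1 := integral_curl_halfPlane hR (cont hPc hP0) (cont hQc hQ0) (diff hPd hP0) (diff hQd hQ0)
    (fun ξ hξ hξR => by
      have hξC : ξ ∉ C := fun h => absurd (hCR ξ h) (not_lt.2 hξR)
      exact ⟨zero hP0 ξ hξ hξC, zero hQ0 ξ hξ hξC⟩) (by
      refine IntegrableOn.congr_fun (f := D.indicator k) ?_ (fun ξ hξ => (hkI ξ hξ).symm) hHm
      rw [integrableOn_indicator_iff hD.measurableSet]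
      exact hint)
  rw [setIntegral_congr_fun hHm hkI, setIntegral_indicator hD.measurableSet, inter_comm] at h1
  rw [h1, ← integral_indicator]
  · rfl
  · exact (hD.preimage Complex.continuous_ofReal).measurableSet

end HalfPlane

end HiggsSurface

namespace HiggsSurface

/-! ### Stokes' theorem in a boundary chart -/

section ChartStokes

variable {X : Type*} [TopologicalSpace X] [ChartedSpace ℂ X] [IsManifold 𝓘(ℂ, ℂ) ω X]

/-- The 1-form `η` is locally on `closure U` the restriction of a `C¹` form, and `dη = ψ` on `U`. -/
structure IsStokesPair (U : Set X) (η : ∀ x : X, T x →ₗ[ℝ] ℂ) (ψ : ∀ x : X, T x → T x → ℂ) :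
    Prop where
  twoForm : IsTwoForm ψ
  extension : ∀ p ∈ closure U, ∃ L : ℂ → ℂ →L[ℝ] ℂ, ContDiffAt ℝ 1 L (chartAt ℂ p p) ∧
    ∀ᶠ ζ in 𝓝 (chartAt ℂ p p),
      ((chartAt ℂ p).symm ζ ∈ closure U → ∀ c, η _ (coordVec p c ((chartAt ℂ p).symm ζ)) = L ζ c) ∧
      ((chartAt ℂ p).symm ζ ∈ U → ψ _ (coordVec p 1 ((chartAt ℂ p).symm ζ)) (coordVec p Complex.I _)
        = fderiv ℝ L ζ 1 Complex.I - fderiv ℝ L ζ Complex.I 1)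

theorem antisymm_plane (B : ℂ →L[ℝ] ℂ →L[ℝ] ℂ) (p q : ℂ) :
    B p q - B q p = ((conj p * q).im : ℂ) * (B 1 Complex.I - B Complex.I 1) := by
  have key : ∀ p : ℂ, p = p.re • (1 : ℂ) + p.im • Complex.I := fun p => by
    apply Complex.ext <;> simp
  have h : ∀ p q : ℂ, B p q = p.re * q.re * B 1 1 + p.re * q.im * B 1 Complex.I
      + p.im * q.re * B Complex.I 1 + p.im * q.im * B Complex.I Complex.I := fun p q => by
    conv_lhs => rw [key p, key q]
    rw [map_add B, map_smul B, map_smul B, add_apply, smul_apply, smul_apply, map_add, map_add,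
      map_smul, map_smul, map_smul, map_smul]
    simp only [Complex.real_smul]
    ring
  rw [h p q, h q p, Complex.mul_im, Complex.conj_re, Complex.conj_im]
  push_cast
  ring

/-- The last term is symmetric in `a` and `b` for a `C²` map, so it disappears when an exterior
derivative is formed. -/
theorem fderiv_pullback {L : ℂ → ℂ →L[ℝ] ℂ} {f : ℂ → ℂ} {ξ : ℂ} (hL : DifferentiableAt ℝ L (f ξ))
    (hf : ContDiffAt ℝ 2 f ξ) (a b : ℂ) :
    fderiv ℝ (fun ξ => (L (f ξ)).comp (fderiv ℝ f ξ)) ξ a b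
      = fderiv ℝ L (f ξ) (fderiv ℝ f ξ a) (fderiv ℝ f ξ b)
        + L (f ξ) (fderiv ℝ (fderiv ℝ f) ξ a b) := by
  have h1 : HasFDerivAt (fun ξ => L (f ξ)) ((fderiv ℝ L (f ξ)).comp (fderiv ℝ f ξ)) ξ :=
    hL.hasFDerivAt.comp ξ (hf.differentiableAt (by simp)).hasFDerivAt
  have h2 : HasFDerivAt (fderiv ℝ f) (fderiv ℝ (fderiv ℝ f) ξ) ξ :=
    ((hf.fderiv_right (m := 1) (by norm_num)).differentiableAt (by simp)).hasFDerivAt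
  rw [(h1.clm_comp h2).fderiv]
  simp [add_comm]

variable {U : Set X} {η : ∀ x : X, T x →ₗ[ℝ] ℂ} {ψ : ∀ x : X, T x → T x → ℂ}
  {φ : OpenPartialHomeomorph X ℂ}

/-- Pull the local extension back along the transition map. Exterior differentiation commutes with
pullback, and the resulting determinant is the one by which the coefficient of `ψ` changes. -/
theorem IsStokesPair.chart_extension (hη : IsStokesPair U η ψ)
    (hφ : φ ∈ IsManifold.maximalAtlas 𝓘(ℝ, ℂ) ∞ X) {ξ₀ : ℂ} (hξ₀ : ξ₀ ∈ φ.target)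
    (hU : φ.symm ξ₀ ∈ closure U) : ∃ Λ : ℂ → ℂ →L[ℝ] ℂ, ContDiffAt ℝ 1 Λ ξ₀ ∧
    ∀ᶠ ξ in 𝓝 ξ₀, (φ.symm ξ ∈ closure U → ∀ c, η (φ.symm ξ) (chartVec φ ξ c) = Λ ξ c) ∧
      (φ.symm ξ ∈ U → chartCoeff φ ψ ξ = fderiv ℝ Λ ξ 1 Complex.I - fderiv ℝ Λ ξ Complex.I 1) := by
  set p := φ.symm ξ₀ with hp
  set z := chartAt ℂ p with hz
  obtain ⟨L, hL, hev⟩ := hη.extension p hU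
  set f : ℂ → ℂ := z ∘ φ.symm with hf
  have hzr := chartAt_mem_realAtlas p
  have hfξ : f ξ₀ = z p := rfl
  have hdom : φ.target ∩ φ.symm ⁻¹' z.source ∈ 𝓝 ξ₀ :=
    (isOpen_transition_domain φ z).mem_nhds ⟨hξ₀, mem_chart_source ℂ p⟩
  have hfs : ContDiffAt ℝ ∞ f ξ₀ := contDiffAt_transition hφ hzr hξ₀ (mem_chart_source ℂ p)
  have hLf : ContDiffAt ℝ 1 (fun ξ => L (f ξ)) ξ₀ := ContDiffAt.comp ξ₀ (by rwa [hfξ])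
    (hfs.of_le ENat.LEInfty.out)
  refine ⟨fun ξ => (L (f ξ)).comp (fderiv ℝ f ξ), hLf.clm_comp (hfs.fderiv_right (m := 1) (by norm_num; exact ENat.LEInfty.out)), ?_⟩
  have hLe : ∀ᶠ ξ in 𝓝 ξ₀, ContDiffAt ℝ 1 L (f ξ) :=
    hfs.continuousAt.eventually (hL.eventually (by simp))
  filter_upwards [hdom, hfs.continuousAt.eventually hev, hLe] with ξ hξ hξe hξL
  set y := φ.symm ξ with hy
  have hys : y ∈ φ.source := φ.map_target hξ.1
  have hyz : y ∈ z.source := hξ.2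
  have hφy : φ y = ξ := φ.right_inv hξ.1
  have hzt : z y ∈ z.target := z.map_source hyz
  have hfy : f ξ = z y := rfl
  have hsy : z.symm (f ξ) = y := z.left_inv hyz
  refine ⟨fun hc c => ?_, fun hc => ?_⟩
  · have h1 := hξe.1 (by rwa [hsy]) (fderiv ℝ f ξ c)
    have h2 := chartVec_eq hφ hzr hys hyz c
    rw [hφy] at h2
    rw [ContinuousLinearMap.comp_apply, ← h1, coordVec_eq_chartVec p _ (hfy ▸ hzt)]
    have key : ∀ (p q : X) (_ : p = q) (a : T p) (b : T q), (a : ℂ) = (b : ℂ) →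
        η p a = η q b := by
      rintro p _ rfl a _ rfl
      rfl
    exact key _ _ hsy.symm _ _ h2
  · have h1 := hξe.2 (by rwa [hsy])
    have h2 := chartCoeff_change hφ hη.twoForm hys hyz
    have hf2 : ContDiffAt ℝ ∞ f ξ := contDiffAt_transition hφ hzr hξ.1 hyz
    have hf2' : ContDiffAt ℝ 2 f ξ := hf2.of_le ENat.LEInfty.out
    have hsym := hf2'.isSymmSndFDerivAt (by simp)
    rw [hφy, chartCoeff_chartAt p _ hzt] at h2
    rw [h2]
    have hLd := hξL.differentiableAt (by simp)
    rw [fderiv_pullback hLd hf2', fderiv_pullback hLd hf2', hsym.eq 1 Complex.I, add_sub_add_right_eq_sub,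
      antisymm_plane, ← det_eq_im, ← h1]
    rfl

/-- The exterior derivative of `χ η`, where `ψ = dη`. -/
def cutoffForm (χ : X → ℝ) (η : ∀ x : X, T x →ₗ[ℝ] ℂ) (ψ : ∀ x : X, T x → T x → ℂ) (x : X)
    (v w : T x) : ℂ :=
  χ x * ψ x v w + (dReal (fun y => (χ y : ℂ)) x v * η x w - dReal (fun y => (χ y : ℂ)) x w * η x v)

theorem isTwoForm_cutoffForm (χ : X → ℝ) (hψ : IsTwoForm ψ) : IsTwoForm (cutoffForm χ η ψ) := by
  intro x p q v
  have key : ∀ (p : ℂ) (v : T x), p • v = p.re • v + p.im • (Complex.I • v) := by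
    intro p v
    let u : ℂ := v
    change p * u = p.re • u + p.im • (Complex.I * u)
    simp only [Complex.real_smul]
    conv_lhs => rw [← Complex.re_add_im p]
    ring
  have h1 : ∀ p : ℂ, η x (p • v) = p.re * η x v + p.im * η x (Complex.I • v) := fun p => by
    rw [key, map_add, map_smul, map_smul]
    simp only [Complex.real_smul]
  have h2 : ∀ p : ℂ, dReal (fun y => (χ y : ℂ)) x (p • v) = p.re * dReal (fun y => (χ y : ℂ)) x v
      + p.im * dReal (fun y => (χ y : ℂ)) x (Complex.I • v) := fun p => by
    rw [key]
    unfold dReal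
    have h3 := map_add (mfderiv 𝓘(ℝ, ℂ) 𝓘(ℝ, ℂ) (fun y => (χ y : ℂ)) x)
      (p.re • v) (p.im • (Complex.I • v))
    have h4 := fun (r : ℝ) (w : T x) =>
      map_smul (mfderiv 𝓘(ℝ, ℂ) 𝓘(ℝ, ℂ) (fun y => (χ y : ℂ)) x) r w
    refine h3.trans ?_
    rw [h4, h4]
    rfl
  unfold cutoffForm
  rw [hψ, h1 p, h1 q, h2 p, h2 q, Complex.mul_im, Complex.conj_re, Complex.conj_im]
  push_cast
  ring

theorem cutoffForm_eq_zero {χ : X → ℝ} {x : X} (h : ∀ᶠ y in 𝓝 x, χ y = 0) (v w : T x) :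
    cutoffForm χ η ψ x v w = 0 := by
  have h1 : (fun y => (χ y : ℂ)) =ᶠ[𝓝 x] fun _ => (0 : ℂ) := h.mono fun y hy => by simp [hy]
  have h2 : ∀ v : T x, dReal (fun y => (χ y : ℂ)) x v = 0 := fun v => by
    unfold dReal
    rw [h1.mfderiv_eq, mfderiv_const]
    rfl
  rw [cutoffForm, h2, h2, h.self_of_nhds]
  simp

theorem cutoffForm_eq_zero_of_notMem [T2Space X] (hUo : IsOpen U) {χ : X → ℝ} {K : Set X}
    (hKc : IsCompact K) (h0 : ∀ x ∈ closure U, x ∉ K → χ x = 0) {x : X} (hx : x ∈ U) (hxK : x ∉ K)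
    (v w : T x) : cutoffForm χ η ψ x v w = 0 := by
  refine cutoffForm_eq_zero ?_ _ _
  filter_upwards [hUo.mem_nhds hx, hKc.isClosed.isOpen_compl.mem_nhds hxK] with y h1 h2
  exact h0 y (subset_closure h1) h2

theorem IsBoundaryChart.symm_mem_iff (hφ : IsBoundaryChart U φ) {ξ : ℂ} (hξ : ξ ∈ φ.target) :
    φ.symm ξ ∈ U ↔ 0 < ξ.im := by
  rw [hφ.straight _ (φ.map_target hξ), φ.right_inv hξ]

/-- Points strictly below the real axis have a neighbourhood missing `U`; points on or above it are
limits of their upward translates. -/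
theorem IsBoundaryChart.symm_mem_closure_iff (hφ : IsBoundaryChart U φ) {ξ : ℂ}
    (hξ : ξ ∈ φ.target) : φ.symm ξ ∈ closure U ↔ 0 ≤ ξ.im := by
  constructor
  · intro h
    by_contra hlt
    push Not at hlt
    have hN : φ.source ∩ φ ⁻¹' {ζ : ℂ | ζ.im < 0} ∈ 𝓝 (φ.symm ξ) :=
      (φ.isOpen_inter_preimage (isOpen_lt Complex.continuous_im continuous_const)).mem_nhds
        ⟨φ.map_target hξ, by rwa [mem_preimage, φ.right_inv hξ]⟩
    obtain ⟨y, hy, hyU⟩ := mem_closure_iff_nhds.1 h _ hN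
    have h1 := (hφ.straight y hy.1).1 hyU
    have h2 : (φ y).im < 0 := hy.2
    linarith
  · intro h
    have hc : Filter.Tendsto (fun t : ℝ => ξ + t * Complex.I) (𝓝[>] 0) (𝓝 ξ) := by
      have : Continuous fun t : ℝ => ξ + t * Complex.I := by fun_prop
      have h1 := this.tendsto 0
      simp only [Complex.ofReal_zero, zero_mul, add_zero] at h1
      exact h1.mono_left nhdsWithin_le_nhds
    refine mem_closure_of_tendsto ((φ.continuousAt_symm hξ).tendsto.comp hc) ?_
    filter_upwards [hc.eventually (φ.open_target.mem_nhds hξ), self_mem_nhdsWithin] with t ht ht0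
    refine (hφ.symm_mem_iff ht).2 ?_
    have : 0 < t := ht0
    simp
    linarith

theorem contDiffAt_comp_symm {χ : X → ℝ} (hχ : ContMDiff 𝓘(ℝ, ℂ) 𝓘(ℝ, ℝ) ∞ χ)
    (hφ : φ ∈ IsManifold.maximalAtlas 𝓘(ℝ, ℂ) ∞ X) {ξ : ℂ} (hξ : ξ ∈ φ.target) :
    ContDiffAt ℝ ∞ (fun ξ => (χ (φ.symm ξ) : ℂ)) ξ := by
  have h1 : ContMDiffAt 𝓘(ℝ, ℂ) 𝓘(ℝ, ℝ) ∞ (fun ξ => χ (φ.symm ξ)) ξ :=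
    hχ.contMDiffAt.comp ξ ((contMDiffOn_symm_of_mem_maximalAtlas hφ).contMDiffAt
      (φ.open_target.mem_nhds hξ))
  exact Complex.ofRealCLM.contDiff.contDiffAt.comp ξ (contMDiffAt_iff_contDiffAt.1 h1)

/-- Stokes' theorem for `χ η`, where `χ` has compact support in a boundary chart. -/
theorem IsStokesPair.integral_boundaryChart [T2Space X] (hUo : IsOpen U) (hη : IsStokesPair U η ψ) (hφ : IsBoundaryChart U φ)
    {χ : X → ℝ} (hχ : ContMDiff 𝓘(ℝ, ℂ) 𝓘(ℝ, ℝ) ∞ χ) {K : Set X} (hKc : IsCompact K)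
    (hK : K ⊆ φ.source) (h0 : ∀ x ∈ closure U, x ∉ K → χ x = 0) :
    IntegrableOn (chartCoeff φ (cutoffForm χ η ψ)) (φ.target ∩ φ.symm ⁻¹' U) ∧
    ∫ ξ in φ.target ∩ φ.symm ⁻¹' U, chartCoeff φ (cutoffForm χ η ψ) ξ
      = ∫ t in {t : ℝ | (t : ℂ) ∈ φ.target}, (χ (φ.symm t) : ℂ) * η (φ.symm t) (chartVec φ t 1) := by
  set D := φ.target with hD
  set H : Set ℂ := {ξ : ℂ | 0 < ξ.im} with hH
  have hHo : IsOpen H := isOpen_lt continuous_const Complex.continuous_im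
  have hDU : D ∩ φ.symm ⁻¹' U = D ∩ H := by
    ext ξ
    exact and_congr_right fun hξ => hφ.symm_mem_iff hξ
  rw [hDU]
  set κ : ℂ → ℂ := chartCoeff φ (cutoffForm χ η ψ) with hκ
  set X' : ℂ → ℂ := fun ξ => (χ (φ.symm ξ) : ℂ) with hX'
  have hXs : ∀ ξ ∈ D, ContDiffAt ℝ ∞ X' ξ := fun ξ hξ => contDiffAt_comp_symm hχ hφ.smooth hξ
  have hXd : ∀ ξ ∈ D, DifferentiableAt ℝ X' ξ := fun ξ hξ => (hXs ξ hξ).differentiableAt (by simp)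
  set C : Set ℂ := φ '' K with hC
  have hCc : IsCompact C := hKc.image_of_continuousOn (φ.continuousOn.mono hK)
  have hCD : C ⊆ D := by
    rintro _ ⟨x, hx, rfl⟩
    exact φ.map_source (hK hx)
  have hXC : ∀ ξ ∈ D, 0 ≤ ξ.im → ξ ∉ C → X' ξ = 0 := by
    intro ξ hξ hξ0 hξC
    have : χ (φ.symm ξ) = 0 := h0 _ ((hφ.symm_mem_closure_iff hξ).2 hξ0)
      fun hk => hξC ⟨_, hk, φ.right_inv hξ⟩
    simp [hX', this]
  have hext := fun ξ (hξ : ξ ∈ D) (hξ0 : 0 ≤ ξ.im) =>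
    hη.chart_extension hφ.smooth hξ ((hφ.symm_mem_closure_iff hξ).2 hξ0)
  have hκe : ∀ {Λ : ℂ → ℂ →L[ℝ] ℂ} {ξ : ℂ}, ξ ∈ D →
      (∀ c, η (φ.symm ξ) (chartVec φ ξ c) = Λ ξ c) →
      (chartCoeff φ ψ ξ = fderiv ℝ Λ ξ 1 Complex.I - fderiv ℝ Λ ξ Complex.I 1) →
      κ ξ = X' ξ * (fderiv ℝ Λ ξ 1 Complex.I - fderiv ℝ Λ ξ Complex.I 1)
        + (fderiv ℝ X' ξ 1 * Λ ξ Complex.I - fderiv ℝ X' ξ Complex.I * Λ ξ 1) := by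
    intro Λ ξ hξ h1 h2
    have h3 : ∀ c, dReal (fun y => (χ y : ℂ)) (φ.symm ξ) (chartVec φ ξ c) = fderiv ℝ X' ξ c :=
      dReal_chartVec hφ.smooth hξ (hXd ξ hξ)
    have h4 : ψ (φ.symm ξ) (chartVec φ ξ 1) (chartVec φ ξ Complex.I)
      = fderiv ℝ Λ ξ 1 Complex.I - fderiv ℝ Λ ξ Complex.I 1 := h2
    simp only [hκ, chartCoeff, cutoffForm, h3, h1, h4, hX']
  -- Near each point of `C`, `κ` cut off to the half plane is either zero or the restriction of a
  -- continuous function built from a `C¹` extension of `η`. Compactness of `C` then gives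
  -- integrability.
  have hint : IntegrableOn κ (D ∩ H) := by
    have hloc : LocallyIntegrableOn ((D ∩ H).indicator κ) C := by
      intro ξ₀ hξ₀
      have hξD := hCD hξ₀
      refine IntegrableAtFilter.filter_mono nhdsWithin_le_nhds ?_
      rcases lt_or_ge ξ₀.im 0 with hneg | hpos
      · refine ⟨{ξ : ℂ | ξ.im < 0}, (isOpen_lt Complex.continuous_im
          continuous_const).mem_nhds hneg, ?_⟩
        refine integrableOn_zero.congr_fun (fun ξ hξ => (indicator_of_notMem ?_ _).symm)
          (isOpen_lt Complex.continuous_im continuous_const).measurableSet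
        intro h
        have h1 : 0 < ξ.im := h.2
        have h2 : ξ.im < 0 := hξ
        linarith
      · obtain ⟨Λ, hΛ, hev⟩ := hext ξ₀ hξD hpos
        obtain ⟨N, hN, hNo, hξN⟩ := eventually_nhds_iff.1
          ((hev.and (hΛ.eventually (by simp))).and (φ.open_target.mem_nhds hξD))
        set k' : ℂ → ℂ := fun ξ => X' ξ * (fderiv ℝ Λ ξ 1 Complex.I - fderiv ℝ Λ ξ Complex.I 1)
          + (fderiv ℝ X' ξ 1 * Λ ξ Complex.I - fderiv ℝ X' ξ Complex.I * Λ ξ 1) with hk'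
        have hk'c : ContinuousOn k' N := by
          intro ξ hξ
          have c1 : ContinuousAt X' ξ := (hXd ξ (hN ξ hξ).2).continuousAt
          have c2 : ContinuousAt (fderiv ℝ X') ξ :=
            ((hXs ξ (hN ξ hξ).2).fderiv_right (m := 0) (by simp)).continuousAt
          have c3 : ContinuousAt Λ ξ := (hN ξ hξ).1.2.continuousAt
          have c4 : ContinuousAt (fderiv ℝ Λ) ξ :=
            ((hN ξ hξ).1.2.fderiv_right (m := 0) (by simp)).continuousAt
          refine ContinuousAt.continuousWithinAt ?_
          have d2 := fun c : ℂ => c2.clm_apply (continuousAt_const (y := c))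
          have d3 := fun c : ℂ => c3.clm_apply (continuousAt_const (y := c))
          have d4 := fun a c : ℂ => (c4.clm_apply (continuousAt_const (y := a))).clm_apply
            (continuousAt_const (y := c))
          exact (c1.mul ((d4 _ _).sub (d4 _ _))).add (((d2 _).mul (d3 _)).sub ((d2 _).mul (d3 _)))
        have h1 := hk'c.integrableAt_nhdsWithin (μ := volume) hNo.measurableSet hξN
        rw [hNo.nhdsWithin_eq hξN] at h1
        obtain ⟨N', hN', hint'⟩ := h1
        obtain ⟨N'', hN'', hNo'', hξN''⟩ := mem_nhds_iff.1 (Filter.inter_mem hN' (hNo.mem_nhds hξN))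
        refine ⟨N'', hNo''.mem_nhds hξN'', ?_⟩
        have h2 : IntegrableOn ((D ∩ H).indicator k') N'' :=
          (hint'.mono_set fun ξ hξ => (hN'' hξ).1).indicator
            (φ.open_target.inter hHo).measurableSet
        refine h2.congr_fun (fun ξ hξ => ?_) hNo''.measurableSet
        by_cases hm : ξ ∈ D ∩ H
        · have hU := (hφ.symm_mem_iff hm.1).2 hm.2
          have h3 := (hN ξ (hN'' hξ).2).1.1
          rw [indicator_of_mem hm, indicator_of_mem hm,
            hκe hm.1 (h3.1 (subset_closure hU)) (h3.2 hU)]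
        · rw [indicator_of_notMem hm, indicator_of_notMem hm]
    have h1 := hloc.integrableOn_isCompact hCc
    have hm := (φ.open_target.inter hHo).measurableSet
    rw [integrableOn_indicator_iff hm] at h1
    refine h1.of_forall_sdiff_eq_zero hm fun ξ hξ => ?_
    have hξC : ξ ∉ C := fun h => hξ.2 ⟨hξ.1, h⟩
    exact cutoffForm_eq_zero_of_notMem hUo hKc h0 ((hφ.symm_mem_iff hξ.1.1).2 hξ.1.2)
      (fun hk => hξC ⟨_, hk, φ.right_inv hξ.1.1⟩) _ _
  refine ⟨hint, ?_⟩
  -- `P dx + Q dy` is the form `χ η` in the chart, and its curl is the coefficient of the cutoff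
  -- form.
  set P : ℂ → ℂ := fun ξ => X' ξ * η (φ.symm ξ) (chartVec φ ξ 1) with hP
  set Q : ℂ → ℂ := fun ξ => X' ξ * η (φ.symm ξ) (chartVec φ ξ Complex.I) with hQ
  have hcont : ∀ c : ℂ, ContinuousOn (fun ξ => X' ξ * η (φ.symm ξ) (chartVec φ ξ c))
      (D ∩ {ξ : ℂ | 0 ≤ ξ.im}) := by
    intro c ξ hξ
    obtain ⟨Λ, hΛ, hev⟩ := hext ξ hξ.1 hξ.2
    have c1 : ContinuousAt (fun ξ => X' ξ * Λ ξ c) ξ :=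
      (hXd ξ hξ.1).continuousAt.mul (hΛ.continuousAt.clm_apply continuousAt_const)
    refine c1.continuousWithinAt.congr_of_eventuallyEq_of_mem ?_ hξ
    filter_upwards [mem_nhdsWithin_of_mem_nhds hev, self_mem_nhdsWithin] with ζ h1 h2
    rw [h1.1 ((hφ.symm_mem_closure_iff h2.1).2 h2.2)]
  have hder : ∀ ξ ∈ D, 0 < ξ.im → ∃ Λ : ℂ → ℂ →L[ℝ] ℂ,
      (∀ c, HasFDerivAt (fun ξ => X' ξ * η (φ.symm ξ) (chartVec φ ξ c))
        (X' ξ • (fderiv ℝ Λ ξ).flip c + Λ ξ c • fderiv ℝ X' ξ) ξ) ∧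
      (∀ c, η (φ.symm ξ) (chartVec φ ξ c) = Λ ξ c) ∧
      (chartCoeff φ ψ ξ = fderiv ℝ Λ ξ 1 Complex.I - fderiv ℝ Λ ξ Complex.I 1) := by
    intro ξ hξ hξ0
    obtain ⟨Λ, hΛ, hev⟩ := hext ξ hξ hξ0.le
    have hself := hev.self_of_nhds
    have hU := (hφ.symm_mem_iff hξ).2 hξ0
    refine ⟨Λ, fun c => ?_, hself.1 (subset_closure hU), hself.2 hU⟩
    have hΛd : HasFDerivAt (fun ξ => Λ ξ c) ((fderiv ℝ Λ ξ).flip c) ξ := by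
      have := (hΛ.differentiableAt (by simp)).hasFDerivAt.clm_apply (hasFDerivAt_const c ξ)
      simpa using this
    refine ((hXd ξ hξ).hasFDerivAt.mul hΛd).congr_of_eventuallyEq ?_
    filter_upwards [hev, φ.open_target.mem_nhds hξ, hHo.mem_nhds hξ0] with ζ h1 h2 h3
    rw [h1.1 ((hφ.symm_mem_closure_iff h2).2 (le_of_lt h3))]
    rfl
  refine integral_curl_of_compact (P := P) (Q := Q) φ.open_target hCc hCD (hcont 1)
    (hcont Complex.I) (fun ξ hξ hξ0 => ?_) (fun ξ hξ hξ0 => ?_) (fun ξ hξ hξ0 hξC => ?_)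
    (fun ξ hξ hξ0 => ?_) hint
  · obtain ⟨Λ, h1, -⟩ := hder ξ hξ hξ0
    exact (h1 1).differentiableAt
  · obtain ⟨Λ, h1, -⟩ := hder ξ hξ hξ0
    exact (h1 Complex.I).differentiableAt
  · simp only [hP, hQ, hXC ξ hξ hξ0 hξC, zero_mul, and_self]
  · obtain ⟨Λ, h1, h2, h3⟩ := hder ξ hξ hξ0
    rw [(h1 1).fderiv, (h1 Complex.I).fderiv, hκe hξ h2 h3]
    simp only [add_apply, smul_apply, ContinuousLinearMap.flip_apply, smul_eq_mul]
    ring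

end ChartStokes

end HiggsSurface

namespace HiggsSurface

/-! ### Stokes' theorem on a domain with smooth boundary -/

section Stokes

variable {X : Type*} [TopologicalSpace X] [ChartedSpace ℂ X] [IsManifold 𝓘(ℂ, ℂ) ω X]

/-- A ball around an interior point is translated into the upper half plane, so interior and
frontier points can be treated by the same charts. -/
theorem exists_boundaryChart_of_mem {U : Set X} (hUo : IsOpen U) {p : X} (hp : p ∈ U) :
    ∃ φ : OpenPartialHomeomorph X ℂ, p ∈ φ.source ∧ IsBoundaryChart U φ := by
  set z := chartAt ℂ p with hz
  have hzp := mem_chart_source ℂ p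
  obtain ⟨r, hr, hrN⟩ := Metric.isOpen_iff.1 (z.symm.isOpen_inter_preimage hUo) (z p)
    ⟨z.map_source hzp, by
      change z.symm (z p) ∈ U
      rwa [z.left_inv hzp]⟩
  -- This shift puts the ball of radius `r` at heights strictly between 0 and `2r`.
  set s : ℂ := ((r - (z p).im : ℝ) : ℂ) * Complex.I with hs
  set B : Set X := z.source ∩ z ⁻¹' Metric.ball (z p) r with hB
  have hBo : IsOpen B := z.isOpen_inter_preimage Metric.isOpen_ball
  set φ : OpenPartialHomeomorph X ℂ := (z.restrOpen B hBo).transHomeomorph (Homeomorph.addRight s)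
    with hφ
  have hsrc : ∀ x ∈ φ.source, x ∈ z.source ∧ z x ∈ Metric.ball (z p) r := fun x hx => hx.2
  have hval : ∀ x, φ x = z x + s := fun x => rfl
  have hsymm : ∀ ξ, φ.symm ξ = z.symm (ξ + -s) := fun x => rfl
  have htgt : ∀ ξ ∈ φ.target, ξ + -s ∈ z.target := by
    intro ξ hξ
    have h1 := hsrc _ (φ.map_target hξ)
    have h2 : z (φ.symm ξ) + s = ξ := φ.right_inv hξ
    rw [← h2, add_neg_cancel_right]
    exact z.map_source h1.1
  have hzr := chartAt_mem_realAtlas p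
  have hsm : φ ∈ IsManifold.maximalAtlas 𝓘(ℝ, ℂ) ∞ X := by
    refine φ.mem_maximalAtlas_of_contMDiffOn ?_ ?_
    · have h1 : ContMDiff 𝓘(ℝ, ℂ) 𝓘(ℝ, ℂ) ∞ fun ζ : ℂ => ζ + s :=
        (contDiff_id.add contDiff_const).contMDiff
      exact h1.comp_contMDiffOn ((contMDiffOn_of_mem_maximalAtlas hzr).mono fun x hx => (hsrc x hx).1)
    · have h1 : ContMDiff 𝓘(ℝ, ℂ) 𝓘(ℝ, ℂ) ∞ fun ζ : ℂ => ζ + -s :=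
        (contDiff_id.add contDiff_const).contMDiff
      exact (contMDiffOn_symm_of_mem_maximalAtlas hzr).comp h1.contMDiffOn htgt
  refine ⟨φ, ⟨hzp, hzp, Metric.mem_ball_self hr⟩, hsm, fun x hx => ?_, fun x hx => ?_⟩
  · rw [mfderiv_chart_eq hsm hx]
    have h1 : (φ ∘ (chartAt ℂ x).symm) = fun ζ => (z ∘ (chartAt ℂ x).symm) ζ + s := rfl
    rw [h1, fderiv_add_const]
    exact fderiv_chart_transition_det_pos (hsrc x hx).1
  · have h1 := hsrc x hx
    have h2 : z.symm (z x) ∈ U := (hrN h1.2).2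
    rw [z.left_inv h1.1] at h2
    refine ⟨fun _ => ?_, fun _ => h2⟩
    rw [hval, hs]
    have h3 : |(z x - z p).im| < r := lt_of_le_of_lt (Complex.abs_im_le_norm _)
      (by rw [← dist_eq_norm]; exact h1.2)
    have h4 := (abs_lt.1 h3).1
    simp at h4 ⊢
    linarith

/-- Cutoffs that sum to 1 near `x` have differentials summing to zero; this removes the `dχ ∧ η`
terms after summation. -/
theorem sum_dReal_eq_zero {ι : Type*} {J : Finset ι} {χ : ι → X → ℝ}
    (hχ : ∀ j, ContMDiff 𝓘(ℝ, ℂ) 𝓘(ℝ, ℝ) ∞ (χ j)) {x : X} (h : ∀ᶠ y in 𝓝 x, ∑ j ∈ J, χ j y = 1)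
    (v : T x) : ∑ j ∈ J, dReal (fun y => (χ j y : ℂ)) x v = 0 := by
  have hx := mem_chart_source ℂ x
  have hd : ∀ j, DifferentiableAt ℝ ((fun y => (χ j y : ℂ)) ∘ (chartAt ℂ x).symm) (chartAt ℂ x x) :=
    fun j => (contDiffAt_comp_symm (hχ j) (chartAt_mem_realAtlas x)
      ((chartAt ℂ x).map_source hx)).differentiableAt (by simp)
  simp only [dReal_eq_fderiv (hd _)]
  have h1 := fderiv_fun_sum (u := J) fun j _ => hd j
  have hx' : (chartAt ℂ x).symm (chartAt ℂ x x) = x := (chartAt ℂ x).left_inv hx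
  have hc : ContinuousAt (chartAt ℂ x).symm (chartAt ℂ x x) :=
    (chartAt ℂ x).continuousAt_symm ((chartAt ℂ x).map_source hx)
  have h2 : (fun ζ => ∑ j ∈ J, ((fun y => (χ j y : ℂ)) ∘ (chartAt ℂ x).symm) ζ)
      =ᶠ[𝓝 (chartAt ℂ x x)] fun _ => 1 := by
    rw [← hx'] at h
    filter_upwards [hc.eventually h] with ζ hζ
    simp only [Function.comp_apply]
    exact_mod_cast congrArg (fun r : ℝ => (r : ℂ)) hζ
  rw [h2.fderiv_eq, fderiv_fun_const] at h1
  let u : ℂ := v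
  have h3 := DFunLike.congr_fun h1 u
  simp only [sum_apply] at h3
  exact h3.symm

variable [T2Space X] [SigmaCompactSpace X] {U : Set X} {η : ∀ x : X, T x →ₗ[ℝ] ℂ}
  {ψ : ∀ x : X, T x → T x → ℂ}

theorem isBoundaryChart_boundaryChart (hU : HasSmoothBoundary U) (p : frontier U) :
    IsBoundaryChart U (boundaryChart hU p) :=
  (hU p p.2).choose_spec.2

theorem boundaryPartition_subordinate (hU : HasSmoothBoundary U) (p : frontier U) :
    tsupport (boundaryPartition hU p) ⊆ (boundaryChart hU p).source :=
  (exists_boundaryPartition hU).choose_spec p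

/-- The boundary integral is defined by one particular partition, which sums to 1 only on the
frontier. It is completed to a partition on `closure U` by functions vanishing on the frontier.
Stokes in each chart then reproduces exactly the defining terms of the boundary integral. -/
theorem IsStokesPair.surfaceIntegral_eq_boundaryIntegral (hη : IsStokesPair U η ψ) (hUo : IsOpen U)
    (hUc : IsCompact (closure U)) (hU : HasSmoothBoundary U) :
    surfaceIntegral U ψ = boundaryIntegral hU fun x v => η x v := by
  have hex : ∀ q : closure U, ∃ φ : OpenPartialHomeomorph X ℂ, (q : X) ∈ φ.source ∧
      IsBoundaryChart U φ := fun q => by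
    by_cases hq : (q : X) ∈ U
    · exact exists_boundaryChart_of_mem hUo hq
    · exact hU q ⟨q.2, by rwa [hUo.interior_eq]⟩
  choose Φ hΦq hΦ using hex
  obtain ⟨ρ, hρ⟩ := SmoothPartitionOfUnity.exists_isSubordinate 𝓘(ℝ, ℂ) (isClosed_closure (s := U))
    (fun q : closure U => (Φ q).source) (fun q => (Φ q).open_source)
    fun q hq => mem_iUnion_of_mem ⟨q, hq⟩ (hΦq ⟨q, hq⟩)
  set f := boundaryPartition hU with hf
  have hAfin := f.locallyFinite.finite_nonempty_inter_compact hUc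
  have hBfin := ρ.locallyFinite.finite_nonempty_inter_compact hUc
  set A := hAfin.toFinset with hA
  set B := hBfin.toFinset with hB
  have hfA : ∀ x ∈ closure U, ∀ p ∉ A, f p x = 0 := fun x hx p hp =>
    by_contra fun h => hp (hAfin.mem_toFinset.2 ⟨x, h, hx⟩)
  have hρB : ∀ x ∈ closure U, ∀ q ∉ B, ρ q x = 0 := fun x hx q hq =>
    by_contra fun h => hq (hBfin.mem_toFinset.2 ⟨x, h, hx⟩)
  have hsumf : ∀ x ∈ frontier U, ∑ p ∈ A, f p x = 1 := fun x hx => by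
    rw [← f.sum_eq_one hx]
    exact (finsum_eq_sum_of_support_subset _ fun p hp =>
      by_contra fun h => hp (hfA x (frontier_subset_closure hx) p h)).symm
  have hsumρ : ∀ x ∈ closure U, ∑ q ∈ B, ρ q x = 1 := fun x hx => by
    rw [← ρ.sum_eq_one hx]
    exact (finsum_eq_sum_of_support_subset _ fun q hq =>
      by_contra fun h => hq (hρB x hx q h)).symm
  -- The second family distributes the remainder `1 - ∑ f p` by a partition `ρ` of `closure U`. This
  -- remainder is zero on the frontier.
  let χ : frontier U ⊕ closure U → X → ℝ :=
    Sum.elim (fun p => f p) fun q x => ρ q x * (1 - ∑ p ∈ A, f p x)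
  let φ : frontier U ⊕ closure U → OpenPartialHomeomorph X ℂ := Sum.elim (boundaryChart hU) Φ
  let K : frontier U ⊕ closure U → Set X := Sum.elim (fun p => tsupport (f p) ∩ closure U)
    fun q => tsupport (ρ q) ∩ closure U
  have hχs : ∀ j, ContMDiff 𝓘(ℝ, ℂ) 𝓘(ℝ, ℝ) ∞ (χ j) := by
    rintro (p | q)
    · exact (f p).contMDiff
    · exact (ρ q).contMDiff.mul (contMDiff_const.sub (contMDiff_finsetSum fun p _ => (f p).contMDiff))
  have hφb : ∀ j, IsBoundaryChart U (φ j) := by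
    rintro (p | q)
    · exact isBoundaryChart_boundaryChart hU p
    · exact hΦ q
  have hKc : ∀ j, IsCompact (K j) := by
    rintro (p | q)
    · exact hUc.inter_left (isClosed_tsupport _)
    · exact hUc.inter_left (isClosed_tsupport _)
  have hK : ∀ j, K j ⊆ (φ j).source := by
    rintro (p | q)
    · exact inter_subset_left.trans (boundaryPartition_subordinate hU p)
    · exact inter_subset_left.trans (hρ q)
  have h0 : ∀ j, ∀ x ∈ closure U, x ∉ K j → χ j x = 0 := by
    rintro (p | q) x hx hxK
    · exact image_eq_zero_of_notMem_tsupport fun h => hxK ⟨h, hx⟩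
    · have : ρ q x = 0 := image_eq_zero_of_notMem_tsupport fun h => hxK ⟨h, hx⟩
      simp [χ, this]
  set J := A.disjSum B with hJ
  have hχ1 : ∀ x ∈ closure U, ∑ j ∈ J, χ j x = 1 := by
    intro x hx
    rw [hJ, Finset.sum_disjSum]
    simp only [χ, Sum.elim_inl, Sum.elim_inr]
    rw [← Finset.sum_mul, hsumρ x hx]
    ring
  have hst := fun j => hη.integral_boundaryChart hUo (hφb j) (hχs j) (hKc j) (hK j) (h0 j)
  rw [surfaceIntegral_eq_sum J φ K (fun j => cutoffForm (χ j) η ψ)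
    (fun j _ => ⟨(hφb j).smooth, (hφb j).oriented⟩)
    (fun j _ => isTwoForm_cutoffForm _ hη.twoForm) hUo (fun j _ => hK j) (fun j _ => hKc j)
    (fun j _ x hx hxK => cutoffForm_eq_zero_of_notMem hUo (hKc j) (h0 j) hx hxK)
    (fun j _ => (hst j).1) ?_, Finset.sum_congr rfl fun j _ => (hst j).2, hJ, Finset.sum_disjSum]
  -- Real points of a boundary chart lie on the frontier, where the remainder vanishes.
  · have hz : ∀ q ∈ B, ∫ t in {t : ℝ | (t : ℂ) ∈ (φ (Sum.inr q)).target},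
        (χ (Sum.inr q) ((φ (Sum.inr q)).symm t) : ℂ)
          * η ((φ (Sum.inr q)).symm t) (chartVec (φ (Sum.inr q)) t 1) = 0 := by
      intro q _
      refine setIntegral_eq_zero_of_forall_eq_zero fun t ht => ?_
      have hfr : (φ (Sum.inr q)).symm t ∈ frontier U := by
        refine ⟨((hφb (Sum.inr q)).symm_mem_closure_iff ht).2 (by simp), ?_⟩
        rw [hUo.interior_eq, (hφb (Sum.inr q)).symm_mem_iff ht]
        simp
      simp [χ, hsumf _ hfr]
    rw [Finset.sum_eq_zero hz, add_zero, boundaryIntegral]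
    have hm : ∀ p, MeasurableSet {t : ℝ | (t : ℂ) ∈ (boundaryChart hU p).target} := fun p =>
      ((boundaryChart hU p).open_target.preimage Complex.continuous_ofReal).measurableSet
    rw [finsum_eq_sum_of_support_subset (s := A) _ fun p hp => ?_]
    · refine Finset.sum_congr rfl fun p _ => setIntegral_congr_fun (hm p) fun t ht => ?_
      have h1 := mfderiv_symm_eq_chartVec (isBoundaryChart_boundaryChart hU p).smooth ht 1
      exact congrArg (fun w : T ((boundaryChart hU p).symm t) =>
        (f p ((boundaryChart hU p).symm t) : ℂ) * η _ w) h1.symm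
    · refine by_contra fun hpA => hp ?_
      refine setIntegral_eq_zero_of_forall_eq_zero fun t ht => ?_
      rw [hfA _ (((isBoundaryChart_boundaryChart hU p).symm_mem_closure_iff ht).2 (by simp)) p hpA]
      simp
  · intro x hx v w
    have hev : ∀ᶠ y in 𝓝 x, ∑ j ∈ J, χ j y = 1 := by
      filter_upwards [hUo.mem_nhds hx] with y hy using hχ1 y (subset_closure hy)
    have h1 : ∑ j ∈ J, (χ j x : ℂ) = 1 := by
      exact_mod_cast congrArg (fun r : ℝ => (r : ℂ)) (hχ1 x (subset_closure hx))
    simp only [cutoffForm, Finset.sum_add_distrib, Finset.sum_sub_distrib, ← Finset.sum_mul, h1,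
      sum_dReal_eq_zero hχs hev]
    ring

end Stokes

end HiggsSurface

namespace HiggsSurface

/-! ### The boundary form of a primitive -/

section BoundaryForm

/-! ### Linearity of the parts of type `(1,0)` and `(0,1)` -/

section Parts

variable {V W : Type*} [AddCommGroup V] [Module ℂ V] [AddCommGroup W] [Module ℂ W]

/-- Composing with `c ↦ c • v` reduces to a real-linear map on `ℂ`. -/
theorem part10_smul (L : V →ₗ[ℝ] W) (p : ℂ) (v : V) : part10 L (p • v) = p • part10 L v := by
  have h := part10_realLinear
    (L ∘ₗ (LinearMap.toSpanSingleton ℂ V v).restrictScalars ℝ) p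
  simpa [part10, mul_smul] using h

theorem part01_smul (L : V →ₗ[ℝ] W) (p : ℂ) (v : V) : part01 L (p • v) = conj p • part01 L v := by
  have h := part01_realLinear
    (L ∘ₗ (LinearMap.toSpanSingleton ℂ V v).restrictScalars ℝ) p
  simpa [part01, mul_smul] using h

theorem part10_add (L : V →ₗ[ℝ] W) (v w : V) : part10 L (v + w) = part10 L v + part10 L w := by
  simp only [part10, smul_add, map_add]
  module

theorem part01_add (L : V →ₗ[ℝ] W) (v w : V) : part01 L (v + w) = part01 L v + part01 L w := by
  simp only [part01, smul_add, map_add]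
  module

end Parts

variable {X : Type*} [TopologicalSpace X] [ChartedSpace ℂ X] [IsManifold 𝓘(ℂ, ℂ) ω X]
  {F : Type*} [NormedAddCommGroup F] [NormedSpace ℂ F] [FiniteDimensional ℂ F]
  {E : X → Type*} [∀ x, AddCommGroup (E x)] [∀ x, Module ℂ (E x)]
  [TopologicalSpace (TotalSpace F E)] [∀ x, TopologicalSpace (E x)]
  [FiberBundle F E] [VectorBundle ℂ F E] [ContMDiffVectorBundle ω F E 𝓘(ℂ, ℂ)]

/-- The 1-form `h (σ, τ^{1,0}) - h (σ, τ^{0,1})`. -/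
def boundaryForm (h : HermitianMetric F E) (σ : ∀ x, E x) (τ : ∀ x : X, T x →ₗ[ℝ] E x) (x : X) :
    T x →ₗ[ℝ] ℂ where
  toFun v := h.inner x (σ x) (part10 (τ x) v) - h.inner x (σ x) (part01 (τ x) v)
  map_add' v w := by
    rw [part10_add, part01_add, map_add, map_add]
    ring
  map_smul' r v := by
    rw [← Complex.coe_smul, part10_smul, part01_smul, map_smulₛₗ, map_smulₛₗ, RingHom.id_apply]
    simp
    ring

/-- The 2-form `h (τ₁^{1,0}, τ₂^{1,0}) - h (τ₁^{0,1}, τ₂^{0,1})`. -/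
def pairingForm (h : HermitianMetric F E) (τ₁ τ₂ : ∀ x : X, T x →ₗ[ℝ] E x) (x : X) (v w : T x) : ℂ :=
  h.wedge (fun y => part10 (τ₁ y)) (fun y => part10 (τ₂ y)) x v w
    - h.wedge (fun y => part01 (τ₁ y)) (fun y => part01 (τ₂ y)) x v w

theorem isTwoForm_pairingForm (h : HermitianMetric F E) (τ₁ τ₂ : ∀ x : X, T x →ₗ[ℝ] E x) :
    IsTwoForm (pairingForm h τ₁ τ₂) := by
  intro x p q v
  simp only [pairingForm, HermitianMetric.wedge, part10_smul, part01_smul, map_smulₛₗ,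
    LinearMap.smul_apply, smul_eq_mul, Complex.conj_conj, RingHom.id_apply, Complex.conj_I,
    map_neg]
  have h1 : ((conj p * q).im : ℂ) = (p * conj q - conj p * q) / (-2 * Complex.I) := by
    rw [eq_div_iff (by simp)]
    apply Complex.ext
    · simp
    · simp
      ring
  rw [h1]
  have hI : Complex.I ≠ 0 := Complex.I_ne_zero
  field_simp
  ring

theorem coord_part10 (τ : ∀ x : X, T x →ₗ[ℝ] E x) (x₀ : X) (ζ c : ℂ) :
    coord F E x₀ ((chartAt ℂ x₀).symm ζ) (part10 (τ _) (coordVec x₀ c _)) = c • locLeft F x₀ τ ζ := by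
  unfold part10
  rw [← coordVec_mul, map_smul, map_sub, map_smul, coord_form, coord_form, map_mul, Complex.conj_I]
  match_scalars <;> ring_nf <;> simp only [Complex.I_sq] <;> ring

theorem coord_part01 (τ : ∀ x : X, T x →ₗ[ℝ] E x) (x₀ : X) (ζ c : ℂ) :
    coord F E x₀ ((chartAt ℂ x₀).symm ζ) (part01 (τ _) (coordVec x₀ c _))
      = conj c • locRight F x₀ τ ζ := by
  unfold part01
  rw [← coordVec_mul, map_smul, map_add, map_smul, coord_form, coord_form, map_mul, Complex.conj_I]
  match_scalars <;> ring_nf <;> simp only [Complex.I_sq] <;> ring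

theorem boundaryForm_coordVec (h : HermitianMetric F E) {x₀ : X} {ζ : ℂ} (hζ : ζ ∈ locDom F E x₀)
    (σ : ∀ x, E x) (τ : ∀ x : X, T x →ₗ[ℝ] E x) (c : ℂ) :
    boundaryForm h σ τ _ (coordVec x₀ c ((chartAt ℂ x₀).symm ζ))
      = covec (-locForm h x₀ ζ (loc F x₀ σ ζ) (locRight F x₀ τ ζ))
        (locForm h x₀ ζ (loc F x₀ σ ζ) (locLeft F x₀ τ ζ)) c := by
  change h.inner _ _ _ - h.inner _ _ _ = _
  have h1 : loc F x₀ σ ζ = coord F E x₀ _ (σ ((chartAt ℂ x₀).symm ζ)) := rfl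
  rw [inner_eq_locForm h hζ, inner_eq_locForm h hζ, coord_part10, coord_part01, ← h1, map_smulₛₗ,
    map_smulₛₗ, covec_apply]
  simp only [smul_eq_mul, Complex.conj_conj]
  ring

theorem pairingForm_coordVec (h : HermitianMetric F E) {x₀ : X} {ζ : ℂ} (hζ : ζ ∈ locDom F E x₀)
    (τ₁ τ₂ : ∀ x : X, T x →ₗ[ℝ] E x) :
    pairingForm h τ₁ τ₂ ((chartAt ℂ x₀).symm ζ) (coordVec x₀ 1 _) (coordVec x₀ Complex.I _)
      = -2 * Complex.I * (locForm h x₀ ζ (locLeft F x₀ τ₁ ζ) (locLeft F x₀ τ₂ ζ)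
        + locForm h x₀ ζ (locRight F x₀ τ₁ ζ) (locRight F x₀ τ₂ ζ)) := by
  simp only [pairingForm, HermitianMetric.wedge, inner_eq_locForm h hζ, coord_part10, coord_part01,
    map_smulₛₗ, LinearMap.smul_apply, smul_eq_mul, RingHom.id_apply,
    Complex.conj_I, map_one, map_neg]
  ring

variable {g : ConformalMetric X} {θ : HiggsField F E} {h : HermitianMetric F E}
  {τ₁ τ₂ : ∀ x : X, T x →ₗ[ℝ] E x} {U : Set X} [T2Space X] [SigmaCompactSpace X]

/-- `d (h (σ, τ₂^{1,0}) - h (σ, τ₂^{0,1})) = h (τ₁^{1,0}, τ₂^{1,0}) - h (τ₁^{0,1}, τ₂^{0,1})` if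
`τ₁` is the image of `σ` under the flat connection. -/
theorem isStokesPair_boundaryForm (hh : IsHarmonicMetric θ h) (hτ₂ : IsHarmonicForm g θ h τ₂)
    {σ₁ : ∀ x, E x} (hσ₁ : ∀ p ∈ closure U, ∃ (W : Set X) (σ' : ∀ x, E x),
      IsOpen W ∧ p ∈ W ∧ IsPrimitiveOn θ h W τ₁ σ' ∧ ∀ y ∈ W ∩ closure U, σ₁ y = σ' y) :
    IsStokesPair U (boundaryForm h σ₁ τ₂) (pairingForm h τ₁ τ₂) where
  twoForm := isTwoForm_pairingForm h τ₁ τ₂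
  extension p hp := by
    obtain ⟨W, σ, hW, hpW, hσ, heq⟩ := hσ₁ p hp
    have M := localHiggs θ h hh p
    have hP := hτ₂.isHarmonicPair hh p
    set Ω : Set ℂ := locDom F E p ∩ ((chartAt ℂ p).target ∩ (chartAt ℂ p).symm ⁻¹' W) with hΩ
    have hΩo : IsOpen Ω := (isOpen_locDom F E p).inter ((chartAt ℂ p).symm.isOpen_inter_preimage hW)
    have hpΩ : chartAt ℂ p p ∈ Ω := ⟨chart_mem_locDom F E p,
      (chartAt ℂ p).map_source (mem_chart_source ℂ p), by
        rwa [mem_preimage, (chartAt ℂ p).left_inv (mem_chart_source ℂ p)]⟩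
    have hs : ContDiffOn ℝ ∞ (loc F p σ) Ω := fun ζ hζ =>
      (hσ.1.contDiffAt_loc hW hζ.1 hζ.2.2).contDiffWithinAt
    have hform : ∀ {q : ℂ → F}, ContDiffOn ℝ ∞ q (locDom F E p) →
        ContDiffOn ℝ ∞ (fun ζ => locForm h p ζ (loc F p σ ζ) (q ζ)) Ω := fun hq =>
      contDiffOn_form (fun u a => (M.smooth u a).mono inter_subset_left) hs
        (hq.mono inter_subset_left)
    have hA := hform hP.smooth_left
    have hB := hform hP.smooth_right
    refine ⟨fun ζ => covec (-locForm h p ζ (loc F p σ ζ) (locRight F p τ₂ ζ))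
      (locForm h p ζ (loc F p σ ζ) (locLeft F p τ₂ ζ)),
      ((contDiffOn_covec hB.neg hA).contDiffAt (hΩo.mem_nhds hpΩ)).of_le ENat.LEInfty.out, ?_⟩
    filter_upwards [hΩo.mem_nhds hpΩ] with ζ hζ
    refine ⟨fun hc c => ?_, fun _ => ?_⟩
    · have h1 : loc F p σ₁ ζ = loc F p σ ζ := by
        unfold loc
        rw [heq _ ⟨hζ.2.2, hc⟩]
      rw [boundaryForm_coordVec h hζ.1, h1]
    · rw [fderiv_covec_sub hΩo hζ hB.neg hA, pairingForm_coordVec h hζ.1]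
      have hd := hσ.hasFDerivAt_loc hW hζ.1 hζ.2.2
      have hn := M.isOpen.mem_nhds hζ.1
      have hαd := (hP.smooth_left.contDiffAt hn).differentiableAt (by simp)
      have hβd := (hP.smooth_right.contDiffAt hn).differentiableAt (by simp)
      -- The `dz` and `dz̄` components of `𝔻^1 σ = τ₁` replace the derivatives of `σ`.
      have e1 : dz (loc F p σ) ζ = locLeft F p τ₁ ζ - (locConn h p ζ (loc F p σ ζ)
          + locHiggs θ p ζ (loc F p σ ζ)) := by
        unfold dz
        rw [hd.fderiv]
        simp only [sub_apply, covec_apply, connForm_apply, map_one, Complex.conj_I]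
        match_scalars <;> ring_nf <;> simp only [Complex.I_sq] <;> ring
      have e2 : dzb (loc F p σ) ζ = locRight F p τ₁ ζ - locAdj θ h p ζ (loc F p σ ζ) := by
        unfold dzb
        rw [hd.fderiv]
        simp only [sub_apply, covec_apply, connForm_apply, map_one, Complex.conj_I]
        match_scalars <;> ring_nf <;> simp only [Complex.I_sq] <;> ring
      have e3 := M.dz_form hζ.1 hd.differentiableAt hαd
      have e4 := M.dzb_form hζ.1 hd.differentiableAt hβd
      rw [hP.closed ζ hζ.1, e1] at e3
      rw [hP.coclosed ζ hζ.1, e2] at e4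
      have e5 : dzb (fun ζ => -locForm h p ζ (loc F p σ ζ) (locRight F p τ₂ ζ)) ζ
          = -dzb (fun ζ => locForm h p ζ (loc F p σ ζ) (locRight F p τ₂ ζ)) ζ := by
        unfold dzb
        rw [fderiv_fun_neg]
        simp only [neg_apply, smul_neg]
        module
      rw [e5, e3, e4]
      -- Adjointness pairs `H(Θσ, α₂)` with `H(σ, Sα₂)` and `H(Sσ, β₂)` with `H(σ, Θβ₂)`, with
      -- opposite signs; only the terms in `τ₁` and `τ₂` survive.
      simp only [map_sub, map_add, LinearMap.sub_apply, LinearMap.add_apply, map_one, Complex.conj_I,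
        smul_eq_mul, M.adjoint ζ hζ.1, ← M.adjoint' hζ.1]
      ring

end BoundaryForm

end HiggsSurface

end

theorem mainTheorem12 {X : Type*} [TopologicalSpace X] [T2Space X] [SigmaCompactSpace X]
    [ChartedSpace ℂ X] [IsManifold 𝓘(ℂ, ℂ) ω X]
    {F : Type*} [NormedAddCommGroup F] [NormedSpace ℂ F] [FiniteDimensional ℂ F]
    {E : X → Type*} [∀ x, AddCommGroup (E x)] [∀ x, Module ℂ (E x)]
    [TopologicalSpace (TotalSpace F E)] [∀ x, TopologicalSpace (E x)]
    [FiberBundle F E] [VectorBundle ℂ F E] [ContMDiffVectorBundle ω F E 𝓘(ℂ, ℂ)]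
    (g : ConformalMetric X) (θ : HiggsField F E) (h : HermitianMetric F E)
    (hh : IsHarmonicMetric θ h)
    (τ₁ τ₂ : ∀ x : X, T x →ₗ[ℝ] E x)
    (hτ₁ : IsHarmonicForm g θ h τ₁) (hτ₂ : IsHarmonicForm g θ h τ₂)
    (U : Set X) (hUo : IsOpen U) (hUsc : SimplyConnectedSpace U) (hUc : IsCompact (closure U))
    (hU : HasSmoothBoundary U) :
    (∃ σ : ∀ x, E x, IsPrimitiveOn θ h U τ₁ σ) ∧
    ∀ σ : ∀ x, E x, IsPrimitiveOn θ h U τ₁ σ →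
      ∃ σ₁ : ∀ x, E x, (∀ x ∈ U, σ₁ x = σ x) ∧ ContinuousSectionOn F (closure U) σ₁ ∧
        Complex.I * surfaceIntegral U (fun x v w =>
            h.wedge (fun y => part10 (τ₁ y)) (fun y => part10 (τ₂ y)) x v w
              - h.wedge (fun y => part01 (τ₁ y)) (fun y => part01 (τ₂ y)) x v w) =
          Complex.I * boundaryIntegral hU (fun x v =>
            h.inner x (σ₁ x) (part10 (τ₂ x) v) - h.inner x (σ₁ x) (part01 (τ₂ x) v)) := by
  refine ⟨exists_primitive hh hτ₁ hUo hUsc, fun σ hσ => ?_⟩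
  -- A given `σ` may take any values off `U`, so the boundary values come from a new section
  -- agreeing with it on `U`.
  obtain ⟨σ₁, h₁, hloc⟩ := exists_boundary_extension hh hτ₁ hUo hU hσ
  refine ⟨σ₁, h₁, continuousSectionOn_of_local hloc, congrArg (Complex.I * ·) ?_⟩
  exact (isStokesPair_boundaryForm hh hτ₂ hloc).surfaceIntegral_eq_boundaryIntegral hUo hUc hU
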